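/- **Setting.** For a finite set $\mathcal C\subset\mathcal S^{k-1}$ (a $k$-dimensional spherical code) let $\operatorname{dec}:\mathbb R^k\to\mathcal C$ send each point to a nearest element of $\mathcal C$, ties being broken arbitrarily. The project-and-partition hash family of $\mathcal C$ on $\mathbb R^d$ consists of the maps $h_A(x)=\operatorname{dec}(Ax)$, where $A\in\mathbb R^{k\times d}$ has independent $\mathcal N(0,1)$ entries. For unit vectors $x,y\in\mathbb R^d$ at angle $\theta$ put $p_1=\Pr_A\big(h_A(x)=h_A(y)\big)$; let $p_2=\Pr\big(\operatorname{dec}(a)=\operatorname{dec}(a')\big)$ for independent $a,a'\sim\mathcal N(0,I_k)$; and let $\rho=\log p_1/\log p_2$ be the query exponent. The code $\mathcal C$ is isogonal if for all $u,v\in\mathcal C$ there is an isometry $f$ of $\mathbb R^k$ with $f(u)=v$ and $f(\mathcal C)=\mathcal C$ (for example, the vertices of a regular polygon, including the $2$-gon). **Theorem (in two dimensions, the triangle is optimal).** Let $\theta\in(0,\frac{\pi}{2})$, and let $\mathcal T\subset\mathcal S^1$ be the vertex set of an equilateral triangle (which is an isogonal code). Then, for every $d$ and all unit vectors $x,y\in\mathbb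 R^d$ at angle $\theta$: 1. the query exponent of $\mathcal T$ is $$\rho(\mathcal T)=\ln\left[\frac13+3\left(\frac{\pi-\theta}{2\pi}\right)^2-3\left(\frac{\arccos(\frac12\cos\theta)}{2\pi}\right)^2\right]\Big/\ln\left[\frac13\right];$$ 2. $\rho(\mathcal T)\le\rho(\mathcal C)$ for every isogonal spherical code $\mathcal C\subset\mathcal S^1$ with $|\mathcal C|\ge 2$, in particular for all regular polygons; 3. $\rho(\mathcal T)<\rho(\{v,-v\})$ for every $k\geq 1$ and every $v\in\mathcal S^{k-1}$; that is, the triangle is strictly better than hyperplane hashing ($k=1$) and than the $2$-gon in the plane ($k=2$). Moreover, for every spherical code, $p_2$ is the limit as $d\to\infty$ of the probability $\Pr\big(h_A(x)=h_A(y)\big)$ that two independent uniformly random points $x,y\in\mathcal S^{d-1}$ collide, where $A$, $x$ and $y$ are independent. -/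

import Mathlib

open MeasureTheory ProbabilityTheory Filter Topology

noncomputable section

/-- A spherical code in dimension `k`: a finite set of unit vectors of Euclidean space. -/
def IsSphericalCode {k : ℕ} (C : Set (EuclideanSpace ℝ (Fin k))) : Prop :=
  C.Finite ∧ C ⊆ Metric.sphere 0 1

/-- Vertex-transitivity: isometries of the space preserving `C` act transitively on `C`. -/
def IsIsogonal {k : ℕ} (C : Set (EuclideanSpace ℝ (Fin k))) : Prop :=
  ∀ u ∈ C, ∀ v ∈ C, ∃ f : EuclideanSpace ℝ (Fin k) ≃ᵢ EuclideanSpace ℝ (Fin k),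
    f u = v ∧ f '' C = C

/-- The (closed) Voronoi cell of the code word `u`. -/
def voronoiCell {k : ℕ} (C : Set (EuclideanSpace ℝ (Fin k))) (u : EuclideanSpace ℝ (Fin k)) :
    Set (EuclideanSpace ℝ (Fin k)) :=
  {z | ∀ v ∈ C, dist z u ≤ dist z v}

/-- A decoding function: it maps every point to a nearest code word, ties being broken in any
way. -/
def IsDecoder {k : ℕ} (C : Set (EuclideanSpace ℝ (Fin k)))
    (dec : EuclideanSpace ℝ (Fin k) → EuclideanSpace ℝ (Fin k)) : Prop :=
  ∀ z, dec z ∈ C ∧ z ∈ voronoiCell C (dec z)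

/-- The law of a random `k × d` matrix with independent standard normal entries. -/
def gaussianMatrix (k d : ℕ) : Measure (Fin k → Fin d → ℝ) :=
  Measure.pi fun _ => Measure.pi fun _ => gaussianReal 0 1

/-- The project-and-partition hash function `x ↦ dec (A x)`. -/
def ppHash {k d : ℕ} (dec : EuclideanSpace ℝ (Fin k) → EuclideanSpace ℝ (Fin k))
    (A : Fin k → Fin d → ℝ) (x : EuclideanSpace ℝ (Fin d)) : EuclideanSpace ℝ (Fin k) :=
  dec (WithLp.toLp 2 (Matrix.mulVec (Matrix.of A) (WithLp.ofLp x)))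

/-- The probability, over the random hash function, that `x` and `y` collide. -/
def pairCollision {k d : ℕ} (dec : EuclideanSpace ℝ (Fin k) → EuclideanSpace ℝ (Fin k))
    (x y : EuclideanSpace ℝ (Fin d)) : ℝ :=
  (gaussianMatrix k d).real {A | ppHash dec A x = ppHash dec A y}

/-- The probability that two independent projected vectors, each standard Gaussian in `ℝᵏ`,
receive the same hash value. -/
def indepCollision {k : ℕ} (dec : EuclideanSpace ℝ (Fin k) → EuclideanSpace ℝ (Fin k)) : ℝ :=
  ((stdGaussian (EuclideanSpace ℝ (Fin k))).prod (stdGaussian (EuclideanSpace ℝ (Fin k)))).real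
    {z | dec z.1 = dec z.2}

/-- The uniform probability measure on the unit sphere of `ℝᵈ` (for `d ≥ 1`). -/
def uniformSphere (d : ℕ) : Measure (Metric.sphere (0 : EuclideanSpace ℝ (Fin d)) 1) :=
  (volume : Measure (EuclideanSpace ℝ (Fin d))).toSphere[|Set.univ]

/-- The probability, over the random hash function and two independent uniformly random points
of the unit sphere of `ℝᵈ`, that the two points collide. -/
def randomCollision {k : ℕ} (dec : EuclideanSpace ℝ (Fin k) → EuclideanSpace ℝ (Fin k))
    (d : ℕ) : ℝ :=
  ((gaussianMatrix k d).prod ((uniformSphere d).prod (uniformSphere d))).real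
    {ω | ppHash dec ω.1 (ω.2.1 : EuclideanSpace ℝ (Fin d)) = ppHash dec ω.1 ω.2.2}

/-- The query exponent `log p₁ / log p₂`, where `p₁` is the collision probability of the pair
`x`, `y` at the target angle. -/
def queryExponent {k d : ℕ} (dec : EuclideanSpace ℝ (Fin k) → EuclideanSpace ℝ (Fin k))
    (x y : EuclideanSpace ℝ (Fin d)) : ℝ :=
  Real.log (pairCollision dec x y) / Real.log (indepCollision dec)

/-- `T` is the vertex set of an equilateral triangle inscribed in the unit circle. -/
def IsEquilateralTriangle (T : Set (EuclideanSpace ℝ (Fin 2))) : Prop :=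
  T ⊆ Metric.sphere 0 1 ∧ T.ncard = 3 ∧
    ∃ r : ℝ, ∀ u ∈ T, ∀ v ∈ T, u ≠ v → dist u v = r

end

/-! A Gaussian matrix sends two unit vectors at angle θ to standard Gaussian vectors of correlation
c = cos θ. Ties lie in finitely many hyperplanes and have probability zero, so p₁ is the sum over
the Voronoi cells of the probability (`noiseStability`) that both vectors fall in the cell, and p₂
is the same sum at c = 0. The n cells of an isogonal code have equal measure, whence p₂ = 1/n.

In the plane a cell is an angular sector. In polar coordinates the radii integrate out and leave a
kernel in the difference of the two angles whose second antiderivative is elementary: a sector of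
opening t has noise stability D(t)/(4π²), where D(t) = t² − arccos(−c cos t)² + arccos(−c)²
(`sector_collision`). Hence p₁ = n·D(2π/n)/(4π²), and the problem concerns functions of one
variable. For the antipodal pair p₁ = 1 − θ/π in every dimension, because only the projections onto
v matter. Its exponent separates the triangle from the codes with at least four words.

For n ≥ 4, put l = 2θ/π. The inequality t·D'(t) ≥ (1 + l)·D(t) on [0, π/2] (`sector_slope`)
integrates to log p₁ ≤ 2 log(1 − θ/π) − l·log(n/4). Concavity of the logarithm gives log(1 − θ/π) ≥
−l·log 2, and together these put the exponent at or above that of the pair.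

For n = 3, p₁ and (1 − θ/π)^(log 3/log 2) agree at θ = 0 and at θ = π/2, and the ratio of their
derivatives is strictly increasing; by Cauchy's mean value theorem p₁ is strictly larger in between
(`lt_log_isogonalCollision_three`).

The limit statement holds because the inner product of two random points of the sphere has second
moment 1/d, while noise stability is bounded and continuous at correlation zero. -/

open scoped RealInnerProductSpace ENNReal

/-! ### Gaussian projections of a pair of vectors -/

/-- The projection `A x` as a point of Euclidean space. -/
noncomputable def matProj {k d : ℕ} (A : Fin k → Fin d → ℝ) (x : EuclideanSpace ℝ (Fin d)) :
    EuclideanSpace ℝ (Fin k) :=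
  WithLp.toLp 2 (Matrix.mulVec (Matrix.of A) (WithLp.ofLp x))

/-- Turns a pair of independent standard Gaussian vectors into a pair with correlation `c`. -/
noncomputable def correlate {F : Type*} [AddCommGroup F] [Module ℝ F] (c : ℝ) (z : F × F) : F × F :=
  (z.1, c • z.1 + √(1 - c ^ 2) • z.2)

theorem matProj_apply {k d : ℕ} (A : Fin k → Fin d → ℝ) (x : EuclideanSpace ℝ (Fin d))
    (i : Fin k) : matProj A x i = ∑ j, A i j * x j := rfl

theorem continuous_matProj {k d : ℕ} :
    Continuous fun p : (Fin k → Fin d → ℝ) × EuclideanSpace ℝ (Fin d) => matProj p.1 p.2 := by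
  refine (PiLp.continuous_toLp 2 _).comp (continuous_pi fun i => ?_)
  change Continuous fun p : (Fin k → Fin d → ℝ) × EuclideanSpace ℝ (Fin d) =>
    ∑ j, p.1 i j * p.2 j
  fun_prop

theorem measurable_matProj_left {k d : ℕ} (x : EuclideanSpace ℝ (Fin d)) :
    Measurable fun A : Fin k → Fin d → ℝ => matProj A x :=
  (continuous_matProj.comp (Continuous.prodMk_left x)).measurable

theorem continuous_correlate {F : Type*} [NormedAddCommGroup F] [NormedSpace ℝ F] (c : ℝ) :
    Continuous (correlate c : F × F → F × F) := by
  unfold correlate; fun_prop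

theorem measurable_correlate {F : Type*} [NormedAddCommGroup F] [NormedSpace ℝ F]
    [MeasurableSpace F] [BorelSpace F] [SecondCountableTopology F] (c : ℝ) :
    Measurable (correlate c : F × F → F × F) :=
  (continuous_correlate c).measurable

instance {k d : ℕ} : IsProbabilityMeasure (gaussianMatrix k d) := by
  unfold gaussianMatrix; infer_instance

theorem integral_cexp_gaussianMatrix {k d : ℕ} (w : Fin k → Fin d → ℝ) :
    ∫ A, Complex.exp (((∑ i, ∑ j, A i j * w i j : ℝ) : ℂ) * Complex.I) ∂(gaussianMatrix k d) =
      Complex.exp (-((∑ i, ∑ j, w i j ^ 2 : ℝ) : ℂ) / 2) := by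
  have h1 : ∀ A : Fin k → Fin d → ℝ,
      Complex.exp (((∑ i, ∑ j, A i j * w i j : ℝ) : ℂ) * Complex.I) =
        ∏ i, ∏ j, Complex.exp ((w i j : ℂ) * (A i j : ℂ) * Complex.I) := by
    intro A
    simp_rw [← Complex.exp_sum]
    congr 1
    push_cast
    simp_rw [Finset.sum_mul]
    refine Finset.sum_congr rfl fun i _ => Finset.sum_congr rfl fun j _ => by ring
  simp_rw [h1]
  rw [gaussianMatrix, integral_fintype_prod_eq_prod
    (f := fun i (a : Fin d → ℝ) => ∏ j, Complex.exp ((w i j : ℂ) * (a j : ℂ) * Complex.I))]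
  simp_rw [fun i => integral_fintype_prod_eq_prod (μ := fun _ : Fin d => gaussianReal 0 1)
    (f := fun j (a : ℝ) => Complex.exp ((w i j : ℂ) * (a : ℂ) * Complex.I)),
    ← charFun_apply_real, charFun_gaussianReal, ← Complex.exp_sum]
  congr 1
  push_cast
  rw [neg_div, Finset.sum_div, ← Finset.sum_neg_distrib]
  refine Finset.sum_congr rfl fun i _ => ?_
  rw [Finset.sum_div, ← Finset.sum_neg_distrib]
  refine Finset.sum_congr rfl fun j _ => ?_
  simp

/-- The left side is the squared Frobenius norm of p xᵀ + q yᵀ, the matrix paired with A in the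
joint characteristic function of (Ax, Ay). -/
theorem sum_bilin_sq {k d : ℕ} (p q : EuclideanSpace ℝ (Fin k)) (x y : EuclideanSpace ℝ (Fin d)) :
    ∑ i, ∑ j, (p i * x j + q i * y j) ^ 2 =
      ‖p‖ ^ 2 * ‖x‖ ^ 2 + ‖q‖ ^ 2 * ‖y‖ ^ 2 + 2 * ⟪p, q⟫ * ⟪x, y⟫ := by
  simp only [EuclideanSpace.real_norm_sq_eq, PiLp.inner_apply, RCLike.inner_apply, conj_trivial]
  simp_rw [mul_assoc, Finset.sum_mul_sum, Finset.mul_sum, ← Finset.sum_add_distrib]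
  refine Finset.sum_congr rfl fun i _ => Finset.sum_congr rfl fun j _ => by ring

/-- Two unit vectors are projected to a pair of correlated standard Gaussian vectors. -/
theorem map_gaussianMatrix_pair {k d : ℕ} (x y : EuclideanSpace ℝ (Fin d)) (hx : ‖x‖ = 1)
    (hy : ‖y‖ = 1) :
    (gaussianMatrix k d).map (fun A => (matProj A x, matProj A y)) =
      ((stdGaussian (EuclideanSpace ℝ (Fin k))).prod
        (stdGaussian (EuclideanSpace ℝ (Fin k)))).map (correlate ⟪x, y⟫) := by
  have hm : Measurable fun A : Fin k → Fin d → ℝ => (matProj A x, matProj A y) :=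
    (measurable_matProj_left x).prodMk (measurable_matProj_left y)
  have hc : ⟪x, y⟫ ^ 2 ≤ 1 := by
    have := abs_real_inner_le_norm x y
    rw [hx, hy] at this
    rw [sq_le_one_iff_abs_le_one]; linarith
  have : IsProbabilityMeasure ((gaussianMatrix k d).map
      (fun A => (matProj A x, matProj A y))) := Measure.isProbabilityMeasure_map hm.aemeasurable
  have : IsProbabilityMeasure (((stdGaussian (EuclideanSpace ℝ (Fin k))).prod
        (stdGaussian (EuclideanSpace ℝ (Fin k)))).map (correlate ⟪x, y⟫)) :=
    Measure.isProbabilityMeasure_map (measurable_correlate _).aemeasurable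
  apply Measure.ext_of_charFunDual
  ext Λ
  -- Riesz representation on each factor turns a functional on the product into a pair of vectors.
  obtain ⟨p, q, hpq⟩ : ∃ p q : EuclideanSpace ℝ (Fin k), ∀ z, Λ z = ⟪z.1, p⟫ + ⟪z.2, q⟫ := by
    refine ⟨(InnerProductSpace.toDual ℝ _).symm (Λ.comp (ContinuousLinearMap.inl ℝ _ _)),
      (InnerProductSpace.toDual ℝ _).symm (Λ.comp (ContinuousLinearMap.inr ℝ _ _)), fun z => ?_⟩
    rw [real_inner_comm, real_inner_comm _ z.2, InnerProductSpace.toDual_symm_apply,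
      InnerProductSpace.toDual_symm_apply]
    simp [← map_add]
  rw [charFunDual_apply, charFunDual_apply, integral_map hm.aemeasurable (by fun_prop),
    integral_map (measurable_correlate _).aemeasurable (by fun_prop)]
  have h1 : ∀ A : Fin k → Fin d → ℝ, Λ (matProj A x, matProj A y) =
      ∑ i, ∑ j, A i j * (p i * x j + q i * y j) := by
    intro A
    rw [hpq]
    simp only [PiLp.inner_apply, RCLike.inner_apply, conj_trivial, matProj_apply, Finset.mul_sum,
      ← Finset.sum_add_distrib]
    refine Finset.sum_congr rfl fun i _ => Finset.sum_congr rfl fun j _ => by ring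
  have h2 : ∀ z : EuclideanSpace ℝ (Fin k) × EuclideanSpace ℝ (Fin k),
      Complex.exp (Λ (correlate ⟪x, y⟫ z) * Complex.I) =
        Complex.exp (⟪z.1, p + ⟪x, y⟫ • q⟫ * Complex.I) *
        Complex.exp (⟪z.2, √(1 - ⟪x, y⟫ ^ 2) • q⟫ * Complex.I) := by
    intro z
    rw [hpq, ← Complex.exp_add]
    congr 1
    simp only [correlate, inner_add_left, inner_add_right, real_inner_smul_left,
      real_inner_smul_right]
    push_cast
    ring
  simp_rw [h1, h2]
  rw [integral_cexp_gaussianMatrix, integral_prod_mul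
    (f := fun u : EuclideanSpace ℝ (Fin k) => Complex.exp (⟪u, p + ⟪x, y⟫ • q⟫ * Complex.I))
    (g := fun u : EuclideanSpace ℝ (Fin k) =>
      Complex.exp (⟪u, √(1 - ⟪x, y⟫ ^ 2) • q⟫ * Complex.I)),
    ← charFun_apply, ← charFun_apply, charFun_stdGaussian, charFun_stdGaussian,
    ← Complex.exp_add, sum_bilin_sq, hx, hy]
  congr 1
  norm_cast
  -- With c = ⟪x, y⟫, the exponents agree because ‖p + cq‖² + (1 − c²)‖q‖² = ‖p‖² + ‖q‖² + 2c⟪p, q⟫.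
  rw [norm_smul, Real.norm_of_nonneg (Real.sqrt_nonneg _), norm_add_sq_real, norm_smul,
    real_inner_smul_right, mul_pow, mul_pow (√_), Real.sq_sqrt (by linarith), Real.norm_eq_abs,
    sq_abs]
  push_cast
  ring

theorem map_inner_stdGaussian {k : ℕ} (w : EuclideanSpace ℝ (Fin k)) :
    (stdGaussian (EuclideanSpace ℝ (Fin k))).map (fun z => ⟪z, w⟫) =
      gaussianReal 0 (‖w‖₊ ^ 2) := by
  have : IsProbabilityMeasure ((stdGaussian (EuclideanSpace ℝ (Fin k))).map (fun z => ⟪z, w⟫)) :=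
    Measure.isProbabilityMeasure_map (by fun_prop)
  apply Measure.ext_of_charFun
  ext t
  rw [charFun_apply_real, integral_map (by fun_prop) (by fun_prop), charFun_gaussianReal]
  have h : ∀ z : EuclideanSpace ℝ (Fin k), Complex.exp ((t : ℂ) * (⟪z, w⟫ : ℝ) * Complex.I) =
      Complex.exp ((⟪z, t • w⟫ : ℝ) * Complex.I) := fun z => by
    rw [real_inner_smul_right]; push_cast; rfl
  simp_rw [h]
  rw [← charFun_apply, charFun_stdGaussian, norm_smul]
  congr 1
  push_cast
  rw [mul_pow, Real.norm_eq_abs, ← Complex.ofReal_pow, sq_abs]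
  push_cast
  ring

theorem stdGaussian_hyperplane {k : ℕ} {w : EuclideanSpace ℝ (Fin k)} (hw : w ≠ 0) :
    stdGaussian (EuclideanSpace ℝ (Fin k)) {z | ⟪z, w⟫ = 0} = 0 := by
  have h : {z : EuclideanSpace ℝ (Fin k) | ⟪z, w⟫ = 0} = (fun z => ⟪z, w⟫) ⁻¹' {0} := rfl
  rw [h, ← Measure.map_apply (by fun_prop) (measurableSet_singleton _), map_inner_stdGaussian]
  have := nullSingletonClass_gaussianReal (μ := 0) (v := ‖w‖₊ ^ 2) (by simpa using hw)
  exact measure_singleton 0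

/-! ### Voronoi cells and collision probabilities -/

theorem dist_le_dist_iff_inner {k : ℕ} {z u v : EuclideanSpace ℝ (Fin k)} (h : ‖u‖ = ‖v‖) :
    dist z u ≤ dist z v ↔ ⟪z, v⟫ ≤ ⟪z, u⟫ := by
  rw [dist_eq_norm, dist_eq_norm, ← sq_le_sq₀ (norm_nonneg _) (norm_nonneg _), norm_sub_sq_real,
    norm_sub_sq_real, h]
  constructor <;> intro h <;> linarith

theorem mem_voronoiCell_iff_inner {k : ℕ} {C : Set (EuclideanSpace ℝ (Fin k))}
    (hC : C ⊆ Metric.sphere 0 1) {u : EuclideanSpace ℝ (Fin k)} (hu : u ∈ C)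
    {z : EuclideanSpace ℝ (Fin k)} : z ∈ voronoiCell C u ↔ ∀ v ∈ C, ⟪z, v⟫ ≤ ⟪z, u⟫ := by
  refine forall₂_congr fun v hv => dist_le_dist_iff_inner ?_
  rw [mem_sphere_zero_iff_norm.1 (hC hu), mem_sphere_zero_iff_norm.1 (hC hv)]

theorem isClosed_voronoiCell {k : ℕ} (C : Set (EuclideanSpace ℝ (Fin k)))
    (u : EuclideanSpace ℝ (Fin k)) : IsClosed (voronoiCell C u) := by
  have : voronoiCell C u = ⋂ v ∈ C, {z | dist z u ≤ dist z v} := by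
    ext z; simp [voronoiCell]
  rw [this]
  exact isClosed_biInter fun v _ => isClosed_le (by fun_prop) (by fun_prop)

theorem measurableSet_voronoiCell {k : ℕ} (C : Set (EuclideanSpace ℝ (Fin k)))
    (u : EuclideanSpace ℝ (Fin k)) : MeasurableSet (voronoiCell C u) :=
  (isClosed_voronoiCell C u).measurableSet

/-- A point of both cells is equidistant from u and v, hence lies on the hyperplane orthogonal to u
− v. -/
theorem voronoiCell_inter_null {k : ℕ} {C : Set (EuclideanSpace ℝ (Fin k))}
    (hC : C ⊆ Metric.sphere 0 1) {u v : EuclideanSpace ℝ (Fin k)} (hu : u ∈ C) (hv : v ∈ C)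
    (huv : u ≠ v) :
    stdGaussian (EuclideanSpace ℝ (Fin k)) (voronoiCell C u ∩ voronoiCell C v) = 0 := by
  refine measure_mono_null (fun z hz => ?_) (stdGaussian_hyperplane (sub_ne_zero.2 huv))
  have h1 := (mem_voronoiCell_iff_inner hC hu).1 hz.1 v hv
  have h2 := (mem_voronoiCell_iff_inner hC hv).1 hz.2 u hu
  simp only [Set.mem_ofPred_eq, inner_sub_right]
  linarith

/-- Almost surely a standard Gaussian point lies in no cell but that of its code word. -/
theorem ae_mem_voronoiCell_iff {Ω : Type*} [MeasurableSpace Ω] {P : Measure Ω} {k : ℕ}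
    {C : Set (EuclideanSpace ℝ (Fin k))}
    {dec : EuclideanSpace ℝ (Fin k) → EuclideanSpace ℝ (Fin k)} (hC : IsSphericalCode C)
    (hd : IsDecoder C dec) {X : Ω → EuclideanSpace ℝ (Fin k)} (hX : Measurable X)
    (hXl : P.map X = stdGaussian (EuclideanSpace ℝ (Fin k))) :
    ∀ᵐ ω ∂P, ∀ u ∈ C, X ω ∈ voronoiCell C u ↔ dec (X ω) = u := by
  have h : ∀ u ∈ C, ∀ v ∈ C, u ≠ v →
      ∀ᵐ ω ∂P, ¬ (X ω ∈ voronoiCell C u ∧ X ω ∈ voronoiCell C v) := by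
    intro u hu v hv huv
    have h0 := voronoiCell_inter_null hC.2 hu hv huv
    rw [← hXl, Measure.map_apply hX
      ((measurableSet_voronoiCell C u).inter (measurableSet_voronoiCell C v))] at h0
    rw [ae_iff]
    simp only [not_not]
    exact h0
  have h' : ∀ᵐ ω ∂P, ∀ u ∈ C, ∀ v ∈ C, u ≠ v →
      ¬ (X ω ∈ voronoiCell C u ∧ X ω ∈ voronoiCell C v) := by
    rw [ae_ball_iff hC.1.countable]
    intro u hu
    rw [ae_ball_iff hC.1.countable]
    intro v hv
    rw [ae_all_iff]
    exact h u hu v hv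
  filter_upwards [h'] with ω hω u hu
  constructor
  · intro hXu
    by_contra hne
    exact hω _ (hd (X ω)).1 u hu hne ⟨(hd (X ω)).2, hXu⟩
  · rintro rfl
    exact (hd (X ω)).2

/-- The collision probability of two standard Gaussian vectors is the sum over the cells of the
probabilities that both lie in the cell. -/
theorem collision_eq_sum {Ω : Type*} [MeasurableSpace Ω] {P : Measure Ω} [IsProbabilityMeasure P]
    {k : ℕ} {C : Set (EuclideanSpace ℝ (Fin k))}
    {dec : EuclideanSpace ℝ (Fin k) → EuclideanSpace ℝ (Fin k)} (hC : IsSphericalCode C)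
    (hd : IsDecoder C dec) {X Y : Ω → EuclideanSpace ℝ (Fin k)} (hX : Measurable X)
    (hY : Measurable Y) (hXl : P.map X = stdGaussian (EuclideanSpace ℝ (Fin k)))
    (hYl : P.map Y = stdGaussian (EuclideanSpace ℝ (Fin k))) :
    P.real {ω | dec (X ω) = dec (Y ω)} =
      ∑ u ∈ hC.1.toFinset, P.real {ω | X ω ∈ voronoiCell C u ∧ Y ω ∈ voronoiCell C u} := by
  have hX' := ae_mem_voronoiCell_iff hC hd hX hXl
  have hY' := ae_mem_voronoiCell_iff hC hd hY hYl
  have hms : ∀ u, MeasurableSet {ω | X ω ∈ voronoiCell C u ∧ Y ω ∈ voronoiCell C u} := fun u =>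
    (hX (measurableSet_voronoiCell C u)).inter (hY (measurableSet_voronoiCell C u))
  have h1 : {ω | dec (X ω) = dec (Y ω)} =ᵐ[P]
      ⋃ u ∈ hC.1.toFinset, {ω | X ω ∈ voronoiCell C u ∧ Y ω ∈ voronoiCell C u} := by
    filter_upwards [hX', hY'] with ω h1 h2
    apply propext
    change dec (X ω) = dec (Y ω) ↔ ω ∈ ⋃ u ∈ hC.1.toFinset, _
    simp only [Set.mem_iUnion, Set.Finite.mem_toFinset, Set.mem_ofPred_eq, exists_prop]
    constructor
    · intro h
      exact ⟨dec (X ω), (hd _).1, (hd _).2, h ▸ (hd _).2⟩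
    · rintro ⟨u, hu, hx, hy⟩
      rw [(h1 u hu).1 hx, (h2 u hu).1 hy]
  rw [measureReal_congr h1, measureReal_def, measure_biUnion_finset₀]
  · rw [ENNReal.toReal_sum fun u _ => measure_ne_top _ _]; rfl
  · intro u hu v hv huv
    rw [Finset.mem_coe, Set.Finite.mem_toFinset] at hu hv
    refine measure_mono_null (t := {ω | ¬ ∀ u ∈ C, X ω ∈ voronoiCell C u ↔ dec (X ω) = u}) ?_ hX'
    rintro ω ⟨h1, h2⟩ h
    exact huv (((h u hu).1 h1.1).symm.trans ((h v hv).1 h2.1))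
  · exact fun u _ => (hms u).nullMeasurableSet

/-- A vector always collides with itself, so `collision_eq_sum` with X = Y gives total mass one. -/
theorem sum_measure_voronoiCell {k : ℕ} {C : Set (EuclideanSpace ℝ (Fin k))}
    {dec : EuclideanSpace ℝ (Fin k) → EuclideanSpace ℝ (Fin k)} (hC : IsSphericalCode C)
    (hd : IsDecoder C dec) :
    ∑ u ∈ hC.1.toFinset, (stdGaussian (EuclideanSpace ℝ (Fin k))).real (voronoiCell C u) = 1 := by
  have h := collision_eq_sum (P := stdGaussian (EuclideanSpace ℝ (Fin k))) hC hd
    measurable_id measurable_id Measure.map_id Measure.map_id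
  simpa using h.symm

/-! ### Noise stability -/

/-- The probability that two Gaussian vectors with correlation `c` both lie in `S`. -/
noncomputable def noiseStability {k : ℕ} (S : Set (EuclideanSpace ℝ (Fin k))) (c : ℝ) : ℝ :=
  ((stdGaussian (EuclideanSpace ℝ (Fin k))).prod (stdGaussian (EuclideanSpace ℝ (Fin k)))).real
    {z | (correlate c z).1 ∈ S ∧ (correlate c z).2 ∈ S}

theorem noiseStability_zero {k : ℕ} (S : Set (EuclideanSpace ℝ (Fin k))) :
    noiseStability S 0 = (stdGaussian (EuclideanSpace ℝ (Fin k))).real S ^ 2 := by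
  have h : {z : EuclideanSpace ℝ (Fin k) × EuclideanSpace ℝ (Fin k) |
      (correlate 0 z).1 ∈ S ∧ (correlate 0 z).2 ∈ S} = S ×ˢ S := by
    ext z; simp [correlate, Set.mem_prod]
  rw [noiseStability, h, measureReal_prod_prod, sq]

theorem map_matProj {k d : ℕ} (x : EuclideanSpace ℝ (Fin d)) (hx : ‖x‖ = 1) :
    (gaussianMatrix k d).map (fun A => matProj A x) = stdGaussian (EuclideanSpace ℝ (Fin k)) := by
  have h := congrArg Measure.fst (map_gaussianMatrix_pair (k := k) x x hx hx)
  rw [Measure.fst, Measure.map_map measurable_fst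
    ((measurable_matProj_left x).prodMk (measurable_matProj_left x)), Measure.fst,
    Measure.map_map measurable_fst (measurable_correlate _)] at h
  have h2 : Prod.fst ∘ (correlate ⟪x, x⟫ : EuclideanSpace ℝ (Fin k) × EuclideanSpace ℝ (Fin k) →
      _) = Prod.fst := rfl
  rw [h2] at h
  change (gaussianMatrix k d).map (fun A => matProj A x) = _ at h
  rw [h]
  exact Measure.map_fst_prod.trans (by simp)

theorem measureReal_matProj_mem {k d : ℕ} (x y : EuclideanSpace ℝ (Fin d)) (hx : ‖x‖ = 1)
    (hy : ‖y‖ = 1) {S : Set (EuclideanSpace ℝ (Fin k))} (hS : MeasurableSet S) :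
    (gaussianMatrix k d).real {A | matProj A x ∈ S ∧ matProj A y ∈ S} =
      noiseStability S ⟪x, y⟫ := by
  have h := congrArg (fun m => m.real (S ×ˢ S)) (map_gaussianMatrix_pair (k := k) x y hx hy)
  simp only at h
  rw [map_measureReal_apply ((measurable_matProj_left x).prodMk (measurable_matProj_left y))
    (hS.prod hS), map_measureReal_apply (measurable_correlate _) (hS.prod hS)] at h
  exact h

theorem pairCollision_eq_sum {k d : ℕ} {C : Set (EuclideanSpace ℝ (Fin k))}
    {dec : EuclideanSpace ℝ (Fin k) → EuclideanSpace ℝ (Fin k)} (hC : IsSphericalCode C)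
    (hd : IsDecoder C dec) (x y : EuclideanSpace ℝ (Fin d)) (hx : ‖x‖ = 1) (hy : ‖y‖ = 1) :
    pairCollision dec x y =
      ∑ u ∈ hC.1.toFinset, noiseStability (voronoiCell C u) ⟪x, y⟫ := by
  have h := collision_eq_sum hC hd (measurable_matProj_left x) (measurable_matProj_left y)
    (map_matProj (k := k) x hx) (map_matProj y hy)
  simp_rw [measureReal_matProj_mem x y hx hy (measurableSet_voronoiCell C _)] at h
  exact h

theorem indepCollision_eq_sum {k : ℕ} {C : Set (EuclideanSpace ℝ (Fin k))}
    {dec : EuclideanSpace ℝ (Fin k) → EuclideanSpace ℝ (Fin k)} (hC : IsSphericalCode C)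
    (hd : IsDecoder C dec) :
    indepCollision dec = ∑ u ∈ hC.1.toFinset, noiseStability (voronoiCell C u) 0 := by
  have h := collision_eq_sum (P := (stdGaussian (EuclideanSpace ℝ (Fin k))).prod
      (stdGaussian (EuclideanSpace ℝ (Fin k)))) hC hd measurable_fst measurable_snd
      (Measure.map_fst_prod.trans (by simp)) (Measure.map_snd_prod.trans (by simp))
  rw [indepCollision, h]
  refine Finset.sum_congr rfl fun u _ => ?_
  simp [noiseStability, correlate]

/-! ### Cells of isogonal codes and equilateral triangles -/

theorem smul_mem_voronoiCell {k : ℕ} {C : Set (EuclideanSpace ℝ (Fin k))}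
    (hC : C ⊆ Metric.sphere 0 1) {u : EuclideanSpace ℝ (Fin k)} (hu : u ∈ C)
    {z : EuclideanSpace ℝ (Fin k)} (hz : z ∈ voronoiCell C u) {t : ℝ} (ht : 0 ≤ t) :
    t • z ∈ voronoiCell C u := by
  rw [mem_voronoiCell_iff_inner hC hu] at hz ⊢
  intro v hv
  rw [real_inner_smul_left, real_inner_smul_left]
  exact mul_le_mul_of_nonneg_left (hz v hv) ht

theorem isometryEquiv_mem_voronoiCell {k : ℕ} {C : Set (EuclideanSpace ℝ (Fin k))}
    (f : EuclideanSpace ℝ (Fin k) ≃ᵢ EuclideanSpace ℝ (Fin k)) (hf : f '' C = C)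
    {u z : EuclideanSpace ℝ (Fin k)} (hz : z ∈ voronoiCell C u) : f z ∈ voronoiCell C (f u) := by
  intro v hv
  rw [← hf] at hv
  obtain ⟨w, hw, rfl⟩ := hv
  rw [f.dist_eq, f.dist_eq]
  exact hz w hw

/-- The linear part of an isometry preserving `C` maps Voronoi cells into Voronoi cells, these
being closed cones. -/
theorem linear_part_mem_voronoiCell {k : ℕ} {C : Set (EuclideanSpace ℝ (Fin k))}
    (hC : C ⊆ Metric.sphere 0 1) (f : EuclideanSpace ℝ (Fin k) ≃ᵢ EuclideanSpace ℝ (Fin k))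
    (hf : f '' C = C) {u z : EuclideanSpace ℝ (Fin k)} (hu : u ∈ C)
    (hz : z ∈ voronoiCell C u) : f.toRealLinearIsometryEquiv z ∈ voronoiCell C (f u) := by
  have hfu : f u ∈ C := hf ▸ Set.mem_image_of_mem f hu
  -- An isometry preserving the code need not fix the origin. With L its linear part,
  -- f((n+1)z)/(n+1) = Lz + f(0)/(n+1) stays in the cell and tends to Lz.
  have h : ∀ n : ℕ, f.toRealLinearIsometryEquiv z + (1 / ((n : ℝ) + 1)) • f 0 ∈
      voronoiCell C (f u) := by
    intro n
    have hn : (0 : ℝ) < n + 1 := by positivity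
    have h1 := smul_mem_voronoiCell hC hfu (isometryEquiv_mem_voronoiCell f hf
      (smul_mem_voronoiCell hC hu hz hn.le)) (t := 1 / ((n : ℝ) + 1)) (by positivity)
    have h2 : f (((n : ℝ) + 1) • z) = ((n : ℝ) + 1) • f.toRealLinearIsometryEquiv z + f 0 := by
      rw [← map_smul, IsometryEquiv.toRealLinearIsometryEquiv_apply, sub_add_cancel]
    rw [h2, smul_add, smul_smul, one_div_mul_cancel hn.ne', one_smul] at h1
    exact h1
  have h3 := ((tendsto_one_div_add_atTop_nhds_zero_nat (𝕜 := ℝ)).smul_const (f 0)).const_add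
    (f.toRealLinearIsometryEquiv z)
  rw [zero_smul, add_zero] at h3
  exact (isClosed_voronoiCell C (f u)).mem_of_tendsto h3 (Eventually.of_forall h)

theorem IsIsogonal.measure_voronoiCell_eq {k : ℕ} {C : Set (EuclideanSpace ℝ (Fin k))}
    (hC : IsSphericalCode C) (hi : IsIsogonal C) {u v : EuclideanSpace ℝ (Fin k)} (hu : u ∈ C)
    (hv : v ∈ C) : (stdGaussian (EuclideanSpace ℝ (Fin k))).real (voronoiCell C u) =
      (stdGaussian (EuclideanSpace ℝ (Fin k))).real (voronoiCell C v) := by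
  have key : ∀ u ∈ C, ∀ v ∈ C, (stdGaussian (EuclideanSpace ℝ (Fin k))).real (voronoiCell C u) ≤
      (stdGaussian (EuclideanSpace ℝ (Fin k))).real (voronoiCell C v) := by
    intro u hu v hv
    obtain ⟨f, rfl, hf⟩ := hi u hu v hv
    obtain ⟨Q, hQ⟩ : ∃ Q : EuclideanSpace ℝ (Fin k) ≃ₗᵢ[ℝ] EuclideanSpace ℝ (Fin k),
        ∀ z ∈ voronoiCell C u, Q z ∈ voronoiCell C (f u) :=
      ⟨_, fun z hz => linear_part_mem_voronoiCell hC.2 f hf hu hz⟩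
    have h1 := map_measureReal_apply (μ := stdGaussian (EuclideanSpace ℝ (Fin k)))
      Q.continuous.measurable (measurableSet_voronoiCell C (f u))
    have hQ' : (stdGaussian (EuclideanSpace ℝ (Fin k))).map Q =
        stdGaussian (EuclideanSpace ℝ (Fin k)) := stdGaussian_map Q
    rw [hQ'] at h1
    rw [h1]
    exact measureReal_mono hQ
  exact le_antisymm (key u hu v hv) (key v hv u hu)

theorem IsIsogonal.measure_voronoiCell {k : ℕ} {C : Set (EuclideanSpace ℝ (Fin k))}
    {dec : EuclideanSpace ℝ (Fin k) → EuclideanSpace ℝ (Fin k)} (hC : IsSphericalCode C)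
    (hd : IsDecoder C dec) (hi : IsIsogonal C) {u : EuclideanSpace ℝ (Fin k)} (hu : u ∈ C) :
    (stdGaussian (EuclideanSpace ℝ (Fin k))).real (voronoiCell C u) = 1 / C.ncard := by
  have h := sum_measure_voronoiCell hC hd
  rw [Finset.sum_congr rfl fun v hv =>
    hi.measure_voronoiCell_eq hC (hC.1.mem_toFinset.1 hv) hu, Finset.sum_const, nsmul_eq_mul,
    ← Set.ncard_eq_toFinset_card C hC.1] at h
  exact eq_one_div_of_mul_eq_one_right h

theorem IsEquilateralTriangle.isSphericalCode {T : Set (EuclideanSpace ℝ (Fin 2))}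
    (hT : IsEquilateralTriangle T) : IsSphericalCode T :=
  ⟨Set.finite_of_ncard_ne_zero (by rw [hT.2.1]; norm_num), hT.1⟩

theorem IsEquilateralTriangle.isIsogonal {T : Set (EuclideanSpace ℝ (Fin 2))}
    (hT : IsEquilateralTriangle T) : IsIsogonal T := by
  obtain ⟨hS, -, r, hr⟩ := hT
  intro u hu v hv
  rcases eq_or_ne u v with rfl | huv
  · exact ⟨IsometryEquiv.refl _, rfl, Set.image_id T⟩
  have hn : ∀ w ∈ T, ‖w‖ = 1 := fun w hw => mem_sphere_zero_iff_norm.1 (hS hw)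
  -- The reflection exchanging u and v serves as the isometry: any other vertex is equidistant from
  -- both and so lies on the mirror.
  set R := (Submodule.reflection (Submodule.span ℝ {u - v})ᗮ)
  have h1 : R u = v := Submodule.reflection_sub ((hn u hu).trans (hn v hv).symm)
  have hRR : ∀ w, R (R w) = w := Submodule.reflection_reflection _
  have h2 : R v = u := by rw [← h1, hRR]
  have h3 : ∀ w ∈ T, w ≠ u → w ≠ v → R w = w := by
    intro w hw hwu hwv
    refine Submodule.reflection_mem_subspace_eq_self ?_
    rw [Submodule.mem_orthogonal_singleton_iff_inner_left]
    have h := (hr w hw u hu hwu).trans (hr w hw v hv hwv).symm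
    have e1 := (dist_le_dist_iff_inner ((hn u hu).trans (hn v hv).symm)).1 h.le
    have e2 := (dist_le_dist_iff_inner ((hn v hv).trans (hn u hu).symm)).1 h.ge
    rw [inner_sub_right]; linarith
  have h4 : ∀ w ∈ T, R w ∈ T := by
    intro w hw
    by_cases hwu : w = u
    · rw [hwu, h1]; exact hv
    by_cases hwv : w = v
    · rw [hwv, h2]; exact hu
    rw [h3 w hw hwu hwv]; exact hw
  refine ⟨R.toIsometryEquiv, h1, Set.Subset.antisymm ?_ fun w hw => ⟨R w, h4 w hw, hRR w⟩⟩
  rintro _ ⟨w, hw, rfl⟩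
  exact h4 w hw

/-! ### Planar cells as angular sectors -/

/-- The vector `u` of the plane, turned by a right angle. -/
noncomputable def perp (u : EuclideanSpace ℝ (Fin 2)) : EuclideanSpace ℝ (Fin 2) :=
  !₂[-u 1, u 0]

/-- The point of the plane with coordinates `p` with respect to `u` and `perp u`. -/
noncomputable def frame (u : EuclideanSpace ℝ (Fin 2)) (p : ℝ × ℝ) : EuclideanSpace ℝ (Fin 2) :=
  p.1 • u + p.2 • perp u

/-- The standard Gaussian measure on `ℝ × ℝ`. -/
noncomputable def planeGaussian : Measure (ℝ × ℝ) :=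
  (gaussianReal 0 1).prod (gaussianReal 0 1)

instance : IsProbabilityMeasure planeGaussian := by unfold planeGaussian; infer_instance

theorem continuous_frame (u : EuclideanSpace ℝ (Fin 2)) : Continuous (frame u) := by
  unfold frame; fun_prop

theorem inner_perp_self (u : EuclideanSpace ℝ (Fin 2)) : ⟪perp u, u⟫ = 0 := by
  simp [perp, PiLp.inner_apply, Fin.sum_univ_two]; ring

theorem inner_sq_add_inner_perp_sq (u v : EuclideanSpace ℝ (Fin 2)) (hu : ‖u‖ = 1) :
    ⟪u, v⟫ ^ 2 + ⟪perp u, v⟫ ^ 2 = ‖v‖ ^ 2 := by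
  have h : u 0 ^ 2 + u 1 ^ 2 = 1 := by
    have := EuclideanSpace.real_norm_sq_eq u
    rw [hu, Fin.sum_univ_two] at this
    linarith
  rw [EuclideanSpace.real_norm_sq_eq]
  simp only [perp, PiLp.inner_apply, Fin.sum_univ_two, RCLike.inner_apply, conj_trivial,
    Matrix.cons_val_zero, Matrix.cons_val_one]
  linear_combination (v 0 ^ 2 + v 1 ^ 2) * h

theorem map_frame_planeGaussian {u : EuclideanSpace ℝ (Fin 2)} (hu : ‖u‖ = 1) :
    planeGaussian.map (frame u) = stdGaussian (EuclideanSpace ℝ (Fin 2)) := by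
  have hm := (continuous_frame u).measurable
  have : IsProbabilityMeasure (planeGaussian.map (frame u)) :=
    Measure.isProbabilityMeasure_map hm.aemeasurable
  apply Measure.ext_of_charFun
  ext t
  rw [charFun_apply, integral_map hm.aemeasurable (by fun_prop), charFun_stdGaussian]
  have h : ∀ p : ℝ × ℝ, Complex.exp (⟪frame u p, t⟫ * Complex.I) =
      Complex.exp ((⟪u, t⟫ : ℝ) * (p.1 : ℂ) * Complex.I) *
        Complex.exp ((⟪perp u, t⟫ : ℝ) * (p.2 : ℂ) * Complex.I) := by
    intro p
    rw [← Complex.exp_add]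
    congr 1
    simp only [frame, inner_add_left, real_inner_smul_left]
    push_cast
    ring
  simp_rw [h]
  rw [planeGaussian, integral_prod_mul
    (f := fun a : ℝ => Complex.exp ((⟪u, t⟫ : ℝ) * (a : ℂ) * Complex.I))
    (g := fun a : ℝ => Complex.exp ((⟪perp u, t⟫ : ℝ) * (a : ℂ) * Complex.I)),
    ← charFun_apply_real, ← charFun_apply_real, charFun_gaussianReal, charFun_gaussianReal,
    ← Complex.exp_add]
  congr 1
  have h2 := congrArg (fun r : ℝ => (r : ℂ)) (inner_sq_add_inner_perp_sq u t hu)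
  push_cast at h2 ⊢
  rw [← h2]
  ring

theorem frame_correlate (u : EuclideanSpace ℝ (Fin 2)) (c : ℝ) (z : (ℝ × ℝ) × (ℝ × ℝ)) :
    correlate c (frame u z.1, frame u z.2) =
      (frame u (correlate c z).1, frame u (correlate c z).2) := by
  simp only [correlate, frame, Prod.mk.injEq, true_and, Prod.fst_add, Prod.snd_add, Prod.smul_fst,
    Prod.smul_snd, smul_eq_mul]
  module

theorem noiseStability_eq_planeGaussian {u : EuclideanSpace ℝ (Fin 2)} (hu : ‖u‖ = 1)
    {S : Set (EuclideanSpace ℝ (Fin 2))} (hS : MeasurableSet S) (c : ℝ) :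
    noiseStability S c = (planeGaussian.prod planeGaussian).real
      {z | frame u (correlate c z).1 ∈ S ∧ frame u (correlate c z).2 ∈ S} := by
  have hm := (continuous_frame u).measurable
  have hS' : MeasurableSet {z : EuclideanSpace ℝ (Fin 2) × EuclideanSpace ℝ (Fin 2) |
      (correlate c z).1 ∈ S ∧ (correlate c z).2 ∈ S} :=
    measurable_correlate c (hS.prod hS)
  rw [noiseStability, ← map_frame_planeGaussian hu, Measure.map_prod_map _ _ hm hm,
    map_measureReal_apply (hm.prodMap hm) hS']
  congr 1
  ext z
  change (correlate c (frame u z.1, frame u z.2)).1 ∈ S ∧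
    (correlate c (frame u z.1, frame u z.2)).2 ∈ S ↔ _
  rw [frame_correlate]
  rfl

theorem exists_angle (u v : EuclideanSpace ℝ (Fin 2)) (hu : ‖u‖ = 1) (hv : ‖v‖ = 1)
    (huv : u ≠ v) : ∃ β, 0 < β ∧ β < 2 * Real.pi ∧ ⟪u, v⟫ = Real.cos β ∧
      ⟪perp u, v⟫ = Real.sin β := by
  have h := inner_sq_add_inner_perp_sq u v hu
  rw [hv, one_pow] at h
  have hne : ⟪u, v⟫ ≠ 1 := fun h1 => huv ((inner_eq_one_iff_of_norm_eq_one hu hv).1 h1)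
  set z : ℂ := ⟨⟪u, v⟫, ⟪perp u, v⟫⟩ with hz
  have hz1 : ‖z‖ = 1 := by
    rw [← sq_eq_sq₀ (norm_nonneg _) zero_le_one, ← Complex.normSq_eq_norm_sq, Complex.normSq_apply]
    simp only [hz]
    linarith
  have hz0 : z ≠ 0 := by
    intro h0; rw [h0] at hz1; simp at hz1
  have hcos := Complex.cos_arg hz0
  have hsin := Complex.sin_arg z
  rw [hz1, div_one] at hcos hsin
  have ha0 : z.arg ≠ 0 := by
    intro h0
    rw [h0, Real.cos_zero] at hcos
    exact hne hcos.symm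
  have hp := Real.pi_pos
  -- Negative arguments are shifted by 2π, so that β/2 lies in (0, π) and has positive sine.
  rcases lt_or_gt_of_ne ha0 with h1 | h1
  · refine ⟨z.arg + 2 * Real.pi, by linarith [Complex.neg_pi_lt_arg z], by linarith, ?_, ?_⟩
    · rw [Real.cos_add_two_pi, hcos]
    · rw [Real.sin_add_two_pi, hsin]
  · exact ⟨z.arg, h1, by linarith [Complex.arg_le_pi z], hcos.symm, hsin.symm⟩

/-- The difference cos ψ − cos(ψ − β) equals 2 sin(β/2) sin(β/2 − ψ), and sin(β/2) is positive. -/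
theorem cos_sub_le_cos_iff {β ψ : ℝ} (h0 : 0 < β) (h1 : β < 2 * Real.pi) (h2 : -Real.pi < ψ)
    (h3 : ψ < Real.pi) : Real.cos (ψ - β) ≤ Real.cos ψ ↔
      β / 2 - Real.pi ≤ ψ ∧ ψ ≤ β / 2 := by
  have h : Real.cos ψ - Real.cos (ψ - β) = 2 * Real.sin (β / 2) * Real.sin (β / 2 - ψ) := by
    rw [Real.cos_sub_cos, show (ψ + (ψ - β)) / 2 = -(β / 2 - ψ) by ring,
      show (ψ - (ψ - β)) / 2 = β / 2 by ring, Real.sin_neg]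
    ring
  have hs : 0 < Real.sin (β / 2) := Real.sin_pos_of_pos_of_lt_pi (by linarith) (by linarith)
  constructor
  · intro hle
    have hn : 0 ≤ Real.sin (β / 2 - ψ) := by
      by_contra hneg
      push Not at hneg
      nlinarith
    constructor
    · by_contra hlt
      push Not at hlt
      have : Real.sin (β / 2 - ψ - Real.pi) > 0 :=
        Real.sin_pos_of_pos_of_lt_pi (by linarith) (by linarith)
      rw [Real.sin_sub_pi] at this
      linarith
    · by_contra hlt
      push Not at hlt
      have : Real.sin (β / 2 - ψ) < 0 := Real.sin_neg_of_neg_of_neg_pi_lt (by linarith) (by linarith)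
      linarith
  · rintro ⟨h4, h5⟩
    have : 0 ≤ Real.sin (β / 2 - ψ) := Real.sin_nonneg_of_nonneg_of_le_pi (by linarith) (by linarith)
    nlinarith [mul_nonneg hs.le this]

/-- In polar coordinates, a planar Voronoi cell is an angular sector. -/
theorem voronoiCell_sector {C : Set (EuclideanSpace ℝ (Fin 2))} (hC : IsSphericalCode C)
    {u v : EuclideanSpace ℝ (Fin 2)} (hu : u ∈ C) (hv : v ∈ C) (huv : u ≠ v) :
    ∃ a b : ℝ, -Real.pi ≤ a ∧ a ≤ b ∧ b ≤ Real.pi ∧ ∀ r ψ : ℝ, 0 < r → -Real.pi < ψ → ψ < Real.pi →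
      (frame u (r * Real.cos ψ, r * Real.sin ψ) ∈ voronoiCell C u ↔ a ≤ ψ ∧ ψ ≤ b) := by
  have hn : ∀ w ∈ C, ‖w‖ = 1 := fun w hw => mem_sphere_zero_iff_norm.1 (hC.2 hw)
  have hβ : ∀ w, ∃ β, w ∈ C → w ≠ u → (0 < β ∧ β < 2 * Real.pi ∧ ⟪u, w⟫ = Real.cos β ∧
      ⟪perp u, w⟫ = Real.sin β) := by
    intro w
    by_cases h : w ∈ C ∧ w ≠ u
    · obtain ⟨β, hβ⟩ := exists_angle u w (hn u hu) (hn w h.1) h.2.symm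
      exact ⟨β, fun _ _ => hβ⟩
    · exact ⟨0, fun h1 h2 => absurd ⟨h1, h2⟩ h⟩
  choose β hβ using hβ
  have hcell : ∀ r ψ : ℝ, 0 < r → -Real.pi < ψ → ψ < Real.pi →
      (frame u (r * Real.cos ψ, r * Real.sin ψ) ∈ voronoiCell C u ↔
        ∀ w ∈ C, w ≠ u → β w / 2 - Real.pi ≤ ψ ∧ ψ ≤ β w / 2) := by
    intro r ψ hr h1 h2
    rw [mem_voronoiCell_iff_inner hC.2 hu]
    have huu : ⟪frame u (r * Real.cos ψ, r * Real.sin ψ), u⟫ = r * Real.cos ψ := by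
      simp only [frame, inner_add_left, real_inner_smul_left, inner_perp_self,
        real_inner_self_eq_norm_sq, hn u hu]
      ring
    refine forall₂_congr fun w hw => ?_
    rw [huu]
    by_cases hwu : w = u
    · subst hwu
      rw [huu]
      simp
    · obtain ⟨h3, h4, h5, h6⟩ := hβ w hw hwu
      have h7 : ⟪frame u (r * Real.cos ψ, r * Real.sin ψ), w⟫ = r * Real.cos (ψ - β w) := by
        simp only [frame, inner_add_left, real_inner_smul_left, h5, h6, Real.cos_sub]
        ring
      rw [h7, mul_le_mul_iff_right₀ hr, cos_sub_le_cos_iff h3 h4 h1 h2]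
      simp [hwu]
  have hfin : (C \ {u}).Finite := hC.1.subset Set.sdiff_subset
  have hne : (C \ {u}).Nonempty := ⟨v, hv, huv.symm⟩
  -- Each word at angle β imposes β/2 − π ≤ ψ ≤ β/2. Only the words of largest and smallest angle,
  -- the two neighbours of u, matter.
  obtain ⟨w₁, hw₁, hmax⟩ := Set.exists_max_image _ β hfin hne
  obtain ⟨w₂, hw₂, hmin⟩ := Set.exists_min_image _ β hfin hne
  have e1 := hβ w₁ hw₁.1 hw₁.2
  have e2 := hβ w₂ hw₂.1 hw₂.2
  refine ⟨β w₁ / 2 - Real.pi, β w₂ / 2, by linarith, by linarith, by linarith, fun r ψ hr h1 h2 => ?_⟩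
  rw [hcell r ψ hr h1 h2]
  constructor
  · intro h
    exact ⟨(h w₁ hw₁.1 hw₁.2).1, (h w₂ hw₂.1 hw₂.2).2⟩
  · rintro ⟨h3, h4⟩ w hw hwu
    have := hmax w ⟨hw, hwu⟩
    have := hmin w ⟨hw, hwu⟩
    exact ⟨by linarith, by linarith⟩

/-! ### The angular kernel and its antiderivatives -/

/-- The angle `arccos (-c cos t)`. -/
noncomputable def hypAngle (c t : ℝ) : ℝ := Real.arccos (-(c * Real.cos t))

/-- Up to a constant, the density of the angle between two correlated planar Gaussian vectors, as
a function of `μ = c cos φ`. -/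
noncomputable def angularKernel (μ : ℝ) : ℝ :=
  1 / (1 - μ ^ 2) + μ * Real.arccos (-μ) / √(1 - μ ^ 2) ^ 3

theorem mul_cos_sq_lt_one {c : ℝ} (hc : c ^ 2 < 1) (t : ℝ) : (c * Real.cos t) ^ 2 < 1 := by
  rw [mul_pow]
  nlinarith [Real.cos_sq_le_one t, sq_nonneg (Real.cos t), sq_nonneg c]

theorem hasDerivAt_sqrt_one_sub_sq {μ : ℝ} (h : μ ^ 2 < 1) :
    HasDerivAt (fun x => √(1 - x ^ 2)) (-μ / √(1 - μ ^ 2)) μ := by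
  have h1 : HasDerivAt (fun x : ℝ => 1 - x ^ 2) (-(2 * μ)) μ := by
    simpa using ((hasDerivAt_id μ).pow 2).const_sub 1
  convert! h1.sqrt (by linarith) using 1
  field_simp

theorem hasDerivAt_arccos_neg {μ : ℝ} (h : μ ^ 2 < 1) :
    HasDerivAt (fun x => Real.arccos (-x)) (1 / √(1 - μ ^ 2)) μ := by
  have h1 : -μ ≠ -1 := by rintro h1; nlinarith
  have h2 : -μ ≠ 1 := by rintro h1; nlinarith
  convert! (Real.hasDerivAt_arccos h1 h2).comp μ (hasDerivAt_neg μ) using 1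
  simp

theorem hasDerivAt_mul_cos (c t : ℝ) :
    HasDerivAt (fun x => c * Real.cos x) (-(c * Real.sin t)) t := by
  simpa using (Real.hasDerivAt_cos t).const_mul c

theorem hasDerivAt_hypAngle {c : ℝ} (hc : c ^ 2 < 1) (t : ℝ) :
    HasDerivAt (hypAngle c) (-(c * Real.sin t) / √(1 - (c * Real.cos t) ^ 2)) t := by
  convert! (hasDerivAt_arccos_neg (mul_cos_sq_lt_one hc t)).comp t (hasDerivAt_mul_cos c t) using 1
  ring

/-- Half the derivative of `t ^ 2 - hypAngle c t ^ 2`. -/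
noncomputable def angularMass (c t : ℝ) : ℝ :=
  t + hypAngle c t * (c * Real.sin t / √(1 - (c * Real.cos t) ^ 2))

theorem hasDerivAt_sq_sub_hypAngle_sq {c : ℝ} (hc : c ^ 2 < 1) (t : ℝ) :
    HasDerivAt (fun t => t ^ 2 - hypAngle c t ^ 2) (2 * angularMass c t) t := by
  convert! ((hasDerivAt_id t).pow 2).sub ((hasDerivAt_hypAngle hc t).pow 2) using 1
  simp [angularMass]
  ring

/-- With `hasDerivAt_sq_sub_hypAngle_sq` this makes the kernel, up to a constant factor, the second
derivative of t² − `hypAngle c t` ², which is why the double integral over a sector is elementary.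
-/
theorem hasDerivAt_angularMass {c : ℝ} (hc : c ^ 2 < 1) (t : ℝ) :
    HasDerivAt (angularMass c) ((1 - c ^ 2) * angularKernel (c * Real.cos t)) t := by
  have hμ := mul_cos_sq_lt_one hc t
  have hs : 0 < √(1 - (c * Real.cos t) ^ 2) := Real.sqrt_pos.2 (by linarith)
  have hss : √(1 - (c * Real.cos t) ^ 2) ^ 2 = 1 - (c * Real.cos t) ^ 2 :=
    Real.sq_sqrt (by linarith)
  have h1 := (hasDerivAt_sqrt_one_sub_sq hμ).comp t (hasDerivAt_mul_cos c t)
  have h2 := ((Real.hasDerivAt_sin t).const_mul c).div h1 hs.ne'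
  convert! (hasDerivAt_id t).add ((hasDerivAt_hypAngle hc t).mul h2) using 1
  simp only [angularKernel, Function.comp, hypAngle, Pi.div_apply]
  set r := √(1 - (c * Real.cos t) ^ 2) with hr
  have hX : 1 - c ^ 2 = r ^ 2 - (c * Real.sin t) ^ 2 := by
    rw [hss]
    linear_combination c ^ 2 * Real.sin_sq_add_cos_sq t
  rw [← hss, hX]
  field_simp
  ring

theorem lintegral_Ioi_of_hasDerivAt_of_nonneg {F f : ℝ → ℝ} {l : ℝ}
    (hF : ∀ x, 0 ≤ x → HasDerivAt F (f x) x) (hf : ∀ x, 0 ≤ x → 0 ≤ f x)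
    (hl : Tendsto F atTop (𝓝 l)) :
    ∫⁻ x in Set.Ioi (0 : ℝ), ENNReal.ofReal (f x) = ENNReal.ofReal (l - F 0) ∧ 0 ≤ l - F 0 := by
  have hi := integrableOn_Ioi_deriv_of_nonneg' (fun x hx => hF x hx)
    (fun x hx => hf x (le_of_lt hx)) hl
  have he := integral_Ioi_of_hasDerivAt_of_nonneg' (fun x hx => hF x hx)
    (fun x hx => hf x (le_of_lt hx)) hl
  have hae : 0 ≤ᵐ[volume.restrict (Set.Ioi (0 : ℝ))] f :=
    (ae_restrict_iff' measurableSet_Ioi).2 (ae_of_all _ fun x hx => hf x (le_of_lt hx))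
  rw [← he]
  exact ⟨(ofReal_integral_eq_lintegral_ofReal hi hae).symm, integral_nonneg_of_ae hae⟩

theorem lintegral_Icc_of_hasDerivAt_of_nonneg {F f : ℝ → ℝ} {a b : ℝ} (hab : a ≤ b)
    (hF : ∀ x, HasDerivAt F (f x) x) (hf : ∀ x, a ≤ x → x ≤ b → 0 ≤ f x) (hc : Continuous f) :
    ∫⁻ x in Set.Icc a b, ENNReal.ofReal (f x) = ENNReal.ofReal (F b - F a) ∧ 0 ≤ F b - F a := by
  have hae : 0 ≤ᵐ[volume.restrict (Set.Icc a b)] f :=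
    (ae_restrict_iff' measurableSet_Icc).2 (ae_of_all _ fun x hx => hf x hx.1 hx.2)
  have he := intervalIntegral.integral_eq_sub_of_hasDerivAt (fun x _ => hF x)
    (hc.intervalIntegrable a b)
  rw [intervalIntegral.integral_of_le hab, ← integral_Icc_eq_integral_Ioc] at he
  rw [← he]
  exact ⟨(ofReal_integral_eq_lintegral_ofReal hc.integrableOn_Icc hae).symm,
    integral_nonneg_of_ae hae⟩

theorem lintegral_pow_three_mul_exp {κ : ℝ} (hκ : 0 < κ) :
    ∫⁻ r in Set.Ioi (0 : ℝ), ENNReal.ofReal (r ^ 3 * Real.exp (-(κ * r ^ 2))) =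
      ENNReal.ofReal (1 / (2 * κ ^ 2)) := by
  have hF : ∀ x : ℝ, HasDerivAt
      (fun r => -((κ * r ^ 2 + 1) * Real.exp (-(κ * r ^ 2))) / (2 * κ ^ 2))
      (x ^ 3 * Real.exp (-(κ * x ^ 2))) x := by
    intro x
    have h1 : HasDerivAt (fun r : ℝ => κ * r ^ 2) (κ * (2 * x)) x := by
      simpa using ((hasDerivAt_id x).pow 2).const_mul κ
    convert! (((h1.add_const 1).mul h1.neg.exp).neg.div_const (2 * κ ^ 2)) using 1
    simp only [Pi.neg_apply]
    field_simp
    ring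
  have hl : Tendsto (fun r : ℝ => -((κ * r ^ 2 + 1) * Real.exp (-(κ * r ^ 2))) / (2 * κ ^ 2))
      atTop (𝓝 0) := by
    have hq : Tendsto (fun r : ℝ => κ * r ^ 2) atTop atTop :=
      (tendsto_pow_atTop two_ne_zero).const_mul_atTop hκ
    have h1 : Tendsto (fun y : ℝ => (y + 1) * Real.exp (-y)) atTop (𝓝 0) := by
      have h2 := Real.tendsto_pow_mul_exp_neg_atTop_nhds_zero 1
      have h3 := Real.tendsto_exp_neg_atTop_nhds_zero
      have h4 := h2.add h3
      simp only [pow_one, add_zero] at h4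
      refine h4.congr fun y => by ring
    have h5 := ((h1.comp hq).neg).div_const (2 * κ ^ 2)
    simpa [Function.comp] using h5
  rw [(lintegral_Ioi_of_hasDerivAt_of_nonneg (fun x _ => hF x) (fun x hx => by positivity) hl).1]
  congr 1
  simp [neg_div]

/-- Completing the square, with s² = 1 − μ², gives a rational function plus a multiple of arctan((R
− μ)/s) as antiderivative; arccos(−μ) enters as π/2 + arctan(μ/s). Nonnegativity of the kernel comes
for free, since it is the integral of a nonnegative function. -/
theorem lintegral_div_quadratic_sq {μ : ℝ} (h : μ ^ 2 < 1) :
    ∫⁻ R in Set.Ioi (0 : ℝ), ENNReal.ofReal (R / (1 + R ^ 2 - 2 * μ * R) ^ 2) =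
      ENNReal.ofReal (angularKernel μ / 2) ∧ 0 ≤ angularKernel μ := by
  have hm : 0 < 1 - μ ^ 2 := by linarith
  set s := √(1 - μ ^ 2) with hs
  have hs0 : 0 < s := Real.sqrt_pos.2 hm
  have hss : s ^ 2 = 1 - μ ^ 2 := Real.sq_sqrt hm.le
  have hq : ∀ R : ℝ, 1 + R ^ 2 - 2 * μ * R = (R - μ) ^ 2 + s ^ 2 := fun R => by rw [hss]; ring
  have hq0 : ∀ R : ℝ, 0 < (R - μ) ^ 2 + s ^ 2 := fun R => by positivity
  simp_rw [hq]
  set F : ℝ → ℝ := fun R => -(1 / (2 * ((R - μ) ^ 2 + s ^ 2))) +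
    μ * ((R - μ) / (2 * s ^ 2 * ((R - μ) ^ 2 + s ^ 2)) + Real.arctan ((R - μ) / s) / (2 * s ^ 3))
    with hFdef
  have hF : ∀ R, HasDerivAt F (R / ((R - μ) ^ 2 + s ^ 2) ^ 2) R := by
    intro R
    have h1 : HasDerivAt (fun R : ℝ => R - μ) 1 R := (hasDerivAt_id R).sub_const μ
    have h2 : HasDerivAt (fun R : ℝ => (R - μ) ^ 2 + s ^ 2) (2 * (R - μ)) R := by
      simpa using (h1.pow 2).add_const (s ^ 2)
    have h3 := ((hasDerivAt_const R (1 : ℝ)).div (h2.const_mul 2)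
      (mul_pos two_pos (hq0 R)).ne').neg
    have h4 := h1.div (h2.const_mul (2 * s ^ 2)) (mul_pos (by positivity) (hq0 R)).ne'
    have h5 := ((h1.div_const s).arctan).div_const (2 * s ^ 3)
    convert! h3.add ((h4.add h5).const_mul μ) using 1
    have := (hq0 R).ne'
    have h6 : 1 + ((R - μ) / s) ^ 2 = ((R - μ) ^ 2 + s ^ 2) / s ^ 2 := by field_simp; ring
    rw [h6]
    generalize hQ : (R - μ) ^ 2 + s ^ 2 = Q at *
    have hRQ : (R - μ) ^ 2 = Q - s ^ 2 := by linarith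
    field_simp
    ring_nf
    ring_nf at hRQ
    linear_combination 2 * μ * hRQ
  have hl : Tendsto F atTop (𝓝 (-0 + μ * (0 + Real.pi / 2 / (2 * s ^ 3)))) := by
    have ht : Tendsto (fun R : ℝ => R - μ) atTop atTop := tendsto_atTop_add_const_right _ (-μ) tendsto_id
    have h1 : Tendsto (fun y : ℝ => 1 / (2 * (y ^ 2 + s ^ 2))) atTop (𝓝 0) := by
      simp_rw [one_div]
      exact ((tendsto_atTop_add_const_right _ (s ^ 2)
        (tendsto_pow_atTop two_ne_zero)).const_mul_atTop two_pos).inv_tendsto_atTop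
    have h2 : Tendsto (fun y : ℝ => y / (2 * s ^ 2 * (y ^ 2 + s ^ 2))) atTop (𝓝 0) := by
      refine squeeze_zero' (g := fun y : ℝ => (2 * s ^ 2 * y)⁻¹) ?_ ?_ ?_
      · filter_upwards [eventually_gt_atTop 0] with y hy
        positivity
      · filter_upwards [eventually_gt_atTop 0] with y hy
        rw [← one_div, div_le_div_iff₀ (by positivity) (by positivity)]
        have : 0 < s ^ 2 * s ^ 2 := by positivity
        nlinarith
      · exact (tendsto_id.const_mul_atTop (by positivity)).inv_tendsto_atTop
    have h3 : Tendsto (fun y : ℝ => Real.arctan (y / s) / (2 * s ^ 3)) atTop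
        (𝓝 (Real.pi / 2 / (2 * s ^ 3))) :=
      ((tendsto_nhds_of_tendsto_nhdsWithin Real.tendsto_arctan_atTop).comp
        (tendsto_id.atTop_div_const hs0)).div_const _
    exact ((h1.neg.add ((h2.add h3).const_mul μ)).comp ht)
  have key := lintegral_Ioi_of_hasDerivAt_of_nonneg (fun x _ => hF x)
    (fun x hx => div_nonneg hx (sq_nonneg _)) hl
  have hval : -0 + μ * (0 + Real.pi / 2 / (2 * s ^ 3)) - F 0 = angularKernel μ / 2 := by
    have h1 : Real.arccos (-μ) = Real.pi / 2 + Real.arctan (μ / s) := by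
      rw [Real.arccos_neg, Real.arccos, Real.arcsin_eq_arctan ⟨by nlinarith, by nlinarith⟩]
      ring
    have h2 : (0 - μ) ^ 2 + s ^ 2 = 1 := by rw [hss]; ring
    have h3 : Real.arctan ((0 - μ) / s) = -Real.arctan (μ / s) := by
      rw [zero_sub, neg_div, Real.arctan_neg]
    have hK : angularKernel μ = 1 / s ^ 2 + μ * Real.arccos (-μ) / s ^ 3 := by
      rw [angularKernel, ← hs, ← hss]
    simp only [hFdef, h2, h3, hK, h1]
    field_simp
    have : μ ^ 2 = 1 - s ^ 2 := by rw [hss]; ring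
    ring_nf
    linear_combination 2 * s * this
  rw [hval] at key
  exact ⟨key.1, by linarith [key.2]⟩

theorem lintegral_Ioi_comp_mul {r : ℝ} (hr : 0 < r) (f : ℝ → ℝ≥0∞) :
    ∫⁻ t in Set.Ioi (0 : ℝ), f t = ∫⁻ t in Set.Ioi (0 : ℝ), ENNReal.ofReal r * f (r * t) := by
  have h := lintegral_image_eq_lintegral_abs_deriv_mul (s := Set.Ioi (0 : ℝ)) (f := fun t => r * t)
    (f' := fun _ => r) measurableSet_Ioi
    (fun x _ => by simpa using ((hasDerivAt_id x).const_mul r).hasDerivWithinAt)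
    (fun x _ y _ hxy => mul_left_cancel₀ hr.ne' hxy) f
  rw [Set.image_mul_left_Ioi hr, mul_zero] at h
  rw [h, abs_of_pos hr]

/-- The radial part of the Gaussian integral over a pair of planar vectors. -/
theorem lintegral_radial {μ s K : ℝ} (h : μ ^ 2 < 1) (hs : 0 < s) (hK : 0 ≤ K) :
    ∫⁻ r in Set.Ioi (0 : ℝ), ∫⁻ t in Set.Ioi (0 : ℝ),
      ENNReal.ofReal (r * t * (K * Real.exp (-((r ^ 2 + t ^ 2 - 2 * μ * r * t) / (2 * s ^ 2))))) =
      ENNReal.ofReal (K * s ^ 4 * angularKernel μ) := by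
  have hq : ∀ R : ℝ, 0 < 1 + R ^ 2 - 2 * μ * R := fun R => by nlinarith [sq_nonneg (R - μ)]
  -- The substitution t = rR makes the exponent a multiple of r², so after exchanging the integrals
  -- the one over r is explicit.
  have h1 : ∀ r ∈ Set.Ioi (0 : ℝ), ∫⁻ t in Set.Ioi (0 : ℝ),
      ENNReal.ofReal (r * t * (K * Real.exp (-((r ^ 2 + t ^ 2 - 2 * μ * r * t) / (2 * s ^ 2))))) =
      ∫⁻ R in Set.Ioi (0 : ℝ), ENNReal.ofReal (K * R) * ENNReal.ofReal
        (r ^ 3 * Real.exp (-((1 + R ^ 2 - 2 * μ * R) / (2 * s ^ 2) * r ^ 2))) := by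
    intro r hr
    have hr0 : 0 < r := hr
    rw [lintegral_Ioi_comp_mul hr0]
    refine setLIntegral_congr_fun measurableSet_Ioi fun R hR => ?_
    have hR0 : 0 < R := hR
    rw [← ENNReal.ofReal_mul hr0.le, ← ENNReal.ofReal_mul (by positivity)]
    congr 1
    rw [show (r ^ 2 + (r * R) ^ 2 - 2 * μ * r * (r * R)) / (2 * s ^ 2) =
      (1 + R ^ 2 - 2 * μ * R) / (2 * s ^ 2) * r ^ 2 by ring]
    ring
  rw [setLIntegral_congr_fun measurableSet_Ioi h1, lintegral_lintegral_swap (by fun_prop)]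
  have h2 : ∀ R ∈ Set.Ioi (0 : ℝ), ∫⁻ r in Set.Ioi (0 : ℝ), ENNReal.ofReal (K * R) * ENNReal.ofReal
        (r ^ 3 * Real.exp (-((1 + R ^ 2 - 2 * μ * R) / (2 * s ^ 2) * r ^ 2))) =
      ENNReal.ofReal (2 * K * s ^ 4) * ENNReal.ofReal (R / (1 + R ^ 2 - 2 * μ * R) ^ 2) := by
    intro R hR
    have hR0 : 0 < R := hR
    rw [lintegral_const_mul _ (by fun_prop), lintegral_pow_three_mul_exp
      (div_pos (hq R) (by positivity)), ← ENNReal.ofReal_mul (by positivity),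
      ← ENNReal.ofReal_mul (by positivity)]
    congr 1
    have := (hq R).ne'
    field_simp
    try ring
  rw [setLIntegral_congr_fun measurableSet_Ioi h2, lintegral_const_mul _ (by fun_prop),
    (lintegral_div_quadratic_sq h).1, ← ENNReal.ofReal_mul (by positivity)]
  congr 1
  ring

/-! ### Noise stability of a sector -/

/-- The planar set `S` is the sector of the points with argument between `a` and `b`. -/
def IsSector (S : Set (ℝ × ℝ)) (a b : ℝ) : Prop :=
  ∀ r ψ : ℝ, 0 < r → -Real.pi < ψ → ψ < Real.pi →
    ((r * Real.cos ψ, r * Real.sin ψ) ∈ S ↔ a ≤ ψ ∧ ψ ≤ b)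

theorem lintegral_sector {S : Set (ℝ × ℝ)} (hS : MeasurableSet S) {a b : ℝ}
    (ha : -Real.pi ≤ a) (hb : b ≤ Real.pi) (h : IsSector S a b) {F : ℝ × ℝ → ℝ≥0∞}
    (hF : Measurable F) :
    ∫⁻ p in S, F p = ∫⁻ ψ in Set.Icc a b, ∫⁻ r in Set.Ioi (0 : ℝ),
      ENNReal.ofReal r * F (r * Real.cos ψ, r * Real.sin ψ) := by
  rw [← lintegral_indicator hS, ← lintegral_comp_polarCoord_symm, polarCoord_target]
  have h1 : ∀ p ∈ Set.Ioi (0 : ℝ) ×ˢ Set.Ioo (-Real.pi) Real.pi,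
      ENNReal.ofReal p.1 • S.indicator F (polarCoord.symm p) =
      (Set.Icc a b).indicator (fun _ => ENNReal.ofReal p.1 *
        F (p.1 * Real.cos p.2, p.1 * Real.sin p.2)) p.2 := by
    rintro ⟨r, ψ⟩ ⟨hr, hψ⟩
    simp only [polarCoord_symm_apply, smul_eq_mul]
    by_cases hI : ψ ∈ Set.Icc a b
    · rw [Set.indicator_of_mem ((h r ψ hr hψ.1 hψ.2).2 hI), Set.indicator_of_mem hI]
    · rw [Set.indicator_of_notMem (fun hh => hI ((h r ψ hr hψ.1 hψ.2).1 hh)),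
        Set.indicator_of_notMem hI, mul_zero]
  have hm : Measurable fun p : ℝ × ℝ => (Set.Icc a b).indicator (fun _ => ENNReal.ofReal p.1 *
        F (p.1 * Real.cos p.2, p.1 * Real.sin p.2)) p.2 := by
    have : (fun p : ℝ × ℝ => (Set.Icc a b).indicator (fun _ => ENNReal.ofReal p.1 *
        F (p.1 * Real.cos p.2, p.1 * Real.sin p.2)) p.2) =
        (Prod.snd ⁻¹' Set.Icc a b).indicator (fun p : ℝ × ℝ => ENNReal.ofReal p.1 *
        F (p.1 * Real.cos p.2, p.1 * Real.sin p.2)) := rfl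
    rw [this]
    exact Measurable.indicator (by fun_prop) (measurable_snd measurableSet_Icc)
  rw [setLIntegral_congr_fun (measurableSet_Ioi.prod measurableSet_Ioo) h1,
    Measure.volume_eq_prod, ← Measure.prod_restrict, lintegral_prod_symm _ hm.aemeasurable,
    Measure.restrict_congr_set Ioo_ae_eq_Icc]
  have h2 : ∀ ψ : ℝ, ∫⁻ r in Set.Ioi (0 : ℝ), (Set.Icc a b).indicator (fun _ => ENNReal.ofReal r *
        F (r * Real.cos ψ, r * Real.sin ψ)) ψ = (Set.Icc a b).indicator (fun ψ =>
        ∫⁻ r in Set.Ioi (0 : ℝ), ENNReal.ofReal r * F (r * Real.cos ψ, r * Real.sin ψ)) ψ := by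
    intro ψ
    by_cases hI : ψ ∈ Set.Icc a b
    · simp only [Set.indicator_of_mem hI]
    · simp only [Set.indicator_of_notMem hI, lintegral_zero]
  simp_rw [h2]
  rw [setLIntegral_indicator measurableSet_Icc,
    Set.inter_eq_left.2 (Set.Icc_subset_Icc ha hb)]

theorem map_affine_planeGaussian {s : ℝ} (hs : 0 < s) (m : ℝ × ℝ) :
    planeGaussian.map (fun q => m + s • q) = volume.withDensity (fun w : ℝ × ℝ =>
      ENNReal.ofReal (1 / (2 * Real.pi * s ^ 2) *
        Real.exp (-(((w.1 - m.1) ^ 2 + (w.2 - m.2) ^ 2) / (2 * s ^ 2))))) := by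
  have h1 : ∀ x : ℝ, (gaussianReal 0 1).map (fun t => x + s * t) =
      gaussianReal x (.mk (s ^ 2) (sq_nonneg _)) := by
    intro x
    have : (fun t => x + s * t) = (fun t => x + t) ∘ (fun t => s * t) := rfl
    rw [this, ← Measure.map_map (by fun_prop) (by fun_prop), gaussianReal_map_const_mul,
      gaussianReal_map_const_add]
    simp
  have h2 : (fun q : ℝ × ℝ => m + s • q) =
      Prod.map (fun t => m.1 + s * t) (fun t => m.2 + s * t) := by
    ext q <;> simp
  have hv : (NNReal.mk (s ^ 2) (sq_nonneg _)) ≠ 0 := by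
    intro h0
    have := congrArg NNReal.toReal h0
    simp at this
    exact hs.ne' this
  rw [planeGaussian, h2, ← Measure.map_prod_map _ _ (by fun_prop) (by fun_prop), h1, h1,
    gaussianReal_of_var_ne_zero _ hv, gaussianReal_of_var_ne_zero _ hv,
    prod_withDensity (measurable_gaussianPDF _ _) (measurable_gaussianPDF _ _),
    ← Measure.volume_eq_prod]
  congr 1
  ext w
  rw [gaussianPDF, gaussianPDF, ← ENNReal.ofReal_mul (gaussianPDFReal_nonneg _ _ _)]
  congr 1
  simp only [gaussianPDFReal, NNReal.coe_mk]
  rw [mul_mul_mul_comm, ← Real.exp_add, ← mul_inv, Real.mul_self_sqrt (by positivity), one_div]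
  congr 2
  ring

theorem planeGaussian_eq_withDensity :
    planeGaussian = volume.withDensity (fun w : ℝ × ℝ =>
      ENNReal.ofReal (1 / (2 * Real.pi) * Real.exp (-((w.1 ^ 2 + w.2 ^ 2) / 2)))) := by
  have h := map_affine_planeGaussian one_pos 0
  simpa using h

/-- The joint density of two correlated planar Gaussian vectors. -/
theorem prod_planeGaussian_correlate {c : ℝ} (hc : c ^ 2 < 1) {S : Set (ℝ × ℝ)}
    (hS : MeasurableSet S) :
    (planeGaussian.prod planeGaussian) {z | (correlate c z).1 ∈ S ∧ (correlate c z).2 ∈ S} =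
      ∫⁻ p in S, ∫⁻ w in S, ENNReal.ofReal (1 / (4 * Real.pi ^ 2 * (1 - c ^ 2)) *
        Real.exp (-((p.1 ^ 2 + p.2 ^ 2 + (w.1 ^ 2 + w.2 ^ 2) - 2 * c * (p.1 * w.1 + p.2 * w.2)) /
          (2 * (1 - c ^ 2))))) := by
  have hm : 0 < 1 - c ^ 2 := by linarith
  set s := √(1 - c ^ 2) with hs
  have hs0 : 0 < s := Real.sqrt_pos.2 hm
  have hss : s ^ 2 = 1 - c ^ 2 := Real.sq_sqrt hm.le
  have hms : MeasurableSet {z : (ℝ × ℝ) × (ℝ × ℝ) |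
      (correlate c z).1 ∈ S ∧ (correlate c z).2 ∈ S} := measurable_correlate c (hS.prod hS)
  rw [Measure.prod_apply hms]
  have h1 : ∀ p : ℝ × ℝ, planeGaussian (Prod.mk p ⁻¹' {z | (correlate c z).1 ∈ S ∧
      (correlate c z).2 ∈ S}) = S.indicator (fun p => ∫⁻ w in S,
        ENNReal.ofReal (1 / (2 * Real.pi * s ^ 2) *
        Real.exp (-(((w.1 - (c • p).1) ^ 2 + (w.2 - (c • p).2) ^ 2) / (2 * s ^ 2))))) p := by
    intro p
    by_cases hp : p ∈ S
    · rw [Set.indicator_of_mem hp]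
      have : (Prod.mk p ⁻¹' {z : (ℝ × ℝ) × (ℝ × ℝ) | (correlate c z).1 ∈ S ∧
          (correlate c z).2 ∈ S}) = (fun q => c • p + s • q) ⁻¹' S := by
        ext q
        simp [correlate, hp, ← hs]
      rw [this, ← Measure.map_apply (by fun_prop) hS, map_affine_planeGaussian hs0,
        withDensity_apply _ hS]
    · rw [Set.indicator_of_notMem hp]
      have : (Prod.mk p ⁻¹' {z : (ℝ × ℝ) × (ℝ × ℝ) | (correlate c z).1 ∈ S ∧
          (correlate c z).2 ∈ S}) = ∅ := by
        ext q
        simp [correlate, hp]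
      rw [this, measure_empty]
  simp_rw [h1]
  have hG : Measurable fun p : ℝ × ℝ => ∫⁻ w in S, ENNReal.ofReal (1 / (2 * Real.pi * s ^ 2) *
        Real.exp (-(((w.1 - (c • p).1) ^ 2 + (w.2 - (c • p).2) ^ 2) / (2 * s ^ 2)))) := by
    refine Measurable.lintegral_prod_right' (f := fun p : (ℝ × ℝ) × (ℝ × ℝ) =>
      ENNReal.ofReal (1 / (2 * Real.pi * s ^ 2) * Real.exp
        (-(((p.2.1 - (c • p.1).1) ^ 2 + (p.2.2 - (c • p.1).2) ^ 2) / (2 * s ^ 2))))) ?_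
    fun_prop
  rw [lintegral_indicator hS, planeGaussian_eq_withDensity,
    restrict_withDensity hS, lintegral_withDensity_eq_lintegral_mul _ (by fun_prop) hG]
  refine lintegral_congr fun p => ?_
  rw [Pi.mul_apply, ← lintegral_const_mul _ (by fun_prop)]
  refine lintegral_congr fun w => ?_
  rw [← ENNReal.ofReal_mul (by positivity)]
  congr 1
  -- The exponents combine through s²|p|² + |w − cp|² = |p|² + |w|² − 2c⟨p, w⟩, valid as s² = 1 −
  -- c².
  rw [mul_mul_mul_comm, ← Real.exp_add, ← hss]
  congr 1
  · field_simp; norm_num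
  · congr 1
    simp only [Prod.smul_fst, Prod.smul_snd, smul_eq_mul]
    field_simp
    have : c ^ 2 = 1 - s ^ 2 := by rw [hss]; ring
    ring_nf
    rw [this]
    ring

theorem continuous_angularKernel_cos {c : ℝ} (hc : c ^ 2 < 1) :
    Continuous fun t => angularKernel (c * Real.cos t) := by
  have h : ∀ t, 1 - (c * Real.cos t) ^ 2 ≠ 0 := fun t => by
    have := mul_cos_sq_lt_one hc t
    linarith
  have h' : ∀ t, √(1 - (c * Real.cos t) ^ 2) ^ 3 ≠ 0 := fun t => by
    have := mul_cos_sq_lt_one hc t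
    exact pow_ne_zero _ (Real.sqrt_pos.2 (by linarith)).ne'
  unfold angularKernel
  refine Continuous.add (continuous_const.div (by fun_prop) h) (Continuous.div ?_ (by fun_prop) h')
  exact Continuous.mul (by fun_prop) (Real.continuous_arccos.comp (by fun_prop))

/-- The integral over a square of a second derivative evaluated at ψ − φ is a second difference of
the antiderivative. Evenness merges its terms at b − a and a − b, and both diagonal terms are values
at 0. -/
theorem lintegral_angularKernel {c a b : ℝ} (hc : c ^ 2 < 1) (hab : a ≤ b) :
    ∫⁻ ψ in Set.Icc a b, ∫⁻ φ in Set.Icc a b, ENNReal.ofReal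
      ((1 - c ^ 2) / (4 * Real.pi ^ 2) * angularKernel (c * Real.cos (ψ - φ))) =
    ENNReal.ofReal (1 / (4 * Real.pi ^ 2) *
      ((b - a) ^ 2 - hypAngle c (b - a) ^ 2 + hypAngle c 0 ^ 2)) ∧
    0 ≤ 1 / (4 * Real.pi ^ 2) *
      ((b - a) ^ 2 - hypAngle c (b - a) ^ 2 + hypAngle c 0 ^ 2) := by
  have hm : 0 < 1 - c ^ 2 := by linarith
  have hk : ∀ t, 0 ≤ (1 - c ^ 2) / (4 * Real.pi ^ 2) * angularKernel (c * Real.cos t) := fun t =>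
    mul_nonneg (by positivity) (lintegral_div_quadratic_sq (mul_cos_sq_lt_one hc t)).2
  have hcont := continuous_angularKernel_cos hc
  have h1 : ∀ ψ, ∫⁻ φ in Set.Icc a b, ENNReal.ofReal
      ((1 - c ^ 2) / (4 * Real.pi ^ 2) * angularKernel (c * Real.cos (ψ - φ))) =
      ENNReal.ofReal (1 / (4 * Real.pi ^ 2) * (angularMass c (ψ - a) - angularMass c (ψ - b))) ∧
      0 ≤ 1 / (4 * Real.pi ^ 2) * (angularMass c (ψ - a) - angularMass c (ψ - b)) := by
    intro ψ
    have hF : ∀ φ, HasDerivAt (fun φ => -(1 / (4 * Real.pi ^ 2)) * angularMass c (ψ - φ))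
        ((1 - c ^ 2) / (4 * Real.pi ^ 2) * angularKernel (c * Real.cos (ψ - φ))) φ := by
      intro φ
      convert! ((hasDerivAt_angularMass hc (ψ - φ)).comp φ
        ((hasDerivAt_id φ).const_sub ψ)).const_mul (-(1 / (4 * Real.pi ^ 2))) using 1
      ring
    have h := lintegral_Icc_of_hasDerivAt_of_nonneg hab hF (fun φ _ _ => hk _)
      (continuous_const.mul (hcont.comp (continuous_const.sub continuous_id)))
    have e : -(1 / (4 * Real.pi ^ 2)) * angularMass c (ψ - b) -
      -(1 / (4 * Real.pi ^ 2)) * angularMass c (ψ - a) =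
      1 / (4 * Real.pi ^ 2) * (angularMass c (ψ - a) - angularMass c (ψ - b)) := by ring
    rw [e] at h
    exact h
  simp_rw [fun ψ => (h1 ψ).1]
  have hP : Continuous (angularMass c) :=
    continuous_iff_continuousAt.2 fun t => (hasDerivAt_angularMass hc t).continuousAt
  have hF : ∀ ψ, HasDerivAt (fun ψ => 1 / (8 * Real.pi ^ 2) *
      (((ψ - a) ^ 2 - hypAngle c (ψ - a) ^ 2) - ((ψ - b) ^ 2 - hypAngle c (ψ - b) ^ 2)))
      (1 / (4 * Real.pi ^ 2) * (angularMass c (ψ - a) - angularMass c (ψ - b))) ψ := by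
    intro ψ
    have e1 := (hasDerivAt_sq_sub_hypAngle_sq hc (ψ - a)).comp ψ ((hasDerivAt_id ψ).sub_const a)
    have e2 := (hasDerivAt_sq_sub_hypAngle_sq hc (ψ - b)).comp ψ ((hasDerivAt_id ψ).sub_const b)
    convert! (e1.sub e2).const_mul (1 / (8 * Real.pi ^ 2)) using 1
    field_simp
    ring
  have h := lintegral_Icc_of_hasDerivAt_of_nonneg hab hF (fun ψ _ _ => (h1 ψ).2)
    (continuous_const.mul ((hP.comp (continuous_id.sub continuous_const)).sub
      (hP.comp (continuous_id.sub continuous_const))))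
  have heven : hypAngle c (a - b) = hypAngle c (b - a) := by
    rw [hypAngle, hypAngle, ← Real.cos_neg, neg_sub]
  have e : 1 / (8 * Real.pi ^ 2) *
      (((b - a) ^ 2 - hypAngle c (b - a) ^ 2) - ((b - b) ^ 2 - hypAngle c (b - b) ^ 2)) -
      1 / (8 * Real.pi ^ 2) *
      (((a - a) ^ 2 - hypAngle c (a - a) ^ 2) - ((a - b) ^ 2 - hypAngle c (a - b) ^ 2)) =
      1 / (4 * Real.pi ^ 2) *
      ((b - a) ^ 2 - hypAngle c (b - a) ^ 2 + hypAngle c 0 ^ 2) := by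
    rw [sub_self, sub_self, heven]
    field_simp
    ring
  rw [e] at h
  exact h

theorem sector_collision {c a b : ℝ} (hc : c ^ 2 < 1) {S : Set (ℝ × ℝ)} (hS : MeasurableSet S)
    (ha : -Real.pi ≤ a) (hab : a ≤ b) (hb : b ≤ Real.pi) (h : IsSector S a b) :
    (planeGaussian.prod planeGaussian) {z | (correlate c z).1 ∈ S ∧ (correlate c z).2 ∈ S} =
      ENNReal.ofReal (1 / (4 * Real.pi ^ 2) *
        ((b - a) ^ 2 - hypAngle c (b - a) ^ 2 + hypAngle c 0 ^ 2)) := by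
  rw [prod_planeGaussian_correlate hc hS, ← (lintegral_angularKernel hc hab).1]
  have hm : 0 < 1 - c ^ 2 := by linarith
  set s := √(1 - c ^ 2) with hs
  have hs0 : 0 < s := Real.sqrt_pos.2 hm
  have hss : s ^ 2 = 1 - c ^ 2 := Real.sq_sqrt hm.le
  rw [← hss]
  set K := 1 / (4 * Real.pi ^ 2 * s ^ 2) with hKdef
  have hK : 0 ≤ K := by positivity
  have hKs : s ^ 2 / (4 * Real.pi ^ 2) = K * s ^ 4 := by
    rw [hKdef]; field_simp
  rw [hKs]
  set F : ℝ × ℝ → ℝ × ℝ → ℝ≥0∞ := fun p w => ENNReal.ofReal (K *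
    Real.exp (-((p.1 ^ 2 + p.2 ^ 2 + (w.1 ^ 2 + w.2 ^ 2) - 2 * c * (p.1 * w.1 + p.2 * w.2)) /
          (2 * s ^ 2)))) with hF
  have hFm : Measurable (Function.uncurry F) := by
    simp only [hF, Function.uncurry_def]
    fun_prop
  rw [lintegral_sector hS ha hb h (F := fun p => ∫⁻ w in S, F p w) (hFm.lintegral_prod_right')]
  refine lintegral_congr fun ψ => ?_
  have h1 : ∀ r ∈ Set.Ioi (0 : ℝ),
      ENNReal.ofReal r * ∫⁻ w in S, F (r * Real.cos ψ, r * Real.sin ψ) w =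
      ∫⁻ φ in Set.Icc a b, ∫⁻ t in Set.Ioi (0 : ℝ), ENNReal.ofReal (r * t * (K *
        Real.exp (-((r ^ 2 + t ^ 2 - 2 * (c * Real.cos (ψ - φ)) * r * t) / (2 * s ^ 2))))) := by
    intro r hr
    rw [lintegral_sector hS ha hb h (hFm.of_uncurry_left),
      ← lintegral_const_mul' _ _ ENNReal.ofReal_ne_top]
    refine lintegral_congr fun φ => ?_
    rw [← lintegral_const_mul' _ _ ENNReal.ofReal_ne_top]
    refine setLIntegral_congr_fun measurableSet_Ioi fun t ht => ?_
    have hr0 : 0 < r := hr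
    have ht0 : 0 < t := ht
    simp only [hF]
    rw [← ENNReal.ofReal_mul ht0.le, ← ENNReal.ofReal_mul hr0.le, mul_assoc r t]
    congr 7
    rw [Real.cos_sub]
    linear_combination r ^ 2 * Real.cos_sq_add_sin_sq ψ + t ^ 2 * Real.cos_sq_add_sin_sq φ
  rw [setLIntegral_congr_fun measurableSet_Ioi h1, lintegral_lintegral_swap]
  · exact lintegral_congr fun φ => lintegral_radial (mul_cos_sq_lt_one hc _) hs0 hK
  · refine (Measurable.lintegral_prod_right' (f := fun p : (ℝ × ℝ) × ℝ =>
      ENNReal.ofReal (p.1.1 * p.2 * (K * Real.exp (-((p.1.1 ^ 2 + p.2 ^ 2 -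
        2 * (c * Real.cos (ψ - p.1.2)) * p.1.1 * p.2) / (2 * s ^ 2)))))) ?_).aemeasurable
    fun_prop

/-- The noise stability of a planar Voronoi cell is determined by its measure. -/
theorem noiseStability_voronoiCell {C : Set (EuclideanSpace ℝ (Fin 2))} (hC : IsSphericalCode C)
    {u v : EuclideanSpace ℝ (Fin 2)} (hu : u ∈ C) (hv : v ∈ C) (huv : u ≠ v) {c : ℝ}
    (hc : c ^ 2 < 1) :
    noiseStability (voronoiCell C u) c = 1 / (4 * Real.pi ^ 2) *
      ((2 * Real.pi * (stdGaussian (EuclideanSpace ℝ (Fin 2))).real (voronoiCell C u)) ^ 2 -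
        hypAngle c (2 * Real.pi *
          (stdGaussian (EuclideanSpace ℝ (Fin 2))).real (voronoiCell C u)) ^ 2 +
        hypAngle c 0 ^ 2) := by
  obtain ⟨a, b, ha, hab, hb, h⟩ := voronoiCell_sector hC hu hv huv
  have hu1 : ‖u‖ = 1 := mem_sphere_zero_iff_norm.1 (hC.2 hu)
  have hS : MeasurableSet (frame u ⁻¹' voronoiCell C u) :=
    (continuous_frame u).measurable (measurableSet_voronoiCell C u)
  have key : ∀ c : ℝ, c ^ 2 < 1 → noiseStability (voronoiCell C u) c = 1 / (4 * Real.pi ^ 2) *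
      ((b - a) ^ 2 - hypAngle c (b - a) ^ 2 + hypAngle c 0 ^ 2) := by
    intro c hc
    rw [noiseStability_eq_planeGaussian hu1 (measurableSet_voronoiCell C u), measureReal_def]
    have := sector_collision hc hS ha hab hb h
    rw [show {z : (ℝ × ℝ) × (ℝ × ℝ) | frame u (correlate c z).1 ∈ voronoiCell C u ∧
      frame u (correlate c z).2 ∈ voronoiCell C u} = {z | (correlate c z).1 ∈
        frame u ⁻¹' voronoiCell C u ∧ (correlate c z).2 ∈ frame u ⁻¹' voronoiCell C u} from rfl,
      this, ENNReal.toReal_ofReal]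
    exact (lintegral_angularKernel hc hab).2
  -- At correlation zero the noise stability is the squared measure of the cell, which identifies
  -- the opening b − a as 2π times that measure.
  have h0 := key 0 (by norm_num)
  rw [noiseStability_zero] at h0
  simp only [hypAngle, zero_mul] at h0
  have h1 : (2 * Real.pi * (stdGaussian (EuclideanSpace ℝ (Fin 2))).real (voronoiCell C u)) ^ 2 =
      (b - a) ^ 2 := by
    rw [mul_pow, h0]
    field_simp
    ring
  have h2 : 2 * Real.pi * (stdGaussian (EuclideanSpace ℝ (Fin 2))).real (voronoiCell C u) =
      b - a := by
    refine (sq_eq_sq₀ (by positivity) (by linarith)).1 h1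
  rw [h2, key c hc]

/-! ### Collision probabilities of isogonal codes and antipodal pairs -/

/-- The collision probability of a planar isogonal code with `n` words at correlation `c`. -/
noncomputable def isogonalCollision (n c : ℝ) : ℝ :=
  n / (4 * Real.pi ^ 2) *
    ((2 * Real.pi / n) ^ 2 - hypAngle c (2 * Real.pi / n) ^ 2 + hypAngle c 0 ^ 2)

theorem IsIsogonal.noiseStability_voronoiCell {C : Set (EuclideanSpace ℝ (Fin 2))}
    {dec : EuclideanSpace ℝ (Fin 2) → EuclideanSpace ℝ (Fin 2)} (hC : IsSphericalCode C)
    (hi : IsIsogonal C) (hn : 2 ≤ C.ncard) (hd : IsDecoder C dec) {c : ℝ} (hc : c ^ 2 < 1)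
    {u : EuclideanSpace ℝ (Fin 2)} (hu : u ∈ C) :
    noiseStability (voronoiCell C u) c = isogonalCollision C.ncard c / C.ncard := by
  obtain ⟨v, hv, huv⟩ := Set.exists_ne_of_one_lt_ncard (by omega : 1 < C.ncard) u
  have hn0 : (C.ncard : ℝ) ≠ 0 := by
    have : C.ncard ≠ 0 := by omega
    exact_mod_cast this
  rw [_root_.noiseStability_voronoiCell hC hu hv huv.symm hc, hi.measure_voronoiCell hC hd hu,
    isogonalCollision, mul_one_div]
  field_simp

theorem IsIsogonal.pairCollision_eq {d : ℕ} {C : Set (EuclideanSpace ℝ (Fin 2))}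
    {dec : EuclideanSpace ℝ (Fin 2) → EuclideanSpace ℝ (Fin 2)} (hC : IsSphericalCode C)
    (hi : IsIsogonal C) (hn : 2 ≤ C.ncard) (hd : IsDecoder C dec)
    {x y : EuclideanSpace ℝ (Fin d)} (hx : ‖x‖ = 1) (hy : ‖y‖ = 1) (hc : ⟪x, y⟫ ^ 2 < 1) :
    pairCollision dec x y = isogonalCollision C.ncard ⟪x, y⟫ := by
  have hn0 : (C.ncard : ℝ) ≠ 0 := by
    have : C.ncard ≠ 0 := by omega
    exact_mod_cast this
  rw [pairCollision_eq_sum hC hd x y hx hy, Finset.sum_congr rfl fun u hu =>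
    hi.noiseStability_voronoiCell hC hn hd hc (hC.1.mem_toFinset.1 hu), Finset.sum_const,
    nsmul_eq_mul, ← Set.ncard_eq_toFinset_card C hC.1, mul_div_cancel₀ _ hn0]

theorem IsIsogonal.indepCollision_eq {k : ℕ} {C : Set (EuclideanSpace ℝ (Fin k))}
    {dec : EuclideanSpace ℝ (Fin k) → EuclideanSpace ℝ (Fin k)} (hC : IsSphericalCode C)
    (hi : IsIsogonal C) (hd : IsDecoder C dec) : indepCollision dec = 1 / C.ncard := by
  have hn0 : (C.ncard : ℝ) ≠ 0 := by
    have : C.ncard ≠ 0 := Set.ncard_ne_zero_of_mem (hd 0).1 hC.1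
    exact_mod_cast this
  rw [indepCollision_eq_sum hC hd, Finset.sum_congr rfl fun u hu => by
    rw [noiseStability_zero, hi.measure_voronoiCell hC hd (hC.1.mem_toFinset.1 hu)],
    Finset.sum_const, nsmul_eq_mul, ← Set.ncard_eq_toFinset_card C hC.1]
  field_simp

theorem ne_neg_of_norm_eq_one {k : ℕ} {v : EuclideanSpace ℝ (Fin k)} (hv : ‖v‖ = 1) : v ≠ -v := by
  intro h
  have h1 := congrArg (fun w => ⟪w, v⟫) h
  simp only [inner_neg_left, real_inner_self_eq_norm_sq, hv] at h1
  norm_num at h1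

theorem isSphericalCode_pair {k : ℕ} {v : EuclideanSpace ℝ (Fin k)} (hv : ‖v‖ = 1) :
    IsSphericalCode ({v, -v} : Set (EuclideanSpace ℝ (Fin k))) := by
  refine ⟨Set.toFinite _, ?_⟩
  rintro w (rfl | rfl) <;> simp [hv]

theorem isIsogonal_pair {k : ℕ} (v : EuclideanSpace ℝ (Fin k)) :
    IsIsogonal ({v, -v} : Set (EuclideanSpace ℝ (Fin k))) := by
  have hneg : (IsometryEquiv.neg (EuclideanSpace ℝ (Fin k))) '' {v, -v} = {v, -v} := by
    rw [Set.image_pair]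
    simp [Set.pair_comm]
  rintro u (rfl | rfl) w (rfl | rfl)
  · exact ⟨IsometryEquiv.refl _, rfl, Set.image_id _⟩
  · exact ⟨IsometryEquiv.neg _, rfl, hneg⟩
  · exact ⟨IsometryEquiv.neg _, neg_neg _, hneg⟩
  · exact ⟨IsometryEquiv.refl _, rfl, Set.image_id _⟩

theorem voronoiCell_pair {k : ℕ} {v : EuclideanSpace ℝ (Fin k)} (hv : ‖v‖ = 1) :
    voronoiCell {v, -v} v = {z | 0 ≤ ⟪z, v⟫} := by
  ext z
  rw [mem_voronoiCell_iff_inner (isSphericalCode_pair hv).2 (Set.mem_insert _ _)]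
  simp only [Set.mem_insert_iff, Set.mem_singleton_iff, forall_eq_or_imp, forall_eq, le_refl,
    true_and, inner_neg_right, Set.mem_ofPred_eq]
  constructor <;> intro h <;> linarith

theorem voronoiCell_pair_neg {k : ℕ} {v : EuclideanSpace ℝ (Fin k)} (hv : ‖v‖ = 1) :
    voronoiCell {v, -v} (-v) = {z | 0 ≤ ⟪z, -v⟫} := by
  have h := voronoiCell_pair (v := -v) (by rwa [norm_neg])
  rwa [neg_neg, Set.pair_comm] at h

/-- Only the inner products with v enter, and these are independent standard normals whatever k is.
This frees the antipodal pair from its dimension. -/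
theorem noiseStability_halfSpace {k : ℕ} {v : EuclideanSpace ℝ (Fin k)} (hv : ‖v‖ = 1) (c : ℝ) :
    noiseStability {z : EuclideanSpace ℝ (Fin k) | 0 ≤ ⟪z, v⟫} c =
      planeGaussian.real {p | 0 ≤ p.1 ∧ 0 ≤ c * p.1 + √(1 - c ^ 2) * p.2} := by
  have h1 : (stdGaussian (EuclideanSpace ℝ (Fin k))).map (fun z => ⟪z, v⟫) = gaussianReal 0 1 := by
    rw [map_inner_stdGaussian]
    congr 1
    ext
    simp [hv]
  have hm : Measurable fun z : EuclideanSpace ℝ (Fin k) => ⟪z, v⟫ := by fun_prop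
  have hS : MeasurableSet {p : ℝ × ℝ | 0 ≤ p.1 ∧ 0 ≤ c * p.1 + √(1 - c ^ 2) * p.2} :=
    (measurableSet_le measurable_const measurable_fst).inter
      (measurableSet_le measurable_const
        ((measurable_fst.const_mul c).add (measurable_snd.const_mul _)))
  rw [planeGaussian, ← h1, Measure.map_prod_map _ _ hm hm,
    map_measureReal_apply (hm.prodMap hm) hS, noiseStability]
  congr 1
  ext z
  simp [correlate, inner_add_left, real_inner_smul_left]

theorem exists_isDecoder_pair {k : ℕ} {v : EuclideanSpace ℝ (Fin k)} (hv : ‖v‖ = 1) :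
    ∃ dec, IsDecoder ({v, -v} : Set (EuclideanSpace ℝ (Fin k))) dec := by
  classical
  refine ⟨fun z => if 0 ≤ ⟪z, v⟫ then v else -v, fun z => ?_⟩
  by_cases h : 0 ≤ ⟪z, v⟫
  · simp only [if_pos h]
    refine ⟨Set.mem_insert _ _, ?_⟩
    rw [voronoiCell_pair hv]
    exact h
  · simp only [if_neg h]
    refine ⟨Set.mem_insert_of_mem _ rfl, ?_⟩
    rw [voronoiCell_pair_neg hv]
    simp only [Set.mem_ofPred_eq, inner_neg_right]
    linarith

/-- The probability is evaluated by the sector formula for a 2-gon in the plane; since it does not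
involve k, the value then serves in every dimension. -/
theorem planeGaussian_halfSpace {c : ℝ} (hc : c ^ 2 < 1) :
    planeGaussian.real {p | 0 ≤ p.1 ∧ 0 ≤ c * p.1 + √(1 - c ^ 2) * p.2} =
      isogonalCollision 2 c / 2 := by
  set v : EuclideanSpace ℝ (Fin 2) := EuclideanSpace.single 0 1
  have hv : ‖v‖ = 1 := by simp [v]
  obtain ⟨dec, hd⟩ := exists_isDecoder_pair hv
  have hn : ({v, -v} : Set (EuclideanSpace ℝ (Fin 2))).ncard = 2 :=
    Set.ncard_pair (ne_neg_of_norm_eq_one hv)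
  have h := (isIsogonal_pair v).noiseStability_voronoiCell (isSphericalCode_pair hv) hn.ge hd hc
    (Set.mem_insert _ _)
  rw [voronoiCell_pair hv, noiseStability_halfSpace hv, hn] at h
  exact_mod_cast h

theorem pairCollision_pair {k d : ℕ} {v : EuclideanSpace ℝ (Fin k)}
    {dec : EuclideanSpace ℝ (Fin k) → EuclideanSpace ℝ (Fin k)} (hv : ‖v‖ = 1)
    (hd : IsDecoder {v, -v} dec) {x y : EuclideanSpace ℝ (Fin d)} (hx : ‖x‖ = 1) (hy : ‖y‖ = 1)
    (hc : ⟪x, y⟫ ^ 2 < 1) : pairCollision dec x y = isogonalCollision 2 ⟪x, y⟫ := by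
  classical
  have hset : (isSphericalCode_pair hv).1.toFinset = {v, -v} := by ext; simp
  rw [pairCollision_eq_sum (isSphericalCode_pair hv) hd x y hx hy, hset,
    Finset.sum_pair (ne_neg_of_norm_eq_one hv), voronoiCell_pair hv, voronoiCell_pair_neg hv,
    noiseStability_halfSpace hv, noiseStability_halfSpace (by rwa [norm_neg]),
    planeGaussian_halfSpace hc]
  ring

theorem indepCollision_pair {k : ℕ} {v : EuclideanSpace ℝ (Fin k)}
    {dec : EuclideanSpace ℝ (Fin k) → EuclideanSpace ℝ (Fin k)} (hv : ‖v‖ = 1)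
    (hd : IsDecoder {v, -v} dec) : indepCollision dec = 1 / 2 := by
  rw [(isIsogonal_pair v).indepCollision_eq (isSphericalCode_pair hv) hd,
    Set.ncard_pair (ne_neg_of_norm_eq_one hv)]
  norm_num

/-! ### The slope inequality for sectors -/

theorem monotoneOn_Icc_of_hasDerivAt {f f' : ℝ → ℝ} {a b : ℝ}
    (hf : ∀ t, a ≤ t → t ≤ b → HasDerivAt f (f' t) t) (h : ∀ t, a < t → t < b → 0 ≤ f' t) :
    MonotoneOn f (Set.Icc a b) := by
  refine monotoneOn_of_deriv_nonneg (convex_Icc a b)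
    (fun t ht => (hf t ht.1 ht.2).continuousAt.continuousWithinAt) (fun t ht => ?_) fun t ht => ?_
  · rw [interior_Icc] at ht
    exact (hf t ht.1.le ht.2.le).differentiableAt.differentiableWithinAt
  · rw [interior_Icc] at ht
    rw [(hf t ht.1.le ht.2.le).deriv]
    exact h t ht.1 ht.2

/-- A function whose second derivative changes sign at most once, from plus to minus, is
nonnegative if it is so at both ends and starts with a nonnegative slope. -/
theorem nonneg_of_second_deriv_sign_change {f f' f'' : ℝ → ℝ} {T : ℝ}
    (hf : ∀ t, 0 ≤ t → t ≤ T → HasDerivAt f (f' t) t)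
    (hf' : ∀ t, 0 ≤ t → t ≤ T → HasDerivAt f' (f'' t) t)
    (h0 : 0 ≤ f 0) (h0' : 0 ≤ f' 0) (hT : 0 ≤ f T)
    (hs : ∀ s t, 0 < s → s ≤ t → t < T → f'' s < 0 → f'' t ≤ 0) {t : ℝ} (ht0 : 0 ≤ t)
    (htT : t ≤ T) : 0 ≤ f t := by
  have hA : ∀ τ, 0 ≤ τ → τ ≤ T → (∀ s, 0 < s → s < τ → 0 ≤ f'' s) → 0 ≤ f τ := by
    intro τ h1 h2 h3
    have hm' : MonotoneOn f' (Set.Icc 0 τ) :=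
      monotoneOn_Icc_of_hasDerivAt (fun t a b => hf' t a (b.trans h2)) h3
    have hm : MonotoneOn f (Set.Icc 0 τ) :=
      monotoneOn_Icc_of_hasDerivAt (fun t a b => hf t a (b.trans h2)) fun t a b =>
        h0'.trans (hm' ⟨le_rfl, h1⟩ ⟨a.le, b.le⟩ a.le)
    exact h0.trans (hm ⟨le_rfl, h1⟩ ⟨h1, le_rfl⟩ h1)
  by_cases hcase : ∀ s, 0 < s → s < t → 0 ≤ f'' s
  · exact hA t ht0 htT hcase
  push Not at hcase
  obtain ⟨s₀, hs0, hs1, hs2⟩ := hcase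
  -- The infimum τ of the points with negative second derivative splits the interval: f increases
  -- from f 0 up to τ and is concave from τ to T.
  set Z : Set ℝ := {s | 0 < s ∧ s < T ∧ f'' s < 0} with hZ
  have hZb : BddBelow Z := ⟨0, fun s hs => hs.1.le⟩
  have hs₀ : s₀ ∈ Z := ⟨hs0, hs1.trans_le htT, hs2⟩
  set τ := sInf Z with hτ
  have hτ0 : 0 ≤ τ := le_csInf ⟨s₀, hs₀⟩ fun s hs => hs.1.le
  have hτt : τ ≤ t := (csInf_le hZb hs₀).trans hs1.le
  have hτf : 0 ≤ f τ := by
    refine hA τ hτ0 (hτt.trans htT) fun s h1 h2 => ?_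
    by_contra hneg
    push Not at hneg
    exact absurd (csInf_le hZb ⟨h1, (h2.trans_le hτt).trans_le htT, hneg⟩) (not_le.2 h2)
  have hneg : ∀ s, τ < s → s < T → f'' s ≤ 0 := by
    intro s h1 h2
    obtain ⟨r, hr, hrs⟩ := exists_lt_of_csInf_lt ⟨s₀, hs₀⟩ h1
    exact hs r s hr.1 hrs.le h2 hr.2.2
  have hanti : AntitoneOn f' (Set.Icc τ T) := by
    have := monotoneOn_Icc_of_hasDerivAt (f := fun t => -f' t) (f' := fun t => -f'' t) (a := τ)
      (b := T) (fun t a b => (hf' t (hτ0.trans a) b).neg)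
      fun t a b => neg_nonneg.2 (hneg t a b)
    exact fun x hx y hy hxy => neg_le_neg_iff.1 (this hx hy hxy)
  have hconc : ConcaveOn ℝ (Set.Icc τ T) f := by
    refine AntitoneOn.concaveOn_of_deriv (convex_Icc τ T)
      (fun t ht => (hf t (hτ0.trans ht.1) ht.2).continuousAt.continuousWithinAt) (fun t ht => ?_) ?_
    · rw [interior_Icc] at ht
      exact (hf t (hτ0.trans ht.1.le) ht.2.le).differentiableAt.differentiableWithinAt
    · rw [interior_Icc]
      intro x hx y hy hxy
      rw [(hf x (hτ0.trans hx.1.le) hx.2.le).deriv, (hf y (hτ0.trans hy.1.le) hy.2.le).deriv]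
      exact hanti ⟨hx.1.le, hx.2.le⟩ ⟨hy.1.le, hy.2.le⟩ hxy
  -- A concave function on [τ, T] is at least the smaller of its two end values.
  have := hconc.ge_on_segment (x := τ) (y := T) (z := t) ⟨le_rfl, hτt.trans htT⟩
    ⟨hτt.trans htT, le_rfl⟩ (by rw [segment_eq_Icc (hτt.trans htT)]; exact ⟨hτt, htT⟩)
  exact (le_min hτf hT).trans this

theorem hasDerivAt_angularKernel {μ : ℝ} (h : μ ^ 2 < 1) :
    HasDerivAt angularKernel (Real.arccos (-μ) / √(1 - μ ^ 2) ^ 3 +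
      3 * μ * (√(1 - μ ^ 2) + μ * Real.arccos (-μ)) / √(1 - μ ^ 2) ^ 5) μ := by
  have hr : 0 < √(1 - μ ^ 2) := Real.sqrt_pos.2 (by linarith)
  have hrr : √(1 - μ ^ 2) ^ 2 = 1 - μ ^ 2 := Real.sq_sqrt (by linarith)
  have h1 : HasDerivAt (fun x : ℝ => 1 - x ^ 2) (-(2 * μ)) μ := by
    simpa using ((hasDerivAt_id μ).pow 2).const_sub 1
  have h2 := (hasDerivAt_const μ (1 : ℝ)).div h1 (by linarith)
  have h3 := ((hasDerivAt_id μ).mul (hasDerivAt_arccos_neg h)).div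
    ((hasDerivAt_sqrt_one_sub_sq h).pow 3) (pow_ne_zero 3 hr.ne')
  convert! h2.add h3 using 1
  simp only [Pi.mul_apply, Pi.pow_apply, id]
  rw [← hrr]
  set r := √(1 - μ ^ 2)
  rw [Real.sqrt_sq hr.le]
  field_simp
  push_cast
  ring

/-- The ratio whose reciprocal measures the logarithmic derivative of the sector kernel. -/
noncomputable def kernelRatio (μ : ℝ) : ℝ :=
  Real.arccos (-μ) * (1 - μ ^ 2) / (√(1 - μ ^ 2) + μ * Real.arccos (-μ))

theorem pi_div_two_le_arccos_neg {μ : ℝ} (h : 0 ≤ μ) : Real.pi / 2 ≤ Real.arccos (-μ) := by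
  rw [Real.arccos]
  have := Real.arcsin_nonpos.2 (neg_nonpos.2 h)
  linarith

/-- With A = arccos(−μ), the reciprocal is 1/(A√(1 − μ²)) + μ/(1 − μ²). The first term has
derivative at least −1/(1 − μ²) because A ≥ 1, and the second has derivative at least 1/(1 − μ²). -/
theorem kernelRatio_antitoneOn : AntitoneOn kernelRatio (Set.Ico 0 1) := by
  have hR : MonotoneOn (fun μ => 1 / (Real.arccos (-μ) * √(1 - μ ^ 2)) + μ / (1 - μ ^ 2))
      (Set.Ico 0 1) := by
    have hd : ∀ μ ∈ Set.Ico (0 : ℝ) 1, HasDerivAt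
        (fun μ => 1 / (Real.arccos (-μ) * √(1 - μ ^ 2)) + μ / (1 - μ ^ 2))
        (-(1 - μ * Real.arccos (-μ) / √(1 - μ ^ 2)) / (Real.arccos (-μ) ^ 2 * (1 - μ ^ 2)) +
          (1 + μ ^ 2) / (1 - μ ^ 2) ^ 2) μ := by
      intro μ hμ
      have h : μ ^ 2 < 1 := by nlinarith [hμ.1, hμ.2]
      have hr : 0 < √(1 - μ ^ 2) := Real.sqrt_pos.2 (by linarith)
      have hrr : √(1 - μ ^ 2) ^ 2 = 1 - μ ^ 2 := Real.sq_sqrt (by linarith)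
      have hA : 0 < Real.arccos (-μ) := by
        linarith [pi_div_two_le_arccos_neg hμ.1, Real.pi_pos]
      have h1 : HasDerivAt (fun x : ℝ => 1 - x ^ 2) (-(2 * μ)) μ := by
        simpa using ((hasDerivAt_id μ).pow 2).const_sub 1
      have h2 := (hasDerivAt_const μ (1 : ℝ)).div
        ((hasDerivAt_arccos_neg h).mul (hasDerivAt_sqrt_one_sub_sq h)) (mul_pos hA hr).ne'
      have h3 := (hasDerivAt_id μ).div h1 (by linarith)
      convert! h2.add h3 using 1
      simp only [Pi.mul_apply, id]
      rw [← hrr]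
      set r := √(1 - μ ^ 2)
      rw [Real.sqrt_sq hr.le]
      have : μ ^ 2 = 1 - r ^ 2 := by rw [hrr]; ring
      field_simp
      linear_combination -Real.arccos (-μ) ^ 2 * this
    refine monotoneOn_of_deriv_nonneg (convex_Ico 0 1)
      (fun t ht => (hd t ht).continuousAt.continuousWithinAt) (fun t ht => ?_) fun t ht => ?_
    · exact (hd t (interior_subset ht)).differentiableAt.differentiableWithinAt
    · have ht := interior_subset ht
      rw [(hd t ht).deriv]
      have hm : 0 < 1 - t ^ 2 := by nlinarith [ht.1, ht.2]
      have hA : 1 ≤ Real.arccos (-t) := by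
        linarith [pi_div_two_le_arccos_neg ht.1, Real.pi_gt_three]
      have e1 : 0 ≤ t * Real.arccos (-t) / √(1 - t ^ 2) :=
        div_nonneg (mul_nonneg ht.1 (by linarith)) (Real.sqrt_nonneg _)
      have e2 : -1 / (1 - t ^ 2) ≤ -(1 - t * Real.arccos (-t) / √(1 - t ^ 2)) /
          (Real.arccos (-t) ^ 2 * (1 - t ^ 2)) := by
        rw [div_le_div_iff₀ hm (by positivity)]
        have : 1 ≤ Real.arccos (-t) ^ 2 := by nlinarith
        nlinarith
      have e3 : 1 / (1 - t ^ 2) ≤ (1 + t ^ 2) / (1 - t ^ 2) ^ 2 := by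
        rw [div_le_div_iff₀ hm (by positivity)]
        nlinarith [sq_nonneg t]
      have e4 : -1 / (1 - t ^ 2) + 1 / (1 - t ^ 2) = 0 := by ring
      linarith
  have hinv : ∀ μ ∈ Set.Ico (0 : ℝ) 1, kernelRatio μ =
      (1 / (Real.arccos (-μ) * √(1 - μ ^ 2)) + μ / (1 - μ ^ 2))⁻¹ ∧
      0 < 1 / (Real.arccos (-μ) * √(1 - μ ^ 2)) + μ / (1 - μ ^ 2) := by
    intro μ hμ
    have h : 0 < 1 - μ ^ 2 := by nlinarith [hμ.1, hμ.2]
    have hr : 0 < √(1 - μ ^ 2) := Real.sqrt_pos.2 h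
    have hrr : √(1 - μ ^ 2) ^ 2 = 1 - μ ^ 2 := Real.sq_sqrt h.le
    have hA : 0 < Real.arccos (-μ) := by
      linarith [pi_div_two_le_arccos_neg hμ.1, Real.pi_pos]
    have hμ0 := hμ.1
    refine ⟨?_, by positivity⟩
    rw [kernelRatio, ← hrr]
    set r := √(1 - μ ^ 2)
    rw [Real.sqrt_sq hr.le]
    field_simp
  intro x hx y hy hxy
  rw [(hinv x hx).1, (hinv y hy).1]
  exact inv_anti₀ (hinv x hx).2 (hR hx hy hxy)

theorem kernelRatio_nonneg {μ : ℝ} (h0 : 0 ≤ μ) (h1 : μ < 1) : 0 ≤ kernelRatio μ := by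
  have h : 0 < 1 - μ ^ 2 := by nlinarith
  have := Real.arccos_nonneg (-μ)
  unfold kernelRatio
  positivity

/-- The ratio is at least (π/2)(1 − μπ/2)(1 − μ²), so it falls short of (π/2)(1 − μ²) by at most
(π²/4)μ, and π²/4 < 3. -/
theorem le_three_mul_add_kernelRatio {μ : ℝ} (h0 : 0 ≤ μ) (h1 : μ < 1) :
    Real.pi / 2 * (1 - μ ^ 2) ≤ 3 * μ + kernelRatio μ := by
  have hm : 0 < 1 - μ ^ 2 := by nlinarith
  have hA := pi_div_two_le_arccos_neg h0
  have hpi := Real.pi_gt_three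
  have hpi' := Real.pi_lt_d2
  have hr : √(1 - μ ^ 2) ≤ 1 := by
    exact Real.sqrt_le_iff.2 ⟨zero_le_one, by nlinarith⟩
  have hr0 : 0 < √(1 - μ ^ 2) := Real.sqrt_pos.2 hm
  set A := Real.arccos (-μ)
  have hA0 : 0 < A := by linarith
  have e1 : Real.pi / 2 * (1 - μ * (Real.pi / 2)) * (1 - μ ^ 2) ≤ kernelRatio μ := by
    unfold kernelRatio
    have hk : 0 < √(1 - μ ^ 2) + μ * A := by positivity
    rw [le_div_iff₀ hk, mul_right_comm]
    refine mul_le_mul_of_nonneg_right ?_ hm.le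
    rcases le_or_gt 0 (1 - μ * (Real.pi / 2)) with hp | hp
    · calc Real.pi / 2 * (1 - μ * (Real.pi / 2)) * (√(1 - μ ^ 2) + μ * A)
          ≤ Real.pi / 2 * (1 - μ * (Real.pi / 2)) * (1 + μ * A) := by gcongr
        _ ≤ A := by
          nlinarith [mul_nonneg (sub_nonneg.2 hA) hp,
            mul_nonneg (sq_nonneg (μ * (Real.pi / 2))) hA0.le]
    · have : Real.pi / 2 * (1 - μ * (Real.pi / 2)) * (√(1 - μ ^ 2) + μ * A) ≤ 0 :=
        mul_nonpos_of_nonpos_of_nonneg (mul_nonpos_of_nonneg_of_nonpos (by linarith) hp.le) hk.le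
      linarith
  have e2 : Real.pi / 2 * (Real.pi / 2) ≤ 3 := by nlinarith
  nlinarith [mul_nonneg h0 hm.le, mul_nonneg h0 (sq_nonneg μ), mul_nonneg (mul_nonneg h0 hm.le) (sub_nonneg.2 e2)]

/-- The difference vanishes at 0, with zero slope, and at 1/2. Its second derivative 12(1 − 2y) − π²
cos(πy) changes sign at most once, a concave cosine being compared with a line that vanishes with it
at 1/2. This is the case t = π/2 of `sector_slope`, with y = θ/π. -/
theorem cubic_le_cos_pi_mul {y : ℝ} (h0 : 0 ≤ y) (h1 : y ≤ 1 / 2) :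
    1 - 6 * y ^ 2 + 4 * y ^ 3 ≤ Real.cos (Real.pi * y) := by
  have hpi := Real.pi_pos
  have hd : ∀ t : ℝ, HasDerivAt (fun t => Real.pi * t) Real.pi t := fun t => by
    simpa using (hasDerivAt_id t).const_mul Real.pi
  have key := nonneg_of_second_deriv_sign_change (T := 1 / 2)
    (f := fun t => Real.cos (Real.pi * t) - (1 - 6 * t ^ 2 + 4 * t ^ 3))
    (f' := fun t => -(Real.pi * Real.sin (Real.pi * t)) + (12 * t - 12 * t ^ 2))
    (f'' := fun t => -(Real.pi ^ 2 * Real.cos (Real.pi * t)) + (12 - 24 * t))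
    (fun t _ _ => ?_) (fun t _ _ => ?_) (by simp) (by simp) ?_ ?_ h0 h1
  · linarith
  · have e1 := ((hasDerivAt_pow 2 t).const_mul 6).const_sub 1
    have e2 := (hasDerivAt_pow 3 t).const_mul 4
    convert! (hd t).cos.sub (e1.add e2) using 1
    simp
    ring
  · have e1 := (hasDerivAt_id t).const_mul 12
    have e2 := (hasDerivAt_pow 2 t).const_mul 12
    convert! (((hd t).sin.const_mul Real.pi).neg).add (e1.sub e2) using 1
    simp
    ring
  · rw [mul_one_div, Real.cos_pi_div_two]
    norm_num
  · intro s t hs hst ht h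
    have hm1 : Real.pi * s ∈ Set.Icc (-(Real.pi / 2)) (Real.pi / 2) :=
      ⟨by nlinarith, by nlinarith⟩
    have hm2 : Real.pi / 2 ∈ Set.Icc (-(Real.pi / 2)) (Real.pi / 2) := ⟨by linarith, le_rfl⟩
    -- The point πt is a convex combination of πs and π/2; the cosine lies above its chord there,
    -- while 12 − 24t scales exactly with the weight of πs.
    have hc := strictConcaveOn_cos_Icc.concaveOn.2 hm1 hm2
      (show 0 ≤ (1 - 2 * t) / (1 - 2 * s) from
        div_nonneg (by linarith) (by linarith))
      (show 0 ≤ (2 * t - 2 * s) / (1 - 2 * s) from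
        div_nonneg (by linarith) (by linarith))
      (by rw [← add_div, div_eq_one_iff_eq (by linarith)]; ring)
    have hne : 1 - 2 * s ≠ 0 := by linarith
    have hpt : (1 - 2 * t) / (1 - 2 * s) * (Real.pi * s) +
        (2 * t - 2 * s) / (1 - 2 * s) * (Real.pi / 2) = Real.pi * t := by
      field_simp
      ring
    simp only [smul_eq_mul, Real.cos_pi_div_two, mul_zero, add_zero] at hc
    rw [hpt] at hc
    have hl : 0 ≤ (1 - 2 * t) / (1 - 2 * s) := div_nonneg (by linarith) (by linarith)
    have h2 := mul_nonneg_of_nonpos_of_nonpos (neg_nonpos.2 hl) h.le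
    have h3 : (1 - 2 * t) / (1 - 2 * s) * (12 - 24 * s) = 12 - 24 * t := by
      field_simp
      ring
    have h4 := mul_le_mul_of_nonneg_left hc (sq_nonneg Real.pi)
    nlinarith

/-- The sign of the second derivative of the comparison function in `sector_slope`. -/
noncomputable def slopeSign (c κ t : ℝ) : ℝ :=
  t * (c * Real.sin t) * (3 * (c * Real.cos t) + kernelRatio (c * Real.cos t)) -
    κ * (1 - (c * Real.cos t) ^ 2)

/-- The term with `kernelRatio` is a product of nonnegative increasing factors. What remains has
derivative (c²/2)(sin 2t + 6t cos 2t) + 2c²(1 − κ) sin t cos t. The endpoint 0.872 keeps the first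
bracket nonnegative and is large enough for `slopeSign_nonneg` to take over. -/
theorem monotoneOn_slopeSign {c κ : ℝ} (hc0 : 0 < c) (hc1 : c < 1) (hκ : κ ≤ 1) :
    MonotoneOn (slopeSign c κ) (Set.Icc 0 0.872) := by
  have hpi := Real.pi_gt_d4
  have h1 : MonotoneOn (fun t => 3 * c ^ 2 * (t * (Real.sin t * Real.cos t)) -
      κ * (1 - (c * Real.cos t) ^ 2)) (Set.Icc 0 0.872) := by
    refine monotoneOn_Icc_of_hasDerivAt (f' := fun t => 3 * c ^ 2 * (Real.sin t * Real.cos t +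
      t * (Real.cos t ^ 2 - Real.sin t ^ 2)) - κ * (2 * c ^ 2 * (Real.sin t * Real.cos t)))
      (fun t _ _ => ?_) fun t h0 h1 => ?_
    · have e1 := ((hasDerivAt_id t).mul ((Real.hasDerivAt_sin t).mul
        (Real.hasDerivAt_cos t))).const_mul (3 * c ^ 2)
      have e2 := (((hasDerivAt_mul_cos c t).pow 2).const_sub 1).const_mul κ
      convert! e1.sub e2 using 1
      simp
      ring
    · have hs := Real.sin_pos_of_pos_of_lt_pi h0 (by linarith)
      have hco := Real.cos_pos_of_mem_Ioo (x := t) ⟨by linarith, by linarith⟩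
      have hsc := mul_pos hs hco
      have key : 0 ≤ Real.sin (2 * t) + 3 * (2 * t) * Real.cos (2 * t) := by
        rcases le_or_gt (2 * t) (Real.pi / 2) with h2 | h2
        · have := Real.cos_nonneg_of_mem_Icc (x := 2 * t) ⟨by linarith, h2⟩
          have := Real.sin_nonneg_of_nonneg_of_le_pi (x := 2 * t) (by linarith) (by linarith)
          positivity
        -- Here cos 2t is negative, but 2t exceeds π/2 by at most 0.1735, so cos e dominates 6t sin
        -- e.
        · set e := 2 * t - Real.pi / 2 with he
          have e1 : Real.sin (2 * t) = Real.cos e := by rw [he, Real.cos_sub_pi_div_two]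
          have e2 : Real.cos (2 * t) = -Real.sin e := by rw [he, Real.sin_sub_pi_div_two, neg_neg]
          have e3 : 0 < e := by linarith
          have e4 : e ≤ 0.1735 := by linarith
          have e5 := Real.one_sub_sq_div_two_le_cos (x := e)
          have e6 := Real.sin_le e3.le
          rw [e1, e2]
          nlinarith
      rw [Real.sin_two_mul, Real.cos_two_mul'] at key
      have : 3 * c ^ 2 * (Real.sin t * Real.cos t +
          t * (Real.cos t ^ 2 - Real.sin t ^ 2)) - κ * (2 * c ^ 2 * (Real.sin t * Real.cos t)) =
          c ^ 2 / 2 * (2 * Real.sin t * Real.cos t +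
            3 * (2 * t) * (Real.cos t ^ 2 - Real.sin t ^ 2)) +
          2 * c ^ 2 * (1 - κ) * (Real.sin t * Real.cos t) := by ring
      rw [this]
      have := sub_nonneg.2 hκ
      positivity
  intro s hs t ht hst
  have ht2 : t ≤ 0.872 := ht.2
  have hs0 : 0 ≤ s := hs.1
  have hsin : Real.sin s ≤ Real.sin t :=
    Real.sin_le_sin_of_le_of_le_pi_div_two (by linarith) (by linarith) hst
  have hsin0 : 0 ≤ Real.sin s := Real.sin_nonneg_of_nonneg_of_le_pi hs0 (by linarith)
  have hcos : Real.cos t ≤ Real.cos s := Real.cos_le_cos_of_nonneg_of_le_pi hs0 (by linarith) hst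
  have hcos0 : 0 ≤ Real.cos t := Real.cos_nonneg_of_mem_Icc ⟨by linarith, by linarith⟩
  have hlt : c * Real.cos s < 1 := by nlinarith [Real.cos_le_one s]
  have hW := kernelRatio_antitoneOn (a := c * Real.cos t) (b := c * Real.cos s)
    ⟨by positivity, by nlinarith⟩ ⟨mul_nonneg hc0.le (hcos0.trans hcos), hlt⟩
    (mul_le_mul_of_nonneg_left hcos hc0.le)
  have hW0 := kernelRatio_nonneg (mul_nonneg hc0.le (hcos0.trans hcos)) hlt
  have h2 : s * (c * Real.sin s) * kernelRatio (c * Real.cos s) ≤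
      t * (c * Real.sin t) * kernelRatio (c * Real.cos t) := by
    have : 0 ≤ Real.sin t := hsin0.trans hsin
    have : 0 ≤ t := hs0.trans hst
    gcongr
  have h3 := h1 hs ht hst
  simp only at h3
  unfold slopeSign
  nlinarith

/-- From 0.872 on, t sin t ≥ 2/π, since 0.872 · 0.7313 > 2/π. Multiplied by
`le_three_mul_add_kernelRatio` this bounds the first term below by c(1 − (c cos t)²). -/
theorem slopeSign_nonneg {c κ t : ℝ} (hc0 : 0 < c) (hc1 : c < 1) (hκ : κ ≤ c) (h0 : 0.872 ≤ t)
    (h1 : t ≤ Real.pi / 2) : 0 ≤ slopeSign c κ t := by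
  have hpi := Real.pi_gt_d4
  have hsin1 : 0.7313 ≤ Real.sin 0.872 := by
    have := Real.sin_bound (x := 0.872) (by rw [abs_of_pos] <;> norm_num)
    rw [abs_of_pos (show (0 : ℝ) < 0.872 by norm_num)] at this
    have := (abs_le.1 this).1
    norm_num at this ⊢
    linarith
  have hsin : Real.sin 0.872 ≤ Real.sin t :=
    Real.sin_le_sin_of_le_of_le_pi_div_two (by linarith) h1 h0
  have hts : 2 / Real.pi ≤ t * Real.sin t := by
    rw [div_le_iff₀ Real.pi_pos]
    have : (0.872 : ℝ) * 0.7313 ≤ t * Real.sin t :=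
      mul_le_mul h0 (hsin1.trans hsin) (by norm_num) (by linarith)
    nlinarith
  have hcos0 : 0 ≤ Real.cos t := Real.cos_nonneg_of_mem_Icc ⟨by linarith, h1⟩
  have hμ0 : 0 ≤ c * Real.cos t := by positivity
  have hμ1 : c * Real.cos t < 1 := by nlinarith [Real.cos_le_one t]
  have hW := le_three_mul_add_kernelRatio hμ0 hμ1
  have hm : 0 ≤ 1 - (c * Real.cos t) ^ 2 := by nlinarith
  have e1 : c * (2 / Real.pi) * (Real.pi / 2 * (1 - (c * Real.cos t) ^ 2)) ≤
      t * (c * Real.sin t) * (3 * (c * Real.cos t) + kernelRatio (c * Real.cos t)) := by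
    have : c * (2 / Real.pi) ≤ t * (c * Real.sin t) := by nlinarith
    have h2 : 0 ≤ c * (2 / Real.pi) := by positivity
    exact mul_le_mul this hW (by positivity) (h2.trans this)
  have e2 : c * (2 / Real.pi) * (Real.pi / 2 * (1 - (c * Real.cos t) ^ 2)) =
      c * (1 - (c * Real.cos t) ^ 2) := by
    field_simp
  unfold slopeSign
  nlinarith

theorem hypAngle_cos_zero {θ : ℝ} (h0 : 0 ≤ θ) (h1 : θ ≤ Real.pi) :
    hypAngle (Real.cos θ) 0 = Real.pi - θ := by
  rw [hypAngle, Real.cos_zero, mul_one, Real.arccos_neg, Real.arccos_cos h0 h1]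

theorem hypAngle_pi_div_two (c : ℝ) : hypAngle c (Real.pi / 2) = Real.pi / 2 := by
  simp [hypAngle]

/-- The logarithmic derivative of the kernel in μ is (3μ + `kernelRatio` μ)/(1 − μ²). The chain rule
with μ = c cos t leaves `slopeSign` times the positive factor k, the kernel divided by 1 − μ². -/
theorem hasDerivAt_angularKernel_cos {c : ℝ} (hc0 : 0 < c) (hc : c ^ 2 < 1) {t : ℝ} (h0 : 0 ≤ t)
    (h1 : t ≤ Real.pi / 2) :
    ∃ K' k : ℝ, HasDerivAt (fun t => angularKernel (c * Real.cos t)) K' t ∧ 0 < k ∧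
      ∀ κ, κ * angularKernel (c * Real.cos t) + t * K' = -(k * slopeSign c κ t) := by
  have hμ := mul_cos_sq_lt_one hc t
  have hcos0 : 0 ≤ Real.cos t := Real.cos_nonneg_of_mem_Icc ⟨by linarith [Real.pi_pos], h1⟩
  have hμ0 : 0 ≤ c * Real.cos t := by positivity
  have hA := Real.arccos_nonneg (-(c * Real.cos t))
  have hr : 0 < √(1 - (c * Real.cos t) ^ 2) := Real.sqrt_pos.2 (by linarith)
  have hrr : √(1 - (c * Real.cos t) ^ 2) ^ 2 = 1 - (c * Real.cos t) ^ 2 :=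
    Real.sq_sqrt (by linarith)
  have hd := HasDerivAt.comp (h₂ := angularKernel) (h := fun x => c * Real.cos x) t
    (hasDerivAt_angularKernel hμ) (hasDerivAt_mul_cos c t)
  refine ⟨_, (√(1 - (c * Real.cos t) ^ 2) + c * Real.cos t *
    Real.arccos (-(c * Real.cos t))) / √(1 - (c * Real.cos t) ^ 2) ^ 5,
    hd, by positivity, fun κ => ?_⟩
  unfold slopeSign kernelRatio angularKernel
  set r := √(1 - (c * Real.cos t) ^ 2)
  rw [← hrr]
  set A := Real.arccos (-(c * Real.cos t))
  have hk : r + c * Real.cos t * A ≠ 0 := by positivity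
  field_simp
  ring

/-- The difference of the two sides vanishes with its slope at 0 and is nonnegative at π/2 by
`cubic_le_cos_pi_mul`. Its second derivative is a negative multiple of `slopeSign`, which, once
positive, never becomes negative again; so `nonneg_of_second_deriv_sign_change` applies. -/
theorem sector_slope {θ : ℝ} (hθ0 : 0 < θ) (hθ1 : θ < Real.pi / 2) {t : ℝ} (h0 : 0 ≤ t)
    (h1 : t ≤ Real.pi / 2) :
    (1 + 2 * θ / Real.pi) * (t ^ 2 - hypAngle (Real.cos θ) t ^ 2 + hypAngle (Real.cos θ) 0 ^ 2) ≤
      2 * t * angularMass (Real.cos θ) t := by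
  have hpi := Real.pi_pos
  set c := Real.cos θ with hcdef
  have hc0 : 0 < c := Real.cos_pos_of_mem_Ioo ⟨by linarith, hθ1⟩
  have hc1 : c < 1 := by
    rw [hcdef, ← Real.cos_zero]
    exact Real.cos_lt_cos_of_nonneg_of_le_pi le_rfl (by linarith) hθ0
  have hc : c ^ 2 < 1 := by nlinarith
  have hl0 : 0 < 2 * θ / Real.pi := by positivity
  have hl1 : 2 * θ / Real.pi < 1 := by rw [div_lt_one hpi]; linarith
  set l := 2 * θ / Real.pi with hl
  have hκc : 1 - l ≤ c := by
    have := Real.one_sub_mul_le_cos hθ0.le hθ1.le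
    rw [hl]
    convert! this using 2
    ring
  have hKd : ∀ t, 0 ≤ t → t ≤ Real.pi / 2 → ∃ K' k : ℝ,
      HasDerivAt (fun t => angularKernel (c * Real.cos t)) K' t ∧ 0 < k ∧
      ∀ κ, κ * angularKernel (c * Real.cos t) + t * K' = -(k * slopeSign c κ t) :=
    fun t a b => hasDerivAt_angularKernel_cos hc0 hc a b
  have key := nonneg_of_second_deriv_sign_change (T := Real.pi / 2)
    (f := fun t => 2 * t * angularMass c t - (1 + l) * (t ^ 2 - hypAngle c t ^ 2 + hypAngle c 0 ^ 2))
    (f' := fun t => 2 * (1 - c ^ 2) * t * angularKernel (c * Real.cos t) - 2 * l * angularMass c t)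
    (f'' := fun t => 2 * (1 - c ^ 2) * ((1 - l) * angularKernel (c * Real.cos t) +
      t * deriv (fun t => angularKernel (c * Real.cos t)) t))
    (fun t _ _ => ?_) (fun t a b => ?_) (by simp) (by simp [angularMass]) ?_ ?_ h0 h1
  · linarith
  · have e1 := ((hasDerivAt_id t).const_mul 2).mul (hasDerivAt_angularMass hc t)
    have e2 := ((hasDerivAt_sq_sub_hypAngle_sq hc t).add_const (hypAngle c 0 ^ 2)).const_mul (1 + l)
    convert! e1.sub e2 using 1
    simp
    ring
  · obtain ⟨K', k, hK, -, -⟩ := hKd t a b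
    have e1 := (((hasDerivAt_id t).const_mul (2 * (1 - c ^ 2)))).mul hK
    have e2 := (hasDerivAt_angularMass hc t).const_mul (2 * l)
    rw [hK.deriv]
    convert! e1.sub e2 using 1
    simp
    ring
  · rw [hypAngle_pi_div_two, hcdef, hypAngle_cos_zero hθ0.le (by linarith), angularMass,
      Real.cos_pi_div_two, hypAngle_pi_div_two, Real.sin_pi_div_two, ← hcdef]
    have h := cubic_le_cos_pi_mul (y := θ / Real.pi) (by positivity)
      (by rw [div_le_iff₀ hpi]; linarith)
    rw [mul_div_cancel₀ _ hpi.ne', ← hcdef] at h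
    set y := θ / Real.pi with hy
    have hθy : θ = Real.pi * y := by rw [hy]; field_simp
    have hly : l = 2 * y := by rw [hl, hy]; ring
    rw [hly, hθy]
    simp only [mul_zero, mul_one, ne_eq, OfNat.ofNat_ne_zero, not_false_eq_true, zero_pow,
      sub_zero, Real.sqrt_one, div_one]
    have : 2 * (Real.pi / 2) * (Real.pi / 2 + Real.pi / 2 * c) - (1 + 2 * y) *
        ((Real.pi / 2) ^ 2 - (Real.pi / 2) ^ 2 + (Real.pi - Real.pi * y) ^ 2) =
        Real.pi ^ 2 / 2 * (c - (1 - 6 * y ^ 2 + 4 * y ^ 3)) := by ring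
    rw [this]
    exact mul_nonneg (by positivity) (by linarith)
  · intro s t hs hst ht h
    obtain ⟨K', k, hK, hk, he⟩ := hKd s hs.le (hst.trans ht.le)
    obtain ⟨L', j, hL, hj, hf⟩ := hKd t (hs.le.trans hst) ht.le
    simp only [hK.deriv, hL.deriv, he, hf] at h ⊢
    have hm : 0 < 2 * (1 - c ^ 2) := by linarith
    have hYs : 0 < slopeSign c (1 - l) s := by
      by_contra hneg
      push Not at hneg
      nlinarith [mul_nonneg hm.le (mul_nonneg hk.le (neg_nonneg.2 hneg))]
    have hYt : 0 ≤ slopeSign c (1 - l) t := by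
      rcases le_total 0.872 t with h2 | h2
      · exact slopeSign_nonneg hc0 hc1 hκc h2 ht.le
      · exact hYs.le.trans (monotoneOn_slopeSign hc0 hc1 (by linarith) ⟨hs.le, hst.trans h2⟩
          ⟨hs.le.trans hst, h2⟩ hst)
    nlinarith [mul_nonneg hm.le (mul_nonneg hj.le hYt)]

/-! ### Explicit values, and codes with at least four words -/

theorem isogonalCollision_two {θ : ℝ} (h0 : 0 ≤ θ) (h1 : θ ≤ Real.pi) :
    isogonalCollision 2 (Real.cos θ) = 1 - θ / Real.pi := by
  have hpi := Real.pi_pos.ne'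
  have h2 : hypAngle (Real.cos θ) (2 * Real.pi / 2) = θ := by
    rw [hypAngle, mul_div_cancel_left₀ _ two_ne_zero, Real.cos_pi, mul_neg_one, neg_neg,
      Real.arccos_cos h0 h1]
  rw [isogonalCollision, h2, hypAngle_cos_zero h0 h1]
  field_simp
  ring

theorem isogonalCollision_three {θ : ℝ} (h0 : 0 ≤ θ) (h1 : θ ≤ Real.pi) :
    isogonalCollision 3 (Real.cos θ) = 1 / 3 + 3 * ((Real.pi - θ) / (2 * Real.pi)) ^ 2
      - 3 * (Real.arccos (1 / 2 * Real.cos θ) / (2 * Real.pi)) ^ 2 := by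
  have hpi := Real.pi_pos.ne'
  have hcos : Real.cos (2 * Real.pi / 3) = -(1 / 2) := by
    rw [show 2 * Real.pi / 3 = Real.pi - Real.pi / 3 by ring, Real.cos_pi_sub, Real.cos_pi_div_three]
  rw [isogonalCollision, hypAngle_cos_zero h0 h1, hypAngle, hcos, mul_neg, neg_neg,
    mul_comm (Real.cos θ)]
  field_simp
  ring

theorem angularMass_pos {c t : ℝ} (hc : 0 ≤ c) (h0 : 0 < t) (h1 : t ≤ Real.pi) :
    0 < angularMass c t := by
  have h2 := Real.sin_nonneg_of_nonneg_of_le_pi h0.le h1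
  have h3 : 0 ≤ hypAngle c t := Real.arccos_nonneg _
  unfold angularMass
  positivity

/-- The expression is zero at t = 0 and strictly increasing. -/
theorem sector_defect_pos {c t : ℝ} (hc0 : 0 ≤ c) (hc : c ^ 2 < 1) (h0 : 0 < t)
    (h1 : t ≤ Real.pi) : 0 < t ^ 2 - hypAngle c t ^ 2 + hypAngle c 0 ^ 2 := by
  have hm : StrictMonoOn (fun t => t ^ 2 - hypAngle c t ^ 2) (Set.Icc 0 Real.pi) := by
    refine strictMonoOn_of_deriv_pos (convex_Icc _ _) (fun t _ =>
      (hasDerivAt_sq_sub_hypAngle_sq hc t).continuousAt.continuousWithinAt) fun t ht => ?_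
    rw [interior_Icc] at ht
    rw [(hasDerivAt_sq_sub_hypAngle_sq hc t).deriv]
    exact mul_pos two_pos (angularMass_pos hc0 ht.1 ht.2.le)
  have h := hm ⟨le_rfl, Real.pi_pos.le⟩ ⟨h0.le, h1⟩ h0
  simp only at h
  linarith

/-- With at least four words, an isogonal planar code is no better than the `2`-gon. -/
theorem log_isogonalCollision_le {θ n : ℝ} (hθ0 : 0 < θ) (hθ1 : θ < Real.pi / 2) (hn : 4 ≤ n) :
    Real.log (isogonalCollision n (Real.cos θ)) ≤
      Real.log (1 - θ / Real.pi) * (Real.log n / Real.log 2) := by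
  have hpi := Real.pi_pos
  set c := Real.cos θ with hcdef
  have hc0 : 0 < c := Real.cos_pos_of_mem_Ioo ⟨by linarith, hθ1⟩
  have hc1 : c < 1 := by
    rw [hcdef, ← Real.cos_zero]
    exact Real.cos_lt_cos_of_nonneg_of_le_pi le_rfl (by linarith) hθ0
  have hc : c ^ 2 < 1 := by nlinarith
  set l := 2 * θ / Real.pi with hl
  have hl0 : 0 < l := by positivity
  have hl1 : l < 1 := by rw [hl, div_lt_one hpi]; linarith
  set D : ℝ → ℝ := fun t => t ^ 2 - hypAngle c t ^ 2 + hypAngle c 0 ^ 2 with hD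
  set α := 2 * Real.pi / n with hα
  have hα0 : 0 < α := by positivity
  have hα1 : α ≤ Real.pi / 2 := by
    rw [hα, div_le_iff₀ (by linarith)]
    nlinarith
  have hDpos : ∀ t, 0 < t → t ≤ Real.pi / 2 → 0 < D t := fun t a b =>
    sector_defect_pos hc0.le hc a (by linarith)
  -- In logarithmic form, `sector_slope` says that D(t)/t^(1+l) increases; it is compared at α =
  -- 2π/n and at π/2.
  have hmono : MonotoneOn (fun t => Real.log (D t) - (1 + l) * Real.log t)
      (Set.Icc α (Real.pi / 2)) := by
    refine monotoneOn_Icc_of_hasDerivAt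
      (f' := fun t => 2 * angularMass c t / D t - (1 + l) * (1 / t)) (fun t a b => ?_)
      fun t a b => ?_
    · have ht := hα0.trans_le a
      have e1 := (((hasDerivAt_sq_sub_hypAngle_sq hc t).add_const (hypAngle c 0 ^ 2))).log
        (hDpos t ht b).ne'
      have e2 := (Real.hasDerivAt_log ht.ne').const_mul (1 + l)
      rw [← one_div] at e2
      exact e1.sub e2
    · have ht := hα0.trans a
      have := sector_slope hθ0 hθ1 ht.le b.le
      rw [mul_one_div, sub_nonneg, div_le_div_iff₀ ht (hDpos t ht b.le)]
      simp only [hD]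
      linarith
  have h1 := hmono ⟨le_rfl, hα1⟩ ⟨hα1, le_rfl⟩ hα1
  have hDpi : D (Real.pi / 2) = (Real.pi - θ) ^ 2 := by
    simp only [hD]
    rw [hypAngle_pi_div_two, hcdef, hypAngle_cos_zero hθ0.le (by linarith)]
    ring
  have hx : 0 < 1 - θ / Real.pi := by
    rw [sub_pos, div_lt_one hpi]; linarith
  have hb : Real.pi - θ = Real.pi * (1 - θ / Real.pi) := by field_simp
  have hR : isogonalCollision n c = D α / (2 * Real.pi * α) := by
    simp only [isogonalCollision, hD, hα]
    have : n ≠ 0 := by linarith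
    field_simp
    ring
  have hlogR : Real.log (isogonalCollision n c) =
      Real.log (D α) - (Real.log 2 + Real.log Real.pi + Real.log α) := by
    rw [hR, Real.log_div (hDpos α hα0 hα1).ne' (by positivity), Real.log_mul (by positivity)
      hα0.ne', Real.log_mul two_ne_zero hpi.ne']
  have hlogα : Real.log α = Real.log 2 + Real.log Real.pi - Real.log n := by
    rw [hα, Real.log_div (by positivity) (by linarith), Real.log_mul two_ne_zero hpi.ne']
  simp only [hDpi, hb] at h1
  rw [Real.log_pow, Real.log_mul hpi.ne' hx.ne', Real.log_div hpi.ne' two_ne_zero] at h1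
  push_cast at h1
  have hlog2 : 0 < Real.log 2 := Real.log_pos one_lt_two
  have hlogn : 2 * Real.log 2 ≤ Real.log n := by
    have : Real.log 4 = 2 * Real.log 2 := by
      rw [show (4 : ℝ) = 2 ^ 2 by norm_num, Real.log_pow]
      push_cast; ring
    rw [← this]
    exact Real.log_le_log (by norm_num) hn
  -- Concavity of the logarithm between 1 and 1/2, since (1 − l) + l/2 = 1 − θ/π.
  have hconc : -(l * Real.log 2) ≤ Real.log (1 - θ / Real.pi) := by
    have h := strictConcaveOn_log_Ioi.concaveOn.2 (Set.mem_Ioi.2 (one_pos (α := ℝ)))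
      (Set.mem_Ioi.2 (show (0 : ℝ) < 1 / 2 by norm_num)) (sub_nonneg.2 hl1.le) hl0.le
      (sub_add_cancel 1 l)
    simp only [smul_eq_mul, Real.log_one, mul_zero, zero_add, one_div, Real.log_inv] at h
    have e : (1 - l) * 1 + l * 2⁻¹ = 1 - θ / Real.pi := by
      rw [hl]; field_simp; ring
    rw [e] at h
    linarith
  have hfin : Real.log (1 - θ / Real.pi) * (Real.log n / Real.log 2) =
      2 * Real.log (1 - θ / Real.pi) +
      Real.log (1 - θ / Real.pi) * ((Real.log n - 2 * Real.log 2) / Real.log 2) := by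
    field_simp
    ring
  have hge : -l * (Real.log n - 2 * Real.log 2) ≤
      Real.log (1 - θ / Real.pi) * ((Real.log n - 2 * Real.log 2) / Real.log 2) := by
    have h := mul_le_mul_of_nonneg_right hconc
      (div_nonneg (sub_nonneg.2 hlogn) hlog2.le)
    have e : -(l * Real.log 2) * ((Real.log n - 2 * Real.log 2) / Real.log 2) =
        -l * (Real.log n - 2 * Real.log 2) := by
      field_simp
    linarith
  rw [hlogR, hfin]
  rw [hlogα] at h1 ⊢
  linarith

/-! ### The triangle against the antipodal pair -/

/-- This makes q increase in `lt_log_isogonalCollision_three`, because 0.58 < log 3/log 2 − 1.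
Jordan's inequality for θ and for B = arccos(c/2), together with B ≥ π/3, reduces it to a polynomial
inequality in c = cos θ. -/
theorem triangle_ratio_ineq {θ : ℝ} (hθ0 : 0 < θ) (hθ1 : θ < Real.pi / 2) :
    (Real.pi - θ) * (3 / √(4 - Real.cos θ ^ 2) ^ 2 *
      (1 - Real.arccos (Real.cos θ / 2) * Real.cos θ / √(4 - Real.cos θ ^ 2))) <
    0.58 * (Real.pi - θ + Real.arccos (Real.cos θ / 2) *
      (Real.sin θ / √(4 - Real.cos θ ^ 2))) := by
  have hpi := Real.pi_gt_d4
  have hc0 : 0 < Real.cos θ := Real.cos_pos_of_mem_Ioo ⟨by linarith, hθ1⟩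
  have hs0 : 0 < Real.sin θ := Real.sin_pos_of_pos_of_lt_pi hθ0 (by linarith)
  have hsc := Real.sin_sq_add_cos_sq θ
  have hb : Real.pi - θ ≤ Real.pi / 2 * (1 + Real.cos θ) := by
    have := Real.one_sub_mul_le_cos hθ0.le hθ1.le
    have e : Real.pi / 2 * (1 - 2 / Real.pi * θ) = Real.pi / 2 - θ := by field_simp
    nlinarith
  set c := Real.cos θ
  set s := Real.sin θ
  have hc1 : c < 1 := by nlinarith
  have hB1 : Real.pi / 3 ≤ Real.arccos (c / 2) := by
    rw [← Real.arccos_cos (x := Real.pi / 3) (by linarith) (by linarith), Real.cos_pi_div_three]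
    exact Real.arccos_le_arccos (by linarith)
  have hB2 : Real.pi / 2 * (1 - c / 2) ≤ Real.arccos (c / 2) := by
    have h1 : Real.arccos (c / 2) ≤ Real.pi / 2 := Real.arccos_le_pi_div_two.2 (by linarith)
    have := Real.one_sub_mul_le_cos (Real.arccos_nonneg (c / 2)) h1
    rw [Real.cos_arccos (by linarith) (by linarith)] at this
    have e : Real.pi / 2 * (1 - 2 / Real.pi * Real.arccos (c / 2)) =
      Real.pi / 2 - Real.arccos (c / 2) := by field_simp
    nlinarith
  set B := Real.arccos (c / 2)
  have hrr : √(4 - c ^ 2) ^ 2 = 4 - c ^ 2 := Real.sq_sqrt (by nlinarith)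
  have hr0 : 0 < √(4 - c ^ 2) := Real.sqrt_pos.2 (by nlinarith)
  set r := √(4 - c ^ 2)
  have hr2 : r ≤ 2 := by nlinarith
  have hbpos : 0 < Real.pi - θ := by linarith
  set b := Real.pi - θ
  -- The constant is just below π/6: B ≥ π/3 and r ≤ 2.
  have e1 : 0.5235 * c ≤ B * c / r := by
    rw [le_div_iff₀ hr0]
    have : 0.5235 * 2 ≤ B := by linarith
    nlinarith
  have e2 : (1 - c ^ 2) / 2 ≤ s / r := by
    rw [le_div_iff₀ hr0]
    have h1 : (1 - c ^ 2) / 2 * r ≤ 1 - c ^ 2 := by nlinarith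
    have h2 : 1 - c ^ 2 = s ^ 2 := by linarith
    have h3 : s ≤ 1 := by nlinarith
    nlinarith
  have e3 : b * ((1 - c / 2) * (1 - c) / 2) ≤ B * (s / r) := by
    have h1 : b * ((1 - c / 2) * (1 - c) / 2) ≤
        Real.pi / 2 * (1 + c) * ((1 - c / 2) * (1 - c) / 2) := by
      refine mul_le_mul_of_nonneg_right hb ?_
      have := mul_nonneg (show 0 ≤ 1 - c / 2 by linarith) (show 0 ≤ 1 - c by linarith)
      linarith
    have h2 : Real.pi / 2 * (1 + c) * ((1 - c / 2) * (1 - c) / 2) =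
        Real.pi / 2 * (1 - c / 2) * ((1 - c ^ 2) / 2) := by ring
    have h3 : Real.pi / 2 * (1 - c / 2) * ((1 - c ^ 2) / 2) ≤ B * (s / r) :=
      mul_le_mul hB2 e2 (by nlinarith) (by linarith)
    linarith
  have e4 : 3 / r ^ 2 * (1 - B * c / r) ≤ 3 / r ^ 2 * (1 - 0.5235 * c) :=
    mul_le_mul_of_nonneg_left (by linarith) (by positivity)
  have e5 : 3 / r ^ 2 * (1 - 0.5235 * c) < 0.58 * (1 + (1 - c / 2) * (1 - c) / 2) := by
    rw [div_mul_eq_mul_div, div_lt_iff₀ (by positivity), hrr]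
    nlinarith [mul_pos hc0 (sub_pos.2 hc1), mul_pos (mul_pos hc0 hc0) (sub_pos.2 hc1),
      mul_pos (mul_pos hc0 (sub_pos.2 hc1)) (sub_pos.2 hc1), pow_pos hc0 3, pow_pos hc0 4]
  have e6 := mul_lt_mul_of_pos_left (e4.trans_lt e5) hbpos
  nlinarith

theorem hasDerivAt_arccos_half_cos (t : ℝ) :
    HasDerivAt (fun t => Real.arccos (Real.cos t / 2)) (Real.sin t / √(4 - Real.cos t ^ 2)) t := by
  have hc := Real.cos_sq_le_one t
  have h1 := Real.hasDerivAt_arccos (x := Real.cos t / 2) (by nlinarith) (by nlinarith)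
  have h := h1.comp t ((Real.hasDerivAt_cos t).div_const 2)
  convert! h using 1
  have e : √(4 - Real.cos t ^ 2) = 2 * √(1 - (Real.cos t / 2) ^ 2) := by
    rw [show 4 - Real.cos t ^ 2 = 2 ^ 2 * (1 - (Real.cos t / 2) ^ 2) by ring,
      Real.sqrt_mul (by norm_num), Real.sqrt_sq (by norm_num)]
  rw [e]
  have : √(1 - (Real.cos t / 2) ^ 2) ≠ 0 := (Real.sqrt_pos.2 (by nlinarith)).ne'
  field_simp

theorem hasDerivAt_sin_div_sqrt (t : ℝ) :
    HasDerivAt (fun t => Real.sin t / √(4 - Real.cos t ^ 2))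
      (3 * Real.cos t / √(4 - Real.cos t ^ 2) ^ 3) t := by
  have hc := Real.cos_sq_le_one t
  have hp : 0 < 4 - Real.cos t ^ 2 := by linarith
  have h1 := (((Real.hasDerivAt_cos t).pow 2).const_sub 4).sqrt hp.ne'
  have h := (Real.hasDerivAt_sin t).div h1 (Real.sqrt_pos.2 hp).ne'
  convert! h using 1
  have hr : 0 < √(4 - Real.cos t ^ 2) := Real.sqrt_pos.2 hp
  have hrr : √(4 - Real.cos t ^ 2) ^ 2 = 4 - Real.cos t ^ 2 := Real.sq_sqrt hp.le
  have hsc := Real.sin_sq_add_cos_sq t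
  simp only [Nat.cast_ofNat, Nat.add_one_sub_one, pow_one, Pi.pow_apply]
  set r := √(4 - Real.cos t ^ 2)
  field_simp
  rw [hrr]
  linear_combination Real.cos t * hsc

/-- This is 2⁷⁹ < 3⁵⁰, as 1.58 = 79/50. -/
theorem log_three_div_log_two_gt : 1.58 < Real.log 3 / Real.log 2 := by
  rw [lt_div_iff₀ (Real.log_pos one_lt_two)]
  have h : Real.log (2 ^ 79 : ℝ) < Real.log (3 ^ 50 : ℝ) :=
    Real.log_lt_log (by norm_num) (by norm_num)
  rw [Real.log_pow, Real.log_pow] at h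
  push_cast at h
  linarith

/-- The triangle collides more often than the corresponding power of the antipodal pair. -/
theorem lt_log_isogonalCollision_three {θ : ℝ} (hθ0 : 0 < θ) (hθ1 : θ < Real.pi / 2) :
    Real.log (1 - θ / Real.pi) * (Real.log 3 / Real.log 2) <
      Real.log (isogonalCollision 3 (Real.cos θ)) := by
  have hpi := Real.pi_pos
  have hlog2 := Real.log_pos one_lt_two
  have hL := log_three_div_log_two_gt
  set L := Real.log 3 / Real.log 2 with hLdef
  set B : ℝ → ℝ := fun t => Real.arccos (Real.cos t / 2) with hB
  set w : ℝ → ℝ := fun t => Real.sin t / √(4 - Real.cos t ^ 2) with hw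
  set M : ℝ → ℝ := fun t => Real.pi - t + B t * w t with hM
  set f : ℝ → ℝ := fun t => 1 / 3 + 3 * ((Real.pi - t) / (2 * Real.pi)) ^ 2 -
    3 * (B t / (2 * Real.pi)) ^ 2 with hf
  set ℓ : ℝ → ℝ := fun t => Real.log (1 - t / Real.pi) with hℓ
  -- Here g(t) = (1 − t/π)^L, and q is, up to a positive constant, the ratio f'/g'.
  set g : ℝ → ℝ := fun t => Real.exp (L * ℓ t) with hg
  set q : ℝ → ℝ := fun t => M t * Real.exp ((1 - L) * ℓ t) with hq
  have hx : ∀ t < Real.pi, 0 < 1 - t / Real.pi := fun t ht => by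
    rw [sub_pos, div_lt_one hpi]; exact ht
  have hdℓ : ∀ t < Real.pi, HasDerivAt ℓ (-(1 / (Real.pi - t))) t := fun t ht => by
    have h := (((hasDerivAt_id t).div_const Real.pi).const_sub 1).log (hx t ht).ne'
    convert! h using 1
    have : Real.pi - t ≠ 0 := by linarith
    have := (hx t ht).ne'
    simp only [id]
    field_simp
  have hdB : ∀ t, HasDerivAt B (w t) t := hasDerivAt_arccos_half_cos
  have hdw : ∀ t, HasDerivAt w (3 * Real.cos t / √(4 - Real.cos t ^ 2) ^ 3) t :=
    hasDerivAt_sin_div_sqrt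
  have hdM : ∀ t, HasDerivAt M (-(3 / √(4 - Real.cos t ^ 2) ^ 2 *
      (1 - B t * Real.cos t / √(4 - Real.cos t ^ 2)))) t := fun t => by
    have h := ((hasDerivAt_id t).const_sub Real.pi).add ((hdB t).mul (hdw t))
    convert! h using 1
    have hp : 0 < 4 - Real.cos t ^ 2 := by have := Real.cos_sq_le_one t; linarith
    have hr : 0 < √(4 - Real.cos t ^ 2) := Real.sqrt_pos.2 hp
    have hrr : √(4 - Real.cos t ^ 2) ^ 2 = 4 - Real.cos t ^ 2 := Real.sq_sqrt hp.le
    have hsc := Real.sin_sq_add_cos_sq t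
    have hw2 : w t * w t = 1 - 3 / √(4 - Real.cos t ^ 2) ^ 2 := by
      simp only [hw]
      set r := √(4 - Real.cos t ^ 2)
      field_simp
      linarith
    rw [hw2]
    field_simp
    ring
  have hdf : ∀ t, HasDerivAt f (-(3 / (2 * Real.pi ^ 2)) * M t) t := fun t => by
    have h := (((((((hasDerivAt_id t).const_sub Real.pi).div_const (2 * Real.pi)).pow 2).const_mul
      3).const_add (1 / 3)).sub ((((hdB t).div_const (2 * Real.pi)).pow 2).const_mul 3))
    convert! h using 1
    simp only [hM, id, Nat.cast_ofNat, Nat.add_one_sub_one, pow_one]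
    field_simp
    ring
  have hdg : ∀ t < Real.pi, HasDerivAt g (g t * (L * -(1 / (Real.pi - t)))) t := fun t ht =>
    ((hdℓ t ht).const_mul L).exp
  have hqg : ∀ t < Real.pi, -(3 / (2 * Real.pi ^ 2)) * M t =
      3 / (2 * Real.pi * L) * q t * (g t * (L * -(1 / (Real.pi - t)))) := fun t ht => by
    have e : Real.exp ((1 - L) * ℓ t) * g t = 1 - t / Real.pi := by
      rw [hg, ← Real.exp_add, show (1 - L) * ℓ t + L * ℓ t = ℓ t by ring, hℓ,
        Real.exp_log (hx t ht)]
    have e2 : 3 / (2 * Real.pi * L) * q t * (g t * (L * -(1 / (Real.pi - t)))) =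
        -(3 / (2 * Real.pi * L) * M t * L * (1 / (Real.pi - t))) *
        (Real.exp ((1 - L) * ℓ t) * g t) := by simp only [hq]; ring
    rw [e2, e]
    have : Real.pi - t ≠ 0 := by linarith
    have : L ≠ 0 := by linarith
    field_simp
  have hdq : ∀ t < Real.pi, HasDerivAt q (-(3 / √(4 - Real.cos t ^ 2) ^ 2 *
      (1 - B t * Real.cos t / √(4 - Real.cos t ^ 2))) * Real.exp ((1 - L) * ℓ t) +
      M t * (Real.exp ((1 - L) * ℓ t) * ((1 - L) * -(1 / (Real.pi - t))))) t := fun t ht =>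
    (hdM t).mul ((hdℓ t ht).const_mul (1 - L)).exp
  have hmono : StrictMonoOn q (Set.Icc 0 (Real.pi / 2)) := by
    refine strictMonoOn_of_deriv_pos (convex_Icc _ _) (fun t ht =>
      (hdq t (by linarith [ht.2])).continuousAt.continuousWithinAt) fun t ht => ?_
    rw [interior_Icc] at ht
    have htpi : t < Real.pi := by linarith [ht.2]
    rw [(hdq t htpi).deriv]
    have hb : 0 < Real.pi - t := by linarith
    have hr := triangle_ratio_ineq ht.1 ht.2
    have hMpos : 0 < M t := by
      have : 0 ≤ B t * w t := mul_nonneg (Real.arccos_nonneg _) (div_nonneg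
        (Real.sin_nonneg_of_nonneg_of_le_pi ht.1.le htpi.le) (Real.sqrt_nonneg _))
      simp only [hM]; linarith
    have h2 : 0.58 * M t < (L - 1) * M t := mul_lt_mul_of_pos_right (by linarith) hMpos
    have h3 : 3 / √(4 - Real.cos t ^ 2) ^ 2 *
        (1 - B t * Real.cos t / √(4 - Real.cos t ^ 2)) < (L - 1) * M t / (Real.pi - t) := by
      rw [lt_div_iff₀ hb, mul_comm]
      exact hr.trans h2
    have := mul_pos (Real.exp_pos ((1 - L) * ℓ t)) (sub_pos.2 h3)
    calc 0 < _ := this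
      _ = _ := by ring
  -- Cauchy's mean value theorem for f and g, with g' cancelled.
  have hmvt : ∀ a b, 0 ≤ a → a < b → b ≤ Real.pi / 2 → ∃ ξ ∈ Set.Ioo a b,
      (g b - g a) * (3 / (2 * Real.pi * L) * q ξ) = f b - f a := by
    intro a b ha hab hb
    obtain ⟨ξ, hξ, h⟩ := exists_ratio_hasDerivAt_eq_ratio_slope f _ hab
      (fun t _ => (hdf t).continuousAt.continuousWithinAt) (fun t _ => hdf t) g _
      (fun t ht => (hdg t (by linarith [ht.2])).continuousAt.continuousWithinAt)
      (fun t ht => hdg t (by linarith [ht.2]))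
    refine ⟨ξ, hξ, ?_⟩
    have hξ2 : ξ < Real.pi := by linarith [hξ.2]
    rw [hqg ξ hξ2, ← mul_assoc] at h
    refine mul_right_cancel₀ ?_ h
    have : 0 < Real.pi - ξ := by linarith
    exact (mul_neg_of_pos_of_neg (Real.exp_pos _)
      (mul_neg_of_pos_of_neg (by linarith) (neg_lt_zero.2 (by positivity)))).ne
  have hganti : ∀ a b, a < b → b < Real.pi → g b < g a := by
    intro a b hab hb
    refine Real.exp_lt_exp.2 (mul_lt_mul_of_pos_left (Real.log_lt_log (hx b hb) ?_) (by linarith))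
    have := div_lt_div_of_pos_right hab hpi
    linarith
  have hf0 : f 0 = 1 := by
    simp only [hf, hB, Real.cos_zero]
    rw [← Real.cos_pi_div_three, Real.arccos_cos (by linarith) (by linarith)]
    field_simp
    ring
  have hg0 : g 0 = 1 := by simp [hg, hℓ]
  have hf1 : f (Real.pi / 2) = 1 / 3 := by
    simp only [hf, hB, Real.cos_pi_div_two, zero_div, Real.arccos_zero]
    field_simp
    ring
  have hg1 : g (Real.pi / 2) = 1 / 3 := by
    have e : 1 - Real.pi / 2 / Real.pi = 2⁻¹ := by field_simp; ring
    simp only [hg, hℓ]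
    rw [e, Real.log_inv, hLdef, mul_neg, div_mul_cancel₀ _ hlog2.ne', Real.exp_neg,
      Real.exp_log three_pos, one_div]
  obtain ⟨ξ, hξ, e1⟩ := hmvt 0 θ le_rfl hθ0 hθ1.le
  obtain ⟨η, hη, e2⟩ := hmvt θ (Real.pi / 2) hθ0.le hθ1 le_rfl
  rw [hf0, hg0] at e1
  rw [hf1, hg1] at e2
  have hlt : g θ < 1 := hg0 ▸ hganti 0 θ hθ0 (by linarith)
  have hgt : 1 / 3 < g θ := hg1 ▸ hganti θ (Real.pi / 2) hθ1 (by linarith)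
  have hqlt : 3 / (2 * Real.pi * L) * q ξ < 3 / (2 * Real.pi * L) * q η := by
    refine mul_lt_mul_of_pos_left (hmono ⟨hξ.1.le, ?_⟩ ⟨?_, hη.2.le⟩ (hξ.2.trans hη.1)) ?_
    · linarith [hξ.2]
    · linarith [hη.1]
    · have : 0 < L := by linarith
      positivity
  -- Both functions run from 1 to 1/3. If f θ ≤ g θ, the mean ratio of decrease would be at least 1
  -- on [0, θ] and at most 1 on [θ, π/2], against the growth of q.
  have hfg : g θ < f θ := by
    by_contra! hle
    have k1 : 1 ≤ 3 / (2 * Real.pi * L) * q ξ := by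
      by_contra! h
      nlinarith
    have k2 : 3 / (2 * Real.pi * L) * q η ≤ 1 := by
      by_contra! h
      nlinarith
    linarith
  have hfin : f θ = isogonalCollision 3 (Real.cos θ) := by
    rw [isogonalCollision_three hθ0.le (by linarith)]
    simp only [hf, hB]
    rw [show Real.cos θ / 2 = 1 / 2 * Real.cos θ by ring]
  rw [← hfin, Real.lt_log_iff_exp_lt (lt_trans (Real.exp_pos _) hfg), mul_comm]
  exact hfg

/-! ### Random points on a sphere of large dimension -/

/-- The strict inequalities cut out an open subset of the cell, so a boundary point ties with
another word and lies on one of finitely many hyperplanes. -/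
theorem frontier_voronoiCell_null {k : ℕ} {C : Set (EuclideanSpace ℝ (Fin k))}
    (hC : IsSphericalCode C) {u : EuclideanSpace ℝ (Fin k)} (hu : u ∈ C) :
    stdGaussian (EuclideanSpace ℝ (Fin k)) (frontier (voronoiCell C u)) = 0 := by
  set D := C \ {u} with hD
  have hDf : D.Finite := hC.1.subset Set.sdiff_subset
  have hopen : IsOpen (⋂ v ∈ D, {z : EuclideanSpace ℝ (Fin k) | ⟪z, v⟫ < ⟪z, u⟫}) :=
    hDf.isOpen_biInter fun v _ => isOpen_lt (by fun_prop) (by fun_prop)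
  have hsub : (⋂ v ∈ D, {z : EuclideanSpace ℝ (Fin k) | ⟪z, v⟫ < ⟪z, u⟫}) ⊆ voronoiCell C u := by
    intro z hz
    rw [mem_voronoiCell_iff_inner hC.2 hu]
    intro v hv
    by_cases huv : v = u
    · rw [huv]
    · exact (Set.mem_iInter₂.1 hz v ⟨hv, huv⟩).le
  refine measure_mono_null (t := ⋃ v ∈ D, {z | ⟪z, u - v⟫ = 0}) ?_ ?_
  · intro z hz
    rw [(isClosed_voronoiCell C u).frontier_eq] at hz
    by_contra h
    refine hz.2 (interior_maximal hsub hopen (Set.mem_iInter₂.2 fun v hv => ?_))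
    refine lt_of_le_of_ne ((mem_voronoiCell_iff_inner hC.2 hu).1 hz.1 v hv.1) fun e => ?_
    refine h (Set.mem_iUnion₂.2 ⟨v, hv, ?_⟩)
    change ⟪z, u - v⟫ = 0
    rw [inner_sub_right, e, sub_self]
  · rw [measure_biUnion_null_iff hDf.countable]
    exact fun v hv => stdGaussian_hyperplane (sub_ne_zero.2 (Ne.symm hv.2))

theorem measurableSet_correlate_mem {k : ℕ} {S : Set (EuclideanSpace ℝ (Fin k))}
    (hS : MeasurableSet S) (c : ℝ) :
    MeasurableSet {z : EuclideanSpace ℝ (Fin k) × EuclideanSpace ℝ (Fin k) |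
      (correlate c z).1 ∈ S ∧ (correlate c z).2 ∈ S} :=
  (measurable_correlate c) (hS.prod hS)

/-- The noise stability of a set with negligible boundary is continuous at correlation zero. -/
theorem tendsto_noiseStability {k : ℕ} {S : Set (EuclideanSpace ℝ (Fin k))}
    (hS : MeasurableSet S) (hf : stdGaussian (EuclideanSpace ℝ (Fin k)) (frontier S) = 0) :
    Tendsto (noiseStability S) (𝓝 0) (𝓝 (noiseStability S 0)) := by
  refine (ENNReal.tendsto_toReal (measure_ne_top _ _)).comp ?_
  refine tendsto_measure_of_ae_tendsto_indicator_of_isFiniteMeasure (𝓝 (0 : ℝ))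
    (measurableSet_correlate_mem hS 0) (measurableSet_correlate_mem hS) ?_
  -- The first vector does not depend on c, so only the second has to avoid the boundary.
  have h : ∀ᵐ z ∂((stdGaussian (EuclideanSpace ℝ (Fin k))).prod
      (stdGaussian (EuclideanSpace ℝ (Fin k)))), z.2 ∉ frontier S :=
    Measure.quasiMeasurePreserving_snd.ae (compl_mem_ae_iff.2 hf)
  filter_upwards [h] with z hz
  have hcont : Tendsto (fun c : ℝ => (correlate c z).2) (𝓝 0) (𝓝 z.2) := by
    have : Continuous fun c : ℝ => (correlate c z).2 := by unfold correlate; fun_prop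
    convert! this.tendsto 0 using 2
    simp [correlate]
  have h0 : (correlate 0 z).2 = z.2 := by simp [correlate]
  by_cases hin : z.2 ∈ interior S
  · filter_upwards [hcont.eventually (isOpen_interior.mem_nhds hin)] with c hc
    have e1 : z.2 ∈ S := interior_subset hin
    have e2 : (correlate c z).2 ∈ S := interior_subset (s := S) hc
    change z.1 ∈ S ∧ (correlate c z).2 ∈ S ↔ z.1 ∈ S ∧ (correlate 0 z).2 ∈ S
    rw [h0]
    exact and_congr_right fun _ => iff_of_true e2 e1
  · have hout : z.2 ∈ (closure S)ᶜ := fun hcl => hz ⟨hcl, hin⟩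
    filter_upwards [hcont.eventually (isClosed_closure.isOpen_compl.mem_nhds hout)] with c hc
    have e1 : z.2 ∉ S := fun h => hout (subset_closure h)
    have e2 : (correlate c z).2 ∉ S := fun h => hc (subset_closure h)
    change _ ∧ (correlate c z).2 ∈ S ↔ _ ∧ (correlate 0 z).2 ∈ S
    simp only [h0, e1, e2, and_false]

theorem measurable_noiseStability {k : ℕ} {S : Set (EuclideanSpace ℝ (Fin k))}
    (hS : MeasurableSet S) : Measurable (noiseStability S) := by
  have hm : Measurable fun p : ℝ × EuclideanSpace ℝ (Fin k) × EuclideanSpace ℝ (Fin k) =>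
      correlate p.1 p.2 := by
    refine Continuous.measurable ?_
    unfold correlate
    fun_prop
  exact (measurable_measure_prodMk_left (hm (hS.prod hS))).ennreal_toReal

theorem noiseStability_mem_Icc {k : ℕ} (S : Set (EuclideanSpace ℝ (Fin k))) (c : ℝ) :
    noiseStability S c ∈ Set.Icc 0 1 :=
  ⟨measureReal_nonneg, measureReal_le_one⟩

instance {d : ℕ} [NeZero d] : IsProbabilityMeasure (uniformSphere d) := by
  have : Nonempty (Fin d) := ⟨0⟩
  refine cond_isProbabilityMeasure ?_
  rw [Measure.measure_univ_ne_zero]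
  exact Measure.toSphere_ne_zero _

/-- A linear isometry acting on the unit sphere. -/
def sphereMap {E : Type*} [NormedAddCommGroup E] [NormedSpace ℝ E] (e : E ≃ₗᵢ[ℝ] E)
    (x : Metric.sphere (0 : E) 1) : Metric.sphere (0 : E) 1 :=
  ⟨e x, by simp⟩

theorem continuous_sphereMap {E : Type*} [NormedAddCommGroup E] [NormedSpace ℝ E]
    (e : E ≃ₗᵢ[ℝ] E) : Continuous (sphereMap e) :=
  (e.continuous.comp continuous_subtype_val).subtype_mk _

-- The spherical measure of s is proportional to the volume of the cone over s, and e carries cones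
-- to cones and preserves volume.
open scoped Pointwise in
theorem map_sphereMap_toSphere {d : ℕ}
    (e : EuclideanSpace ℝ (Fin d) ≃ₗᵢ[ℝ] EuclideanSpace ℝ (Fin d)) :
    (volume : Measure (EuclideanSpace ℝ (Fin d))).toSphere.map (sphereMap e) =
      (volume : Measure (EuclideanSpace ℝ (Fin d))).toSphere := by
  have hm := (continuous_sphereMap e).measurable
  ext s hs
  rw [Measure.map_apply hm hs, Measure.toSphere_apply' _ (hm hs), Measure.toSphere_apply' _ hs]
  congr 1
  have h : Set.Ioo (0 : ℝ) 1 • ((↑) '' (sphereMap e ⁻¹' s) : Set (EuclideanSpace ℝ (Fin d))) =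
      e ⁻¹' (Set.Ioo (0 : ℝ) 1 • ((↑) '' s)) := by
    ext z
    simp only [Set.mem_smul, Set.mem_image, Set.mem_preimage]
    constructor
    · rintro ⟨r, hr, _, ⟨x, hx, rfl⟩, rfl⟩
      exact ⟨r, hr, e x, ⟨sphereMap e x, hx, rfl⟩, (e.map_smul r _).symm⟩
    · rintro ⟨r, hr, _, ⟨x, hx, rfl⟩, hz⟩
      refine ⟨r, hr, e.symm x, ⟨sphereMap e.symm x, ?_, rfl⟩, ?_⟩
      · have : sphereMap e (sphereMap e.symm x) = x := Subtype.ext (e.apply_symm_apply _)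
        rwa [this]
      · apply e.injective
        rw [e.map_smul, e.apply_symm_apply, hz]
  rw [h]
  exact e.measurePreserving.measure_preimage_emb e.toMeasurableEquiv.measurableEmbedding _

theorem map_sphereMap_uniformSphere {d : ℕ}
    (e : EuclideanSpace ℝ (Fin d) ≃ₗᵢ[ℝ] EuclideanSpace ℝ (Fin d)) :
    (uniformSphere d).map (sphereMap e) = uniformSphere d := by
  rw [uniformSphere, ProbabilityTheory.cond, Measure.map_smul, Measure.restrict_univ,
    map_sphereMap_toSphere]

/-- The reflection exchanging y and z preserves the uniform measure. -/
theorem integral_inner_sq_eq {d : ℕ} {y z : EuclideanSpace ℝ (Fin d)} (h : ‖y‖ = ‖z‖) :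
    ∫ x, ⟪(x : EuclideanSpace ℝ (Fin d)), y⟫ ^ 2 ∂(uniformSphere d) =
      ∫ x, ⟪(x : EuclideanSpace ℝ (Fin d)), z⟫ ^ 2 ∂(uniformSphere d) := by
  set e := Submodule.reflection (ℝ ∙ (y - z))ᗮ with he
  have hez : e y = z := Submodule.reflection_sub h
  have hm := (continuous_sphereMap e).measurable
  conv_rhs => rw [← map_sphereMap_uniformSphere e]
  rw [integral_map hm.aemeasurable (Continuous.aestronglyMeasurable (by fun_prop))]
  refine integral_congr_ae (Eventually.of_forall fun x => ?_)
  change _ = ⟪e x, z⟫ ^ 2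
  rw [← hez, e.inner_map_map]

/-- The d squared coordinates of a unit vector add up to 1 and have equal means. -/
theorem integral_inner_sq_uniformSphere {d : ℕ} [NeZero d] {y : EuclideanSpace ℝ (Fin d)}
    (hy : ‖y‖ = 1) :
    ∫ x, ⟪(x : EuclideanSpace ℝ (Fin d)), y⟫ ^ 2 ∂(uniformSphere d) = 1 / d := by
  have hint : ∀ z : EuclideanSpace ℝ (Fin d),
      Integrable (fun x : Metric.sphere (0 : EuclideanSpace ℝ (Fin d)) 1 =>
        ⟪(x : EuclideanSpace ℝ (Fin d)), z⟫ ^ 2) (uniformSphere d) := fun z =>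
    Continuous.integrable_of_hasCompactSupport (by fun_prop) (HasCompactSupport.of_compactSpace _)
  have h1 : ∑ i : Fin d, ∫ x, ⟪(x : EuclideanSpace ℝ (Fin d)),
      EuclideanSpace.single i (1 : ℝ)⟫ ^ 2 ∂(uniformSphere d) = 1 := by
    rw [← integral_finsetSum _ fun i _ => hint _]
    have : ∀ x : Metric.sphere (0 : EuclideanSpace ℝ (Fin d)) 1,
        ∑ i : Fin d, ⟪(x : EuclideanSpace ℝ (Fin d)), EuclideanSpace.single i (1 : ℝ)⟫ ^ 2 = 1 := by
      intro x
      have hx : ‖(x : EuclideanSpace ℝ (Fin d))‖ ^ 2 = 1 := by simp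
      rw [EuclideanSpace.real_norm_sq_eq] at hx
      simpa [EuclideanSpace.inner_single_right] using hx
    simp_rw [this]
    simp
  have h2 : ∀ i : Fin d, ∫ x, ⟪(x : EuclideanSpace ℝ (Fin d)),
      EuclideanSpace.single i (1 : ℝ)⟫ ^ 2 ∂(uniformSphere d) =
      ∫ x, ⟪(x : EuclideanSpace ℝ (Fin d)), y⟫ ^ 2 ∂(uniformSphere d) := fun i =>
    integral_inner_sq_eq (by simp [hy])
  simp_rw [h2] at h1
  rw [Finset.sum_const, Finset.card_univ, Fintype.card_fin, nsmul_eq_mul] at h1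
  have : (d : ℝ) ≠ 0 := Nat.cast_ne_zero.2 (NeZero.ne d)
  field_simp
  linarith

theorem integral_inner_sq_prod_uniformSphere {d : ℕ} [NeZero d] :
    ∫ p, ⟪(p.1 : EuclideanSpace ℝ (Fin d)), (p.2 : EuclideanSpace ℝ (Fin d))⟫ ^ 2
      ∂((uniformSphere d).prod (uniformSphere d)) = 1 / d := by
  rw [integral_prod_symm _ (Continuous.integrable_of_hasCompactSupport (by fun_prop)
    (HasCompactSupport.of_compactSpace _))]
  simp_rw [fun y : Metric.sphere (0 : EuclideanSpace ℝ (Fin d)) 1 =>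
    integral_inner_sq_uniformSphere (y := (y : EuclideanSpace ℝ (Fin d))) (by simp)]
  simp

theorem measurable_matProj_comp {Ω : Type*} [MeasurableSpace Ω] {k d : ℕ}
    {f : Ω → EuclideanSpace ℝ (Fin d)} (hf : Measurable f) :
    Measurable fun ω : (Fin k → Fin d → ℝ) × Ω => matProj ω.1 (f ω.2) :=
  continuous_matProj.measurable.comp (measurable_fst.prodMk (hf.comp measurable_snd))

/-- An independent random unit vector is projected to a standard Gaussian vector. -/
theorem map_matProj_comp {Ω : Type*} [MeasurableSpace Ω] {k d : ℕ} {σ : Measure Ω}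
    [IsProbabilityMeasure σ] {f : Ω → EuclideanSpace ℝ (Fin d)} (hf : Measurable f)
    (hf1 : ∀ p, ‖f p‖ = 1) :
    ((gaussianMatrix k d).prod σ).map (fun ω => matProj ω.1 (f ω.2)) =
      stdGaussian (EuclideanSpace ℝ (Fin k)) := by
  ext s hs
  rw [Measure.map_apply (measurable_matProj_comp hf) hs,
    Measure.prod_apply_symm (measurable_matProj_comp hf hs)]
  have : ∀ p, gaussianMatrix k d ((fun A => (A, p)) ⁻¹'
      ((fun ω : (Fin k → Fin d → ℝ) × Ω => matProj ω.1 (f ω.2)) ⁻¹' s)) =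
      stdGaussian (EuclideanSpace ℝ (Fin k)) s := fun p => by
    rw [← map_matProj (f p) (hf1 p), Measure.map_apply (measurable_matProj_left _) hs]
    rfl
  simp_rw [this]
  simp

/-- The collision probability of two random unit vectors is the mean of the noise stabilities at
the correlation of the two vectors. -/
theorem collision_eq_sum_integral {Ω : Type*} [MeasurableSpace Ω] {k d : ℕ} {σ : Measure Ω}
    [IsProbabilityMeasure σ] {f g : Ω → EuclideanSpace ℝ (Fin d)} (hf : Measurable f)
    (hg : Measurable g) (hf1 : ∀ p, ‖f p‖ = 1) (hg1 : ∀ p, ‖g p‖ = 1)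
    {C : Set (EuclideanSpace ℝ (Fin k))}
    {dec : EuclideanSpace ℝ (Fin k) → EuclideanSpace ℝ (Fin k)} (hC : IsSphericalCode C)
    (hd : IsDecoder C dec) :
    ((gaussianMatrix k d).prod σ).real
        {ω | dec (matProj ω.1 (f ω.2)) = dec (matProj ω.1 (g ω.2))} =
      ∑ u ∈ hC.1.toFinset, ∫ p, noiseStability (voronoiCell C u) ⟪f p, g p⟫ ∂σ := by
  rw [collision_eq_sum hC hd (measurable_matProj_comp hf) (measurable_matProj_comp hg)
    (map_matProj_comp hf hf1) (map_matProj_comp hg hg1)]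
  refine Finset.sum_congr rfl fun u _ => ?_
  have hV := measurableSet_voronoiCell C u
  have hms : MeasurableSet {ω : (Fin k → Fin d → ℝ) × Ω | matProj ω.1 (f ω.2) ∈ voronoiCell C u ∧
      matProj ω.1 (g ω.2) ∈ voronoiCell C u} :=
    (measurable_matProj_comp hf hV).inter (measurable_matProj_comp hg hV)
  rw [measureReal_def, Measure.prod_apply_symm hms, ← integral_toReal
    (measurable_measure_prodMk_right hms).aemeasurable
    (Eventually.of_forall fun _ => measure_lt_top _ _)]
  exact integral_congr_ae (Eventually.of_forall fun p =>
    measureReal_matProj_mem _ _ (hf1 p) (hg1 p) hV)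

theorem randomCollision_eq_integral {k d : ℕ} [NeZero d] {C : Set (EuclideanSpace ℝ (Fin k))}
    {dec : EuclideanSpace ℝ (Fin k) → EuclideanSpace ℝ (Fin k)} (hC : IsSphericalCode C)
    (hd : IsDecoder C dec) :
    randomCollision dec d = ∑ u ∈ hC.1.toFinset, ∫ p, noiseStability (voronoiCell C u)
      ⟪(p.1 : EuclideanSpace ℝ (Fin d)), (p.2 : EuclideanSpace ℝ (Fin d))⟫
      ∂((uniformSphere d).prod (uniformSphere d)) :=
  collision_eq_sum_integral (measurable_subtype_coe.comp measurable_fst)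
    (measurable_subtype_coe.comp measurable_snd) (fun p => by simp) (fun p => by simp) hC hd

/-- A bounded function of the inner product of two random points of the sphere has asymptotically
the mean of its value at zero. -/
theorem tendsto_integral_inner_uniformSphere {g : ℝ → ℝ} (hg : Measurable g)
    (hb : ∀ c, g c ∈ Set.Icc 0 1) (h0 : Tendsto g (𝓝 0) (𝓝 (g 0))) :
    Tendsto (fun d : ℕ => ∫ p, g ⟪(p.1 : EuclideanSpace ℝ (Fin d)),
      (p.2 : EuclideanSpace ℝ (Fin d))⟫ ∂((uniformSphere d).prod (uniformSphere d)))
      atTop (𝓝 (g 0)) := by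
  rw [Metric.tendsto_atTop]
  intro ε hε
  obtain ⟨δ, hδ, hgδ⟩ := Metric.tendsto_nhds_nhds.1 h0 (ε / 2) (half_pos hε)
  -- A Chebyshev bound in pointwise form: continuity handles |c| < δ, and for |c| ≥ δ the quadratic
  -- term exceeds 1.
  have hbound : ∀ c, |g c - g 0| ≤ ε / 2 + 1 / δ ^ 2 * c ^ 2 := by
    intro c
    have hc0 : 0 ≤ 1 / δ ^ 2 * c ^ 2 := by positivity
    rcases lt_or_ge |c| δ with hc | hc
    · have := hgδ (x := c) (by rwa [Real.dist_eq, sub_zero])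
      rw [Real.dist_eq] at this
      linarith
    · have h1 : |g c - g 0| ≤ 1 := by
        rw [abs_le]
        constructor <;> linarith [(hb c).1, (hb c).2, (hb 0).1, (hb 0).2]
      have h2 : 1 ≤ 1 / δ ^ 2 * c ^ 2 := by
        rw [one_div_mul_eq_div, one_le_div (by positivity), ← sq_abs c]
        exact pow_le_pow_left₀ hδ.le hc 2
      linarith
  obtain ⟨N, hN⟩ := exists_nat_gt (2 / (ε * δ ^ 2))
  -- The successor gives d > N > 2/(εδ²), and also d ≠ 0, which the uniform measure needs to have
  -- mass one.
  refine ⟨N + 1, fun d hd => ?_⟩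
  have : NeZero d := ⟨by omega⟩
  set σ := (uniformSphere d).prod (uniformSphere d)
  have hsq : Integrable (fun p : Metric.sphere (0 : EuclideanSpace ℝ (Fin d)) 1 ×
      Metric.sphere (0 : EuclideanSpace ℝ (Fin d)) 1 =>
      ⟪(p.1 : EuclideanSpace ℝ (Fin d)), (p.2 : EuclideanSpace ℝ (Fin d))⟫ ^ 2) σ :=
    Continuous.integrable_of_hasCompactSupport (by fun_prop) (HasCompactSupport.of_compactSpace _)
  have hgi : Integrable (fun p : Metric.sphere (0 : EuclideanSpace ℝ (Fin d)) 1 ×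
      Metric.sphere (0 : EuclideanSpace ℝ (Fin d)) 1 =>
      g ⟪(p.1 : EuclideanSpace ℝ (Fin d)), (p.2 : EuclideanSpace ℝ (Fin d))⟫) σ := by
    refine Integrable.of_bound (C := 1) ?_ (Eventually.of_forall fun p => ?_)
    · refine (hg.comp (Continuous.measurable ?_)).aestronglyMeasurable
      fun_prop
    · rw [Real.norm_of_nonneg (hb _).1]
      exact (hb _).2
  have e : ∫ p, g ⟪(p.1 : EuclideanSpace ℝ (Fin d)), (p.2 : EuclideanSpace ℝ (Fin d))⟫ ∂σ - g 0 =
      ∫ p, (g ⟪(p.1 : EuclideanSpace ℝ (Fin d)), (p.2 : EuclideanSpace ℝ (Fin d))⟫ - g 0) ∂σ := by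
    rw [integral_sub hgi (integrable_const _)]
    simp
  rw [Real.dist_eq, e]
  have hd0 : (N : ℝ) < d := by exact_mod_cast hd
  have hdpos : 0 < (d : ℝ) := lt_of_le_of_lt (Nat.cast_nonneg N) hd0
  calc _ ≤ ∫ p, |g ⟪(p.1 : EuclideanSpace ℝ (Fin d)), (p.2 : EuclideanSpace ℝ (Fin d))⟫ - g 0| ∂σ :=
        abs_integral_le_integral_abs
    _ ≤ ∫ p, (ε / 2 + 1 / δ ^ 2 *
          ⟪(p.1 : EuclideanSpace ℝ (Fin d)), (p.2 : EuclideanSpace ℝ (Fin d))⟫ ^ 2) ∂σ :=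
        integral_mono (hgi.sub (integrable_const _)).abs
          ((integrable_const _).add (hsq.const_mul _)) fun p => hbound _
    _ = ε / 2 + 1 / δ ^ 2 * (1 / d) := by
        rw [integral_add (integrable_const _) (hsq.const_mul _), integral_const_mul,
          integral_inner_sq_prod_uniformSphere]
        simp
    _ < ε := by
        have h : 1 / δ ^ 2 * (1 / d) < ε / 2 := by
          rw [div_mul_div_comm, one_mul, div_lt_div_iff₀ (by positivity) two_pos]
          rw [div_lt_iff₀ (by positivity)] at hN
          have := mul_lt_mul_of_pos_right hd0 (show 0 < ε * δ ^ 2 by positivity)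
          linarith
        linarith

theorem tendsto_randomCollision {k : ℕ} {C : Set (EuclideanSpace ℝ (Fin k))}
    {dec : EuclideanSpace ℝ (Fin k) → EuclideanSpace ℝ (Fin k)} (hC : IsSphericalCode C)
    (hd : IsDecoder C dec) :
    Tendsto (fun d : ℕ => randomCollision dec d) atTop (𝓝 (indepCollision dec)) := by
  rw [indepCollision_eq_sum hC hd]
  have h := tendsto_finsetSum hC.1.toFinset fun u hu => tendsto_integral_inner_uniformSphere
    (measurable_noiseStability (measurableSet_voronoiCell C u)) (noiseStability_mem_Icc _)
    (tendsto_noiseStability (measurableSet_voronoiCell C u)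
      (frontier_voronoiCell_null hC (hC.1.mem_toFinset.1 hu)))
  refine h.congr' ?_
  filter_upwards [eventually_ge_atTop 1] with d hd1
  have : NeZero d := ⟨by omega⟩
  exact (randomCollision_eq_integral hC hd).symm

/-! ### Comparison of the exponents -/

theorem triangle_exponent_lt {θ : ℝ} (hθ0 : 0 < θ) (hθ1 : θ < Real.pi / 2) :
    Real.log (isogonalCollision 3 (Real.cos θ)) / Real.log (1 / 3) <
      -(Real.log (1 - θ / Real.pi) / Real.log 2) := by
  have hlog2 := Real.log_pos one_lt_two
  have hlog3 : 0 < Real.log 3 := Real.log_pos (by norm_num)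
  have h := lt_log_isogonalCollision_three hθ0 hθ1
  rw [one_div, Real.log_inv, div_neg, neg_lt_neg_iff, lt_div_iff₀ hlog3]
  calc _ = _ := by ring
    _ < _ := h

theorem two_exponent_eq {θ : ℝ} (hθ0 : 0 < θ) (hθ1 : θ < Real.pi / 2) :
    Real.log (isogonalCollision 2 (Real.cos θ)) / Real.log (1 / 2) =
      -(Real.log (1 - θ / Real.pi) / Real.log 2) := by
  rw [isogonalCollision_two hθ0.le (by linarith [Real.pi_pos]), one_div, Real.log_inv, div_neg]

theorem le_isogonal_exponent {θ n : ℝ} (hθ0 : 0 < θ) (hθ1 : θ < Real.pi / 2) (hn : 4 ≤ n) :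
    -(Real.log (1 - θ / Real.pi) / Real.log 2) ≤
      Real.log (isogonalCollision n (Real.cos θ)) / Real.log (1 / n) := by
  have hlogn : 0 < Real.log n := Real.log_pos (by linarith)
  have h := log_isogonalCollision_le hθ0 hθ1 hn
  rw [one_div, Real.log_inv, div_neg, neg_le_neg_iff, div_le_iff₀ hlogn]
  calc _ ≤ _ := h
    _ = _ := by ring

theorem mainTheorem3 :
    -- `indepCollision` is the large-dimension value of the random collision probability
    (∀ (k : ℕ) (C : Set (EuclideanSpace ℝ (Fin k)))
        (dec : EuclideanSpace ℝ (Fin k) → EuclideanSpace ℝ (Fin k)),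
        IsSphericalCode C → IsDecoder C dec →
        Tendsto (fun d : ℕ => randomCollision dec d) atTop (𝓝 (indepCollision dec))) ∧
    -- equilateral triangles are themselves two-dimensional isogonal spherical codes
    (∀ T : Set (EuclideanSpace ℝ (Fin 2)), IsEquilateralTriangle T →
        IsSphericalCode T ∧ IsIsogonal T) ∧
    ∀ θ : ℝ, θ ∈ Set.Ioo 0 (Real.pi / 2) →
      ∀ (T : Set (EuclideanSpace ℝ (Fin 2)))
        (decT : EuclideanSpace ℝ (Fin 2) → EuclideanSpace ℝ (Fin 2)),
        IsEquilateralTriangle T → IsDecoder T decT →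
      ∀ (d : ℕ) (x y : EuclideanSpace ℝ (Fin d)),
        ‖x‖ = 1 → ‖y‖ = 1 → InnerProductGeometry.angle x y = θ →
        -- the exponent of the triangle
        queryExponent decT x y =
          Real.log (1 / 3 + 3 * ((Real.pi - θ) / (2 * Real.pi)) ^ 2
            - 3 * (Real.arccos (1 / 2 * Real.cos θ) / (2 * Real.pi)) ^ 2) / Real.log (1 / 3) ∧
        -- optimality among all two-dimensional isogonal codes
        (∀ (C : Set (EuclideanSpace ℝ (Fin 2)))
            (dec : EuclideanSpace ℝ (Fin 2) → EuclideanSpace ℝ (Fin 2)),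
            IsSphericalCode C → IsIsogonal C → 2 ≤ C.ncard → IsDecoder C dec →
            queryExponent decT x y ≤ queryExponent dec x y) ∧
        -- strict improvement over two antipodal points (`k = 1` is hyperplane hashing)
        (∀ (k : ℕ) (v : EuclideanSpace ℝ (Fin k))
            (dec : EuclideanSpace ℝ (Fin k) → EuclideanSpace ℝ (Fin k)),
            ‖v‖ = 1 → IsDecoder {v, -v} dec →
            queryExponent decT x y < queryExponent dec x y) := by
  refine ⟨fun k C dec hC hd => tendsto_randomCollision hC hd,
    fun T hT => ⟨hT.isSphericalCode, hT.isIsogonal⟩, ?_⟩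
  rintro θ ⟨hθ0, hθ1⟩ T decT hT hdT d x y hx hy hangle
  have hpi := Real.pi_pos
  have hinner : ⟪x, y⟫ = Real.cos θ := by
    rw [← hangle, InnerProductGeometry.cos_angle, hx, hy, mul_one, div_one]
  have hc : ⟪x, y⟫ ^ 2 < 1 := by
    rw [hinner]
    have hs := Real.sin_pos_of_pos_of_lt_pi hθ0 (by linarith)
    nlinarith [Real.sin_sq_add_cos_sq θ]
  have hexp : ∀ (C : Set (EuclideanSpace ℝ (Fin 2)))
      (dec : EuclideanSpace ℝ (Fin 2) → EuclideanSpace ℝ (Fin 2)), IsSphericalCode C →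
      IsIsogonal C → 2 ≤ C.ncard → IsDecoder C dec → queryExponent dec x y =
        Real.log (isogonalCollision C.ncard (Real.cos θ)) / Real.log (1 / C.ncard) := by
    intro C dec hC hi hn hd
    rw [queryExponent, hi.pairCollision_eq hC hn hd hx hy hc, hi.indepCollision_eq hC hd, hinner]
  have hexpT := hexp T decT hT.isSphericalCode hT.isIsogonal (by rw [hT.2.1]; norm_num) hdT
  rw [hT.2.1, Nat.cast_ofNat] at hexpT
  have hlt := triangle_exponent_lt hθ0 hθ1
  refine ⟨?_, ?_, ?_⟩
  · rw [hexpT, isogonalCollision_three hθ0.le (by linarith)]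
  · intro C dec hC hi hn hd
    rw [hexpT, hexp C dec hC hi hn hd]
    -- The exponent of the 2-gon lies strictly above that of the triangle and at or below that of
    -- every code with four or more words.
    obtain h | h | h : C.ncard = 2 ∨ C.ncard = 3 ∨ 4 ≤ C.ncard := by omega
    · rw [h, Nat.cast_ofNat, two_exponent_eq hθ0 hθ1]
      exact hlt.le
    · rw [h, Nat.cast_ofNat]
    · exact hlt.le.trans (le_isogonal_exponent hθ0 hθ1 (by exact_mod_cast h))
  · intro k v dec hv hd
    rw [hexpT, queryExponent, pairCollision_pair hv hd hx hy hc, indepCollision_pair hv hd, hinner,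
      two_exponent_eq hθ0 hθ1]
    exact hlt
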